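/- Let $\mathcal M$ be a (finite-dimensional, Hausdorff, smooth, real) Lie group with Lie algebra $\mathfrak m$, $\mathcal K\subset\mathcal M$ a closed subgroup with Lie algebra $\mathfrak k$, and suppose $\mathcal B=\mathcal M/\mathcal K$ is connected and naturally reductive: $\mathfrak m=\mathfrak k\oplus\mathfrak b$ with $[\mathfrak k,\mathfrak b]\subset\mathfrak b$ and $\mathrm{Ad}(\mathcal K)\mathfrak b\subset\mathfrak b$, and $\mathfrak b$ carries an $\mathrm{Ad}(\mathcal K)$-invariant inner product $\langle\cdot,\cdot\rangle_{\mathfrak b}$ with $$\langle X,[Z,Y]_{\mathfrak b}\rangle_{\mathfrak b}+\langle [Z,X]_{\mathfrak b},Y\rangle_{\mathfrak b}=0\qquad(X,Y,Z\in\mathfrak b),$$ where $W=W_{\mathfrak k}+W_{\mathfrak b}$ is the decomposition of $W\in\mathfrak m$. Give $\mathcal B$ the quotient smooth structure, for which the projection $\mathfrak q:\mathcal M\to\mathcal B$ is a submersion, and the induced invariant Riemannian metric: $X\mapsto d\mathfrak q\,(d\mathcal L_UX)$ is an isometry from $\mathfrak b$ onto $T_{\mathfrak q(U)}\mathcal B$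 for each $U\in\mathcal M$, where $\mathcal L_U$ is left multiplication by $U$. For $U\in\mathcal M$ and $A\in\mathfrak b$ let $\gamma(t)=U\exp(tA)$, so that $\mathfrak q\circ\gamma$ is a geodesic of $\mathcal B$. For $C,E\in\mathfrak b$ let $\mathfrak J_{U,C,A,E}$ be the horizontal lift along $\gamma$ of the Jacobi field along $\mathfrak q\circ\gamma$ whose value and covariant derivative at $t=0$ are $d\mathfrak q(d\mathcal L_UC)$ and $d\mathfrak q(d\mathcal L_UE)$. Such a field is called isotropic if there is $X\in\mathfrak m$ with $\mathfrak J(t)=d\mathcal L_{\gamma(t)}\big(\exp(-t\,\mathrm{ad}_A)X\big)_{\mathfrak b}$ for all $t\in\mathbb R$. Let $\mathcal Z(x)=\frac{1-e^{-x}}{x}=\sum_{n\ge0}\frac{(-1)^n}{(n+1)!}x^n$. 1) $\mathfrak J_{U,C,A,E}$ is isotropic if and only if there is $X=X_{\mathfrak b}+X_{\mathfrak k}\in\mathfrak m$ such that $C=X_{\mathfrak b}$ and $E=-\tfrac12[A,C]_{\mathfrak b}-[A,X_{\mathfrak k}]$. In particular, $\mathfrak J_{U,0,A,E}$ is isotropic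 if and only if $E=-[A,D]$ for some $D\in\mathfrak k$. Also, $\mathfrak J_{U,C,A,-\frac12[A,C]_{\mathfrak b}}$ is isotropic. 2) For all $A\in\mathfrak b$, the map $\mathrm{ad}_A^{\mathfrak b}:X\mapsto[A,X]_{\mathfrak b}$ of $\mathfrak b$ is anti-self-adjoint for $\langle\cdot,\cdot\rangle_{\mathfrak b}$, and its complex eigenvalues have real part zero. If $\lambda\in\mathbb R$, $\lambda\ne0$, and $\lambda\sqrt{-1}$ is an eigenvalue of (the complexification of) $\mathrm{ad}_A^{\mathfrak b}$ with eigenvector $V+\sqrt{-1}V_*$, $V,V_*\in\mathfrak b$, then $[A,V]=-\lambda V_*+D_*$ and $[A,V_*]=\lambda V+D$ for some $D,D_*\in\mathfrak k$. If moreover $[A,D]=[A,D_*]=0$ (in particular, if $[A,\mathfrak k]=0$), then for all real $t\neq0$ $$(\mathcal Z(t\,\mathrm{ad}_A)V)_{\mathfrak b}=\frac{\sin t\lambda}{t\lambda}V-t\,\frac{1-\cos t\lambda}{(t\lambda)^2}[A,V]_{\mathfrak b},$$ while at $t=0$ the left side is $V$. Consequently $t(\mathcal Z(t\,\mathrm{ad}_A)V)_{\mathfrak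 b}=0$ for $t=\frac{2k\pi}{\lambda}$, $k\in\mathbb Z$, and for every $U\in\mathcal M$ the Jacobi field $\mathfrak J_{U,0,A,V}$ vanishes at those $t$. -/

import Mathlib

open scoped Manifold ContDiff Bundle TensorProduct

noncomputable section

namespace NatRed

/-! ### Riemannian geometry along curves, for a connection on the tangent bundle -/

section Connection

variable {E : Type*} [NormedAddCommGroup E] [NormedSpace ℝ E] [FiniteDimensional ℝ E]
  {M : Type*} [TopologicalSpace M] [ChartedSpace E M] [IsManifold 𝓘(ℝ, E) ∞ M]

/-- The velocity `c'(t)` of a curve. -/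
def velocity (c : ℝ → M) (t : ℝ) : TangentSpace 𝓘(ℝ, E) (c t) :=
  mfderiv 𝓘(ℝ, ℝ) 𝓘(ℝ, E) c t (1 : ℝ)

/-- The field `t ↦ J t` along the curve `c` is smooth, as a curve in the tangent bundle. -/
def IsSmoothFieldAlong (c : ℝ → M) (J : ∀ t, TangentSpace 𝓘(ℝ, E) (c t)) : Prop :=
  ContMDiff 𝓘(ℝ, ℝ) 𝓘(ℝ, E).tangent ∞
    (fun t : ℝ => (⟨c t, J t⟩ : TangentBundle 𝓘(ℝ, E) M))

/-- The covariant derivative `(D J / dt)(t)` along `c`. With `e₁, …, eₙ` the coordinate frame of the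
trivialization at `c t` and `J s = ∑ jⁱ(s) eᵢ(c s)` for `s` near `t`, it is
`∑ (jⁱ)'(t) eᵢ + ∇_{c'(t)} (∑ jⁱ(t) eᵢ)`; the local field `∑ jⁱ(t) eᵢ`, with constant coefficients
in that trivialization, is `FiberBundle.extend E (J t)`. -/
def covDerivAlong (nabla : CovariantDerivative 𝓘(ℝ, E) E (TangentSpace 𝓘(ℝ, E) : M → Type _))
    (c : ℝ → M) (J : ∀ t, TangentSpace 𝓘(ℝ, E) (c t)) (t : ℝ) : TangentSpace 𝓘(ℝ, E) (c t) :=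
  (trivializationAt E (TangentSpace 𝓘(ℝ, E) : M → Type _) (c t)).symm (c t)
      (deriv (fun s : ℝ =>
        (trivializationAt E (TangentSpace 𝓘(ℝ, E) : M → Type _) (c t) ⟨c s, J s⟩).2) t)
    + nabla (FiberBundle.extend E (J t)) (c t) (velocity c t)

/-- The curvature `R(x, y) z = ∇_X ∇_Y Z - ∇_Y ∇_X Z - ∇_{[X, Y]} Z`, for the local extensions
`X, Y, Z` of `x, y, z` which are constant in the trivialization at `p`. -/
def curvature (nabla : CovariantDerivative 𝓘(ℝ, E) E (TangentSpace 𝓘(ℝ, E) : M → Type _))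
    (p : M) (x y z : TangentSpace 𝓘(ℝ, E) p) : TangentSpace 𝓘(ℝ, E) p :=
  let X : ∀ r : M, TangentSpace 𝓘(ℝ, E) r := FiberBundle.extend E x
  let Y : ∀ r : M, TangentSpace 𝓘(ℝ, E) r := FiberBundle.extend E y
  let Z : ∀ r : M, TangentSpace 𝓘(ℝ, E) r := FiberBundle.extend E z
  nabla (fun r => nabla Z r (Y r)) p (X p) - nabla (fun r => nabla Z r (X r)) p (Y p)
    - nabla Z p (VectorField.mlieBracket 𝓘(ℝ, E) X Y p)

/-- `nabla` is the Levi-Civita connection: it is torsion-free, and compatible with the metric in the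
sense that `v⟨σ, τ⟩ = ⟨∇_v σ, τ⟩ + ⟨σ, ∇_v τ⟩` for fields `σ`, `τ` differentiable at `p`. -/
structure IsLeviCivita [Bundle.RiemannianBundle (fun p : M => TangentSpace 𝓘(ℝ, E) p)]
    (nabla : CovariantDerivative 𝓘(ℝ, E) E (TangentSpace 𝓘(ℝ, E) : M → Type _)) : Prop where
  torsion_free : nabla.torsion = 0
  metric : ∀ (p : M) (v : TangentSpace 𝓘(ℝ, E) p) (σ τ : ∀ r : M, TangentSpace 𝓘(ℝ, E) r),
    MDifferentiableAt 𝓘(ℝ, E) 𝓘(ℝ, E).tangent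
      (fun r => (⟨r, σ r⟩ : TangentBundle 𝓘(ℝ, E) M)) p →
    MDifferentiableAt 𝓘(ℝ, E) 𝓘(ℝ, E).tangent
      (fun r => (⟨r, τ r⟩ : TangentBundle 𝓘(ℝ, E) M)) p →
    (mfderiv 𝓘(ℝ, E) 𝓘(ℝ, ℝ) (fun r : M => (inner ℝ (σ r) (τ r) : ℝ)) p v : ℝ)
      = inner ℝ (nabla σ p v) (τ p) + inner ℝ (σ p) (nabla τ p v)

/-- `c` is a geodesic: it is smooth and its velocity is parallel. -/
structure IsGeodesic
    (nabla : CovariantDerivative 𝓘(ℝ, E) E (TangentSpace 𝓘(ℝ, E) : M → Type _))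
    (c : ℝ → M) : Prop where
  smooth : ContMDiff 𝓘(ℝ, ℝ) 𝓘(ℝ, E) ∞ c
  parallel : ∀ t, covDerivAlong nabla c (velocity c) t = 0

/-- The Jacobi equation `D²J/dt² + R(J, c') c' = 0` for a smooth field along `c`. -/
structure IsJacobiField
    (nabla : CovariantDerivative 𝓘(ℝ, E) E (TangentSpace 𝓘(ℝ, E) : M → Type _))
    (c : ℝ → M) (J : ∀ t, TangentSpace 𝓘(ℝ, E) (c t)) : Prop where
  smooth : IsSmoothFieldAlong c J
  equation : ∀ t, covDerivAlong nabla c (covDerivAlong nabla c J) t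
    + curvature nabla (c t) (J t) (velocity c t) (velocity c t) = 0

end Connection

/-! ### Lie groups -/

section LieGroup

variable {E : Type*} [NormedAddCommGroup E] [NormedSpace ℝ E]
  {G : Type*} [TopologicalSpace G] [ChartedSpace E G] [Group G]

/-- A smooth real Lie group has the smoothness under which Mathlib defines the Lie algebra. -/
instance instLieGroupMinSmoothness [LieGroup 𝓘(ℝ, E) ∞ G] :
    LieGroup 𝓘(ℝ, E) (minSmoothness ℝ 3) G := by
  rw [minSmoothness_of_isRCLikeNormedField]
  infer_instance

/-- The Lie algebra of the Lie group `G`. -/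
abbrev LieAlg (E : Type*) [NormedAddCommGroup E] [NormedSpace ℝ E]
    (G : Type*) [TopologicalSpace G] [ChartedSpace E G] [Group G] : Type _ :=
  GroupLieAlgebra 𝓘(ℝ, E) G

/-- `dL_U X`, the tangent vector at `U` which is the left translate of `X`. -/
abbrev leftTranslate (U : G) (X : LieAlg E G) : TangentSpace 𝓘(ℝ, E) U :=
  mulInvariantVectorField X U

/-- `γ` is the curve `t ↦ U exp (t A)`: the integral curve, with `γ 0 = U`, of the left-invariant
vector field defined by `A`. -/
structure IsExpCurve (U : G) (A : LieAlg E G) (γ : ℝ → G) : Prop where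
  integral : IsMIntegralCurve γ
    (mulInvariantVectorField A : (g : G) → TangentSpace 𝓘(ℝ, E) g)
  initial : γ 0 = U

/-- The adjoint representation `Ad(g)`, the differential at `1` of `x ↦ g x g⁻¹`. -/
def Ad (g : G) (X : LieAlg E G) : LieAlg E G :=
  mfderiv 𝓘(ℝ, E) 𝓘(ℝ, E) (fun x : G => g * x * g⁻¹) 1 X

/-- The value `∑ₙ c n Lⁿ v` of the power series `∑ₙ c n xⁿ` at the endomorphism `L`, applied to `v`. -/
def powerSeriesAt (c : ℕ → ℝ) (L : Module.End ℝ (LieAlg E G)) (v : LieAlg E G) : LieAlg E G :=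
  ∑' n : ℕ, c n • (L ^ n) v

/-- `exp(L) v`. -/
def expEnd (L : Module.End ℝ (LieAlg E G)) (v : LieAlg E G) : LieAlg E G :=
  powerSeriesAt (fun n => 1 / (n.factorial : ℝ)) L v

/-- `𝒵(L) v`, where `𝒵(x) = (1 - exp(-x)) / x = ∑ₙ (-1)ⁿ xⁿ / (n + 1)!`. -/
def calZ (L : Module.End ℝ (LieAlg E G)) (v : LieAlg E G) : LieAlg E G :=
  powerSeriesAt (fun n => (-1) ^ n / ((n + 1).factorial : ℝ)) L v

variable [FiniteDimensional ℝ E] [LieGroup 𝓘(ℝ, E) ∞ G]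

/-- The operator `ad_A` on the Lie algebra of `G`. -/
def adOp (A : LieAlg E G) : Module.End ℝ (LieAlg E G) :=
  LieAlgebra.ad ℝ (LieAlg E G) A

/-! ### Naturally reductive homogeneous spaces -/

/-- The data making `G ⧸ K` naturally reductive: the Lie algebra `𝔨` of `K`, a complement `𝔟` of it,
stable under `Ad(K)`, and an inner product on `𝔟`, invariant under `Ad(K)`, for which
`X ↦ [Z, X]_𝔟` is skew for all `Z ∈ 𝔟`. -/
structure NaturallyReductive (E : Type*) [NormedAddCommGroup E] [NormedSpace ℝ E]
    [FiniteDimensional ℝ E] {G : Type*} [TopologicalSpace G] [ChartedSpace E G] [Group G]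
    [LieGroup 𝓘(ℝ, E) ∞ G] (K : Subgroup G) where
  𝔨 : Submodule ℝ (LieAlg E G)
  /-- `𝔨 = {X | exp (t X) ∈ K for all t}` is the Lie algebra of `K`. -/
  mem_𝔨 : ∀ X : LieAlg E G, X ∈ 𝔨 ↔ ∃ γ : ℝ → G, IsExpCurve 1 X γ ∧ ∀ t, γ t ∈ K
  𝔟 : Submodule ℝ (LieAlg E G)
  isCompl : IsCompl 𝔟 𝔨
  bracket_mem : ∀ D ∈ 𝔨, ∀ X ∈ 𝔟, ⁅D, X⁆ ∈ 𝔟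
  Ad_mem : ∀ k ∈ K, ∀ X ∈ 𝔟, Ad k X ∈ 𝔟
  /-- The inner product on `𝔟`. -/
  form : LinearMap.BilinForm ℝ 𝔟
  form_symm : ∀ X Y, form X Y = form Y X
  form_pos : ∀ X, X ≠ 0 → 0 < form X X
  form_Ad : ∀ k (hk : k ∈ K) (X Y : 𝔟),
    form ⟨Ad k X, Ad_mem k hk X X.2⟩ ⟨Ad k Y, Ad_mem k hk Y Y.2⟩ = form X Y
  natural : ∀ X Y Z : 𝔟,
    form X (𝔟.projectionOnto 𝔨 isCompl ⁅(Z : LieAlg E G), (Y : LieAlg E G)⁆)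
      + form (𝔟.projectionOnto 𝔨 isCompl ⁅(Z : LieAlg E G), (X : LieAlg E G)⁆) Y = 0

namespace NaturallyReductive

variable {K : Subgroup G} (S : NaturallyReductive E K)

/-- The component `W_𝔟` of `W` in the decomposition `𝔪 = 𝔨 ⊕ 𝔟`. -/
def projB : LieAlg E G →ₗ[ℝ] S.𝔟 := S.𝔟.projectionOnto S.𝔨 S.isCompl

/-- The component `W_𝔨` of `W` in the decomposition `𝔪 = 𝔨 ⊕ 𝔟`. -/
def projK : LieAlg E G →ₗ[ℝ] S.𝔨 := S.𝔨.projectionOnto S.𝔟 S.isCompl.symm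

/-- The operator `ad_A^𝔟 : X ↦ [A, X]_𝔟` on `𝔟`. -/
def adB (A : S.𝔟) : Module.End ℝ S.𝔟 := S.projB ∘ₗ adOp (A : LieAlg E G) ∘ₗ S.𝔟.subtype

/-- A field along a curve in `G` is isotropic if it is
`t ↦ dL_{γ(t)} (exp(-t ad_A) X)_𝔟` for some `X` in the Lie algebra of `G`. -/
def IsIsotropic (A : S.𝔟) (γ : ℝ → G) (J : ∀ t, TangentSpace 𝓘(ℝ, E) (γ t)) : Prop :=
  ∃ X : LieAlg E G, ∀ t : ℝ, J t =
    leftTranslate (γ t) (S.projB (expEnd (-(t • adOp (A : LieAlg E G))) X) : LieAlg E G)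

section Quotient

variable {E' : Type*} [NormedAddCommGroup E'] [NormedSpace ℝ E'] [FiniteDimensional ℝ E']
  [ChartedSpace E' (G ⧸ K)]

/-- The differential at `U` of the projection `𝔮 : G → G ⧸ K`. -/
def dproj (E : Type*) [NormedAddCommGroup E] [NormedSpace ℝ E] {G : Type*} [TopologicalSpace G]
    [ChartedSpace E G] [Group G] (K : Subgroup G) (E' : Type*) [NormedAddCommGroup E']
    [NormedSpace ℝ E'] [ChartedSpace E' (G ⧸ K)] (U : G) :
    TangentSpace 𝓘(ℝ, E) U →L[ℝ] TangentSpace 𝓘(ℝ, E') (QuotientGroup.mk U : G ⧸ K) :=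
  mfderiv 𝓘(ℝ, E) 𝓘(ℝ, E') (QuotientGroup.mk : G → G ⧸ K) U

/-- The Riemannian metric of `G ⧸ K` is the invariant metric induced by the inner product of `𝔟`:
at `U K`, the map `X ↦ d𝔮 (dL_U X)` from `𝔟` preserves inner products. -/
def IsInducedMetric
    [Bundle.RiemannianBundle (fun p : G ⧸ K => TangentSpace 𝓘(ℝ, E') p)] : Prop :=
  ∀ (U : G) (X Y : S.𝔟),
    inner ℝ (dproj E K E' U (leftTranslate U (X : LieAlg E G)))
      (dproj E K E' U (leftTranslate U (Y : LieAlg E G))) = S.form X Y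

variable [IsManifold 𝓘(ℝ, E') ∞ (G ⧸ K)]

/-- `J = 𝔍_{U, C, A, E₀}` along `γ(t) = U exp(t A)`: it is horizontal, `d𝔮 J` is a smooth Jacobi
field on `G ⧸ K` along `𝔮 ∘ γ`, with `J(0) = dL_U C`, and the horizontal lift of
`(D/dt d𝔮 J)(0)` is `dL_U E₀`. -/
structure IsLiftedJacobiField
    (nabla : CovariantDerivative 𝓘(ℝ, E') E' (TangentSpace 𝓘(ℝ, E') : (G ⧸ K) → Type _))
    (γ : ℝ → G) (C E₀ : S.𝔟) (J : ∀ t, TangentSpace 𝓘(ℝ, E) (γ t)) : Prop where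
  smooth : IsSmoothFieldAlong γ J
  horizontal : ∀ t, ∃ X : S.𝔟, J t = leftTranslate (γ t) (X : LieAlg E G)
  jacobi : IsJacobiField nabla (fun t => (QuotientGroup.mk (γ t) : G ⧸ K))
    (fun t => dproj E K E' (γ t) (J t))
  value_zero : J 0 = leftTranslate (γ 0) (C : LieAlg E G)
  deriv_zero : covDerivAlong nabla (fun t => (QuotientGroup.mk (γ t) : G ⧸ K))
    (fun t => dproj E K E' (γ t) (J t)) 0
      = dproj E K E' (γ 0) (leftTranslate (γ 0) (E₀ : LieAlg E G))

end Quotient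

end NaturallyReductive

end LieGroup

end NatRed

end

open NatRed

/-! Everything is read in the left-invariant frame. A horizontal field along `γ` has the form
`dL_{γ(t)} x(t)` for a curve `x` in `𝔟`, and the geometry of `G ⧸ K` along `𝔮 ∘ γ` becomes linear
algebra with `ad_A`.

Connection: differentiating the projected field replaces its coordinate `x` by `x' + ½[A, x]_𝔟`
(`leftChr_eq`, `covDerivAlong_dprojLeft`). The deviation of the true derivative from this formula is
symmetric in its two arguments because the torsion vanishes. Paired with a third argument it is skew
in the last two, because the metric is parallel and `𝔟` is naturally reductive. These two symmetries
force it to be zero. The case `x = A` shows that `𝔮 ∘ γ` is a geodesic.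

Curvature: if `δ` is the one-parameter group of `A`, every curve `h` in `G` gives a variation `𝔮
(h(s) δ(t))` by geodesics, so its variation field is Jacobi. That field comes from `a(t)` with `a' =
-[A, a]`, and the Jacobi equation at `t = 0` yields `R(C, A)A = -(¼[A, [A, C]_𝔟]_𝔟 + [A, [A, C]_𝔨])`
(`curvature_dprojLeft`).

Isotropy: the Jacobi equation is now `x'' = [A, [A, x]_𝔨] - [A, x']_𝔟` with `x(0) = C` and `x'(0) =
E - ½[A, C]_𝔟` (`IsLiftedJacobiField.exists_isJacobiCurve`). The curve `(exp(-t ad_A) X)_𝔟` solves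
the same equation with initial values `X_𝔟` and `-[A, X]_𝔟`. By uniqueness for linear equations, the
field is isotropic exactly when the initial values match, which is the first claim.

Eigenvectors: natural reductivity says that `ad_A^𝔟` is skew, so its eigenvalues are imaginary and
`ad_A^𝔟` rotates the plane of `V` and `V_*`. If `ad_A` kills the two `𝔨`-components, then `ad_A² V`
is `-λ²` times `V` plus an element of `𝔨` killed by `ad_A`, and the series for `𝒵` splits into sine
and cosine series (`calZ_eq`). In the same situation `(sin(tλ)/λ) V + ((1 - cos(tλ))/λ) V_*` solves
the Jacobi equation with initial values `0` and `V`, and it vanishes at `t = 2kπ/λ`. -/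

noncomputable section

namespace NatRed

open scoped Topology

/-! ### Tangent vectors, vector fields and Lie brackets in a chart. -/

section Chart

set_option linter.unusedSectionVars false

variable {E : Type*} [NormedAddCommGroup E] [NormedSpace ℝ E]
  {M : Type*} [TopologicalSpace M] [ChartedSpace E M] [IsManifold 𝓘(ℝ, E) ∞ M]

/-- The coordinates of a tangent vector at `r` in the trivialization at `p`. -/
def tr (p r : M) : TangentSpace 𝓘(ℝ, E) r →L[ℝ] E :=
  (trivializationAt E (TangentSpace 𝓘(ℝ, E) : M → Type _) p).continuousLinearMapAt ℝ r

/-- The tangent vector at `r` with given coordinates in the trivialization at `p`. -/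
def ts (p r : M) : E →L[ℝ] TangentSpace 𝓘(ℝ, E) r :=
  (trivializationAt E (TangentSpace 𝓘(ℝ, E) : M → Type _) p).symmL ℝ r

theorem tr_ts {p r : M} (h : r ∈ (chartAt E p).source) (v : E) : tr p r (ts p r v) = v :=
  (trivializationAt E (TangentSpace 𝓘(ℝ, E) : M → Type _) p).continuousLinearMapAt_symmL h v

theorem ts_tr {p r : M} (h : r ∈ (chartAt E p).source) (v : TangentSpace 𝓘(ℝ, E) r) :
    ts p r (tr p r v) = v :=
  (trivializationAt E (TangentSpace 𝓘(ℝ, E) : M → Type _) p).symmL_continuousLinearMapAt h v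

theorem trivializationAt_snd {p r : M} (h : r ∈ (chartAt E p).source)
    (v : TangentSpace 𝓘(ℝ, E) r) :
    (trivializationAt E (TangentSpace 𝓘(ℝ, E) : M → Type _) p
      (⟨r, v⟩ : TangentBundle 𝓘(ℝ, E) M)).2 = tr p r v := by
  rw [tr, Bundle.Trivialization.continuousLinearMapAt_apply,
    Bundle.Trivialization.coe_linearMapAt_of_mem]
  exact h

theorem tr_eq_mfderiv {p r : M} (h : r ∈ (chartAt E p).source) :
    tr p r = mfderiv 𝓘(ℝ, E) 𝓘(ℝ, E) (extChartAt 𝓘(ℝ, E) p) r :=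
  TangentBundle.continuousLinearMapAt_trivializationAt h

theorem extend_apply {p r : M} (h : r ∈ (chartAt E p).source) (v : TangentSpace 𝓘(ℝ, E) p) :
    (FiberBundle.extend E v : ∀ r : M, TangentSpace 𝓘(ℝ, E) r) r = ts p r (tr p p v) := by
  rw [← trivializationAt_snd (mem_chart_source E p), FiberBundle.extend, ts]
  exact (Bundle.Trivialization.symmL_apply _ h _).symm

theorem mem_source_iff {p r : M} :
    r ∈ (chartAt E p).source ↔ r ∈ (extChartAt 𝓘(ℝ, E) p).source := by
  rw [extChartAt_source]

/-- The coordinate expression of a vector field in the chart at `p`. -/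
def hat (p : M) (X : ∀ r : M, TangentSpace 𝓘(ℝ, E) r) (x : E) : E :=
  tr p ((extChartAt 𝓘(ℝ, E) p).symm x) (X ((extChartAt 𝓘(ℝ, E) p).symm x))

theorem extChartAt_symm_apply {p r : M} (h : r ∈ (chartAt E p).source) :
    (extChartAt 𝓘(ℝ, E) p).symm (extChartAt 𝓘(ℝ, E) p r) = r :=
  (extChartAt 𝓘(ℝ, E) p).left_inv (mem_source_iff.1 h)

theorem hat_apply {p r : M} (h : r ∈ (chartAt E p).source)
    (X : ∀ r : M, TangentSpace 𝓘(ℝ, E) r) :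
    hat p X (extChartAt 𝓘(ℝ, E) p r) = tr p r (X r) := by
  rw [hat, extChartAt_symm_apply h]

theorem mem_chart_target {p : M} {x : E} (h : x ∈ (extChartAt 𝓘(ℝ, E) p).target) :
    (extChartAt 𝓘(ℝ, E) p).symm x ∈ (chartAt E p).source :=
  mem_source_iff.2 ((extChartAt 𝓘(ℝ, E) p).map_target h)

theorem target_mem_nhds {p r : M} (h : r ∈ (chartAt E p).source) :
    (extChartAt 𝓘(ℝ, E) p).target ∈ 𝓝 (extChartAt 𝓘(ℝ, E) p r) :=
  (isOpen_extChartAt_target p).mem_nhds ((extChartAt 𝓘(ℝ, E) p).map_source (mem_source_iff.1 h))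

theorem contMDiffAt_extChartAt_of_mem {p r : M} (h : r ∈ (chartAt E p).source) :
    ContMDiffAt 𝓘(ℝ, E) 𝓘(ℝ, E) ∞ (extChartAt 𝓘(ℝ, E) p) r :=
  contMDiffAt_extChartAt' h

theorem contMDiffAt_extChartAt_symm {p r : M} (h : r ∈ (chartAt E p).source) :
    ContMDiffAt 𝓘(ℝ, E) 𝓘(ℝ, E) ∞ (extChartAt 𝓘(ℝ, E) p).symm (extChartAt 𝓘(ℝ, E) p r) :=
  ((contMDiffOn_extChartAt_symm p).contMDiffAt (target_mem_nhds h))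

theorem mdifferentiableAt_section_iff_tr {p r : M} (h : r ∈ (chartAt E p).source)
    {X : ∀ r : M, TangentSpace 𝓘(ℝ, E) r} :
    MDifferentiableAt 𝓘(ℝ, E) 𝓘(ℝ, E).tangent
      (fun r => (⟨r, X r⟩ : TangentBundle 𝓘(ℝ, E) M)) r ↔
    DifferentiableAt ℝ (hat p X) (extChartAt 𝓘(ℝ, E) p r) := by
  rw [Bundle.Trivialization.mdifferentiableAt_section_iff (IB := 𝓘(ℝ, E))
    (trivializationAt E (TangentSpace 𝓘(ℝ, E) : M → Type _) p) X h, ← mdifferentiableAt_iff_differentiableAt]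
  have hs : ∀ᶠ r' in 𝓝 r, r' ∈ (chartAt E p).source := (chartAt E p).open_source.mem_nhds h
  constructor
  · intro H
    have H' : MDifferentiableAt 𝓘(ℝ, E) 𝓘(ℝ, E) (fun r' => tr p r' (X r')) r :=
      H.congr_of_eventuallyEq (hs.mono fun r' h' => (trivializationAt_snd h' _).symm)
    have := (contMDiffAt_extChartAt_symm h).mdifferentiableAt (by simp)
    rw [← extChartAt_symm_apply h] at H'
    exact H'.comp (extChartAt 𝓘(ℝ, E) p r) this
  · intro H
    have := (contMDiffAt_extChartAt_of_mem h).mdifferentiableAt (by simp)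
    refine (H.comp r this).congr_of_eventuallyEq (hs.mono fun r' h' => ?_)
    exact (trivializationAt_snd h' _).trans (hat_apply h' X).symm

theorem contMDiffAt_section_iff_tr {n : ℕ∞} {p r : M} (h : r ∈ (chartAt E p).source)
    {X : ∀ r : M, TangentSpace 𝓘(ℝ, E) r} :
    ContMDiffAt 𝓘(ℝ, E) 𝓘(ℝ, E).tangent n
      (fun r => (⟨r, X r⟩ : TangentBundle 𝓘(ℝ, E) M)) r ↔
    ContDiffAt ℝ n (hat p X) (extChartAt 𝓘(ℝ, E) p r) := by
  have : ContMDiffVectorBundle n E (TangentSpace 𝓘(ℝ, E) : M → Type _) 𝓘(ℝ, E) :=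
    ContMDiffVectorBundle.of_le (n := ∞) (by exact_mod_cast le_top)
  rw [Bundle.Trivialization.contMDiffAt_section_iff (IB := 𝓘(ℝ, E))
    (trivializationAt E (TangentSpace 𝓘(ℝ, E) : M → Type _) p) h, ← contMDiffAt_iff_contDiffAt]
  have hs : ∀ᶠ r' in 𝓝 r, r' ∈ (chartAt E p).source := (chartAt E p).open_source.mem_nhds h
  constructor
  · intro H
    have H' : ContMDiffAt 𝓘(ℝ, E) 𝓘(ℝ, E) n (fun r' => tr p r' (X r')) r :=
      H.congr_of_eventuallyEq (hs.mono fun r' h' => (trivializationAt_snd h' _).symm)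
    have := (contMDiffAt_extChartAt_symm h).of_le (m := n) (by exact_mod_cast le_top)
    rw [← extChartAt_symm_apply h] at H'
    exact H'.comp (extChartAt 𝓘(ℝ, E) p r) this
  · intro H
    have := (contMDiffAt_extChartAt_of_mem h).of_le (m := n) (by exact_mod_cast le_top)
    refine (H.comp r this).congr_of_eventuallyEq (hs.mono fun r' h' => ?_)
    exact (trivializationAt_snd h' _).trans (hat_apply h' X).symm

theorem hat_ts {p r : M} (h : r ∈ (chartAt E p).source) (v : E) :
    hat p (fun r => ts p r v) =ᶠ[𝓝 (extChartAt 𝓘(ℝ, E) p r)] fun _ => v := by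
  filter_upwards [target_mem_nhds h] with x hx
  exact tr_ts (mem_chart_target hx) v

theorem mdifferentiableAt_ts {p r : M} (h : r ∈ (chartAt E p).source) (v : E) :
    MDifferentiableAt 𝓘(ℝ, E) 𝓘(ℝ, E).tangent
      (fun r => (⟨r, ts p r v⟩ : TangentBundle 𝓘(ℝ, E) M)) r :=
  (mdifferentiableAt_section_iff_tr h).2
    ((differentiableAt_const v).congr_of_eventuallyEq (hat_ts h v))

theorem tr_velocity {c : ℝ → M} {t : ℝ} (hc : MDifferentiableAt 𝓘(ℝ, ℝ) 𝓘(ℝ, E) c t) {p : M}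
    (h : c t ∈ (chartAt E p).source) :
    HasDerivAt (fun s => extChartAt 𝓘(ℝ, E) p (c s)) (tr p (c t) (velocity c t)) t := by
  have h1 := ((contMDiffAt_extChartAt_of_mem h).mdifferentiableAt (by simp)).hasMFDerivAt
  have h2 := (h1.comp t hc.hasMFDerivAt).hasFDerivAt
  rw [tr_eq_mfderiv h]
  let L : ℝ →L[ℝ] E := (mfderiv 𝓘(ℝ, E) 𝓘(ℝ, E) (extChartAt 𝓘(ℝ, E) p) (c t)).comp
    (mfderiv 𝓘(ℝ, ℝ) 𝓘(ℝ, E) c t)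
  have h3 : HasFDerivAt (fun s => extChartAt 𝓘(ℝ, E) p (c s)) L t := h2
  exact h3.hasDerivAt

/-- The derivative of a map between manifolds, in terms of the curves it transports. -/
theorem velocity_comp {E' : Type*} [NormedAddCommGroup E'] [NormedSpace ℝ E']
    {N : Type*} [TopologicalSpace N] [ChartedSpace E' N] {f : M → N} {c : ℝ → M} {t : ℝ}
    (hf : MDifferentiableAt 𝓘(ℝ, E) 𝓘(ℝ, E') f (c t))
    (hc : MDifferentiableAt 𝓘(ℝ, ℝ) 𝓘(ℝ, E) c t) :
    velocity (fun s => f (c s)) t = mfderiv 𝓘(ℝ, E) 𝓘(ℝ, E') f (c t) (velocity c t) := by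
  have := mfderiv_comp t hf hc
  exact congrArg (fun L => L (1 : ℝ)) this

theorem ts_eq_inverse {p r : M} (h : r ∈ (chartAt E p).source) (v : E) :
    (mfderiv 𝓘(ℝ, E) 𝓘(ℝ, E) (extChartAt 𝓘(ℝ, E) p) r).inverse v = ts p r v := by
  rw [← tr_eq_mfderiv h]
  have : (tr p r).inverse = ts p r :=
    ContinuousLinearMap.inverse_eq (ContinuousLinearMap.ext (tr_ts h))
      (ContinuousLinearMap.ext (ts_tr h))
  exact congrArg (fun L => L v) this

/-- Near `r` each field is the pullback of its coordinate expression by the chart, and pullback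
commutes with brackets, so the bracket is the one of the model space. -/
theorem tr_mlieBracket [CompleteSpace E] {p r : M} (h : r ∈ (chartAt E p).source)
    {X Y : ∀ r : M, TangentSpace 𝓘(ℝ, E) r}
    (hX : MDifferentiableAt 𝓘(ℝ, E) 𝓘(ℝ, E).tangent
      (fun r => (⟨r, X r⟩ : TangentBundle 𝓘(ℝ, E) M)) r)
    (hY : MDifferentiableAt 𝓘(ℝ, E) 𝓘(ℝ, E).tangent
      (fun r => (⟨r, Y r⟩ : TangentBundle 𝓘(ℝ, E) M)) r) :
    tr p r (VectorField.mlieBracket 𝓘(ℝ, E) X Y r) =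
      fderiv ℝ (hat p Y) (extChartAt 𝓘(ℝ, E) p r) (tr p r (X r))
        - fderiv ℝ (hat p X) (extChartAt 𝓘(ℝ, E) p r) (tr p r (Y r)) := by
  have : IsManifold 𝓘(ℝ, E) (minSmoothness ℝ 2) M := by
    rw [minSmoothness_of_isRCLikeNormedField]; infer_instance
  have : IsManifold 𝓘(ℝ, E) (minSmoothness ℝ 3) M := by
    rw [minSmoothness_of_isRCLikeNormedField]; infer_instance
  let H (X : ∀ r : M, TangentSpace 𝓘(ℝ, E) r) : ∀ x : E, TangentSpace 𝓘(ℝ, E) x := hat p X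
  have key : ∀ X : ∀ r : M, TangentSpace 𝓘(ℝ, E) r,
      VectorField.mpullback 𝓘(ℝ, E) 𝓘(ℝ, E) (extChartAt 𝓘(ℝ, E) p) (H X) =ᶠ[𝓝 r] X := by
    intro X
    filter_upwards [(chartAt E p).open_source.mem_nhds h] with r' h'
    rw [VectorField.mpullback_apply]
    refine (ts_eq_inverse h' _).trans ?_
    exact (congrArg (ts p r') (hat_apply h' X)).trans (ts_tr h' _)
  have hd : ∀ X : ∀ r : M, TangentSpace 𝓘(ℝ, E) r,
      MDifferentiableAt 𝓘(ℝ, E) 𝓘(ℝ, E).tangent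
        (fun r => (⟨r, X r⟩ : TangentBundle 𝓘(ℝ, E) M)) r →
      MDifferentiableAt 𝓘(ℝ, E) 𝓘(ℝ, E).tangent
        (fun x => (⟨x, H X x⟩ : TangentBundle 𝓘(ℝ, E) E)) (extChartAt 𝓘(ℝ, E) p r) := by
    intro X hX
    rw [mdifferentiableAt_section]
    have := ((mdifferentiableAt_section_iff_tr h).1 hX).mdifferentiableAt
    refine this.congr_of_eventuallyEq (Filter.Eventually.of_forall fun x => ?_)
    simp [H]
  have := VectorField.mpullback_mlieBracket (n := ∞) (hd X hX) (hd Y hY)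
    (contMDiffAt_extChartAt_of_mem h)
    (by rw [minSmoothness_of_isRCLikeNormedField]; norm_cast)
  rw [VectorField.mpullback_apply,
    Filter.EventuallyEq.mlieBracket_vectorField_eq (key X) (key Y)] at this
  rw [← this]
  refine ((congrArg (tr p r) (ts_eq_inverse h _)).trans (tr_ts h _)).trans ?_
  rw [← VectorField.mlieBracketWithin_univ, VectorField.mlieBracketWithin_eq_lieBracketWithin,
    VectorField.lieBracketWithin_univ, ← hat_apply h, ← hat_apply h]
  rfl

end Chart

/-- In finite dimension an operator is determined linearly by its values on a basis, so smoothness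
can be tested vector by vector. -/
theorem contDiffAt_clm_apply_iff {n : ℕ∞ω} {D E F : Type*} [NormedAddCommGroup D]
    [NormedSpace ℝ D] [NormedAddCommGroup E] [NormedSpace ℝ E] [NormedAddCommGroup F]
    [NormedSpace ℝ F] [FiniteDimensional ℝ E] {f : D → E →L[ℝ] F} {x : D} :
    ContDiffAt ℝ n f x ↔ ∀ y, ContDiffAt ℝ n (fun x => f x y) x := by
  refine ⟨fun h y => h.clm_apply contDiffAt_const, fun h => ?_⟩
  let d := Module.finrank ℝ E
  have hd : d = Module.finrank ℝ (Fin d → ℝ) := (Module.finrank_fin_fun ℝ).symm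
  let e₁ := ContinuousLinearEquiv.ofFinrankEq hd
  let e₂ := (e₁.arrowCongr (1 : F ≃L[ℝ] F)).trans (ContinuousLinearEquiv.piRing (Fin d))
  rw [← Function.id_comp f, ← e₂.symm_comp_self]
  exact e₂.symm.contDiff.contDiffAt.comp x (contDiffAt_pi.mpr fun i => h _)

/-! ### Christoffel symbols, the metric in coordinates, and Koszul's formula. -/

section Christoffel

set_option linter.unusedSectionVars false

variable {E : Type*} [NormedAddCommGroup E] [NormedSpace ℝ E] [FiniteDimensional ℝ E]
  {M : Type*} [TopologicalSpace M] [ChartedSpace E M] [IsManifold 𝓘(ℝ, E) ∞ M]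
  (nabla : CovariantDerivative 𝓘(ℝ, E) E (TangentSpace 𝓘(ℝ, E) : M → Type _))

/-- The Christoffel symbols in the chart at `p`: `chr nabla p x v w` is the coordinate expression of
the derivative in the direction `w` of the field with constant coordinates `v`. -/
def chr (p : M) (x : E) : E →L[ℝ] E →L[ℝ] E :=
  ∑ i, (LinearMap.toContinuousLinearMap ((Module.finBasis ℝ E).coord i)).smulRight
    ((tr p ((extChartAt 𝓘(ℝ, E) p).symm x)).comp
      ((nabla (fun r => ts p r (Module.finBasis ℝ E i)) ((extChartAt 𝓘(ℝ, E) p).symm x)).comp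
        (ts p ((extChartAt 𝓘(ℝ, E) p).symm x))))

theorem chr_eq_sum {p r : M} (h : r ∈ (chartAt E p).source) (v : E)
    (w : TangentSpace 𝓘(ℝ, E) r) :
    chr nabla p (extChartAt 𝓘(ℝ, E) p r) v (tr p r w) =
      ∑ i, (Module.finBasis ℝ E).coord i v •
        tr p r (nabla (fun r => ts p r (Module.finBasis ℝ E i)) r w) := by
  rw [chr, sum_apply, sum_apply]
  refine Finset.sum_congr rfl fun i _ => ?_
  rw [extChartAt_symm_apply h]
  change (Module.finBasis ℝ E).coord i v • tr p r (nabla _ r (ts p r (tr p r w))) = _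
  rw [ts_tr h]

/-- Differentiability and the formula are proved together because additivity of `nabla` needs the
partial sums to be differentiable. -/
theorem nabla_sum {ι : Type*} (s : Finset ι) {r : M}
    (f : ι → M → ℝ) (hf : ∀ i, MDifferentiableAt 𝓘(ℝ, E) 𝓘(ℝ, ℝ) (f i) r)
    (X : ι → ∀ r : M, TangentSpace 𝓘(ℝ, E) r)
    (hX : ∀ i, MDifferentiableAt 𝓘(ℝ, E) 𝓘(ℝ, E).tangent
      (fun r => (⟨r, X i r⟩ : TangentBundle 𝓘(ℝ, E) M)) r) (w : TangentSpace 𝓘(ℝ, E) r) :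
    MDifferentiableAt 𝓘(ℝ, E) 𝓘(ℝ, E).tangent
      (fun r => (⟨r, (∑ i ∈ s, f i • X i) r⟩ : TangentBundle 𝓘(ℝ, E) M)) r ∧
    nabla (∑ i ∈ s, f i • X i) r w =
      ∑ i ∈ s, (f i r • nabla (X i) r w + mvfderiv 𝓘(ℝ, E) (f i) r w • X i r) := by
  classical
  induction s using Finset.induction_on with
  | empty =>
    refine ⟨?_, ?_⟩
    · simpa using! (Bundle.mdifferentiable_zeroSection ℝ (TangentSpace 𝓘(ℝ, E) : M → Type _)
        (IB := 𝓘(ℝ, E)) (F := E)) r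
    · simp
  | insert i s hi ih =>
    simp only [Finset.sum_insert hi]
    have hs : MDifferentiableAt 𝓘(ℝ, E) 𝓘(ℝ, E).tangent
      (fun r => (⟨r, (f i • X i) r⟩ : TangentBundle 𝓘(ℝ, E) M)) r := (hf i).smul_section (hX i)
    refine ⟨mdifferentiableAt_add_section hs ih.1, ?_⟩
    rw [nabla.isCovariantDerivativeOn.add hs ih.1 (Set.mem_univ r),
      nabla.isCovariantDerivativeOn.leibniz (hX i) (hf i) (Set.mem_univ r), ← ih.2]
    rfl

theorem mvfderiv_comp_extChartAt {p r : M} (h : r ∈ (chartAt E p).source) {g : E → ℝ}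
    (hg : DifferentiableAt ℝ g (extChartAt 𝓘(ℝ, E) p r)) (w : TangentSpace 𝓘(ℝ, E) r) :
    (mfderiv 𝓘(ℝ, E) 𝓘(ℝ, ℝ) (fun r => g (extChartAt 𝓘(ℝ, E) p r)) r w : ℝ) =
      fderiv ℝ g (extChartAt 𝓘(ℝ, E) p r) (tr p r w) := by
  have h1 := mfderiv_comp r hg.mdifferentiableAt
    ((contMDiffAt_extChartAt_of_mem h).mdifferentiableAt (by simp))
  rw [tr_eq_mfderiv h, ← mfderiv_eq_fderiv]
  exact congrArg (fun L => L w) h1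

/-- Expand `X` in the frame of constant-coordinate fields and apply the Leibniz rule: the
coefficients give the ordinary derivative, the frame gives the Christoffel term. -/
theorem nabla_eq {p r : M} (h : r ∈ (chartAt E p).source) {X : ∀ r : M, TangentSpace 𝓘(ℝ, E) r}
    (hX : DifferentiableAt ℝ (hat p X) (extChartAt 𝓘(ℝ, E) p r)) (w : TangentSpace 𝓘(ℝ, E) r) :
    tr p r (nabla X r w) = fderiv ℝ (hat p X) (extChartAt 𝓘(ℝ, E) p r) (tr p r w)
      + chr nabla p (extChartAt 𝓘(ℝ, E) p r) (tr p r (X r)) (tr p r w) := by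
  set b := Module.finBasis ℝ E with hb
  let g (i) (x : E) : ℝ := b.coord i (hat p X x)
  have hg (i) : DifferentiableAt ℝ (g i) (extChartAt 𝓘(ℝ, E) p r) :=
    (LinearMap.toContinuousLinearMap (b.coord i)).differentiableAt.comp _ hX
  let f (i) (r : M) : ℝ := g i (extChartAt 𝓘(ℝ, E) p r)
  have hf (i) : MDifferentiableAt 𝓘(ℝ, E) 𝓘(ℝ, ℝ) (f i) r :=
    (hg i).mdifferentiableAt.comp r
      ((contMDiffAt_extChartAt_of_mem h).mdifferentiableAt (by simp))
  obtain ⟨h1, h2⟩ := nabla_sum nabla Finset.univ f hf (fun i r => ts p r (b i))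
    (fun i => mdifferentiableAt_ts h (b i)) w
  -- The expansion holds only on the chart domain, so locality of `nabla` is what transfers it.
  have h3 : nabla X r = nabla (∑ i, f i • fun r => ts p r (b i)) r := by
    refine nabla.isCovariantDerivativeOnUniv.congr_of_eventuallyEq
      ((mdifferentiableAt_section_iff_tr h).2 hX) h1 Filter.univ_mem ?_
    filter_upwards [(chartAt E p).open_source.mem_nhds h] with r' h'
    have : (∑ i, f i • fun r => ts p r (b i) : ∀ r : M, TangentSpace 𝓘(ℝ, E) r) r'
        = ts p r' (∑ i, b.coord i (tr p r' (X r')) • b i) := by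
      rw [Finset.sum_apply, map_sum]
      refine Finset.sum_congr rfl fun i _ => ?_
      rw [map_smul, ← hat_apply h']
      rfl
    rw [this]
    simp only [Module.Basis.coord_apply, Module.Basis.sum_repr]
    exact (ts_tr h' _).symm
  rw [h3, h2, map_sum, chr_eq_sum nabla h]
  simp only [map_add, map_smul, Finset.sum_add_distrib]
  rw [add_comm]
  congr 1
  · conv_rhs => rw [← b.sum_repr (fderiv ℝ (hat p X) (extChartAt 𝓘(ℝ, E) p r) (tr p r w))]
    refine Finset.sum_congr rfl fun i _ => ?_
    rw [tr_ts h]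
    congr 1
    refine (mvfderiv_comp_extChartAt h (hg i) w).trans ?_
    have := ((LinearMap.toContinuousLinearMap (b.coord i)).hasFDerivAt.comp _ hX.hasFDerivAt).fderiv
    exact congrArg (fun L => L (tr p r w)) this
  · refine Finset.sum_congr rfl fun i _ => ?_
    rw [← hat_apply h]

theorem nabla_ts {p r : M} (h : r ∈ (chartAt E p).source) (v : E) (w : TangentSpace 𝓘(ℝ, E) r) :
    tr p r (nabla (fun r => ts p r v) r w) =
      chr nabla p (extChartAt 𝓘(ℝ, E) p r) v (tr p r w) := by
  rw [nabla_eq nabla h ((mdifferentiableAt_section_iff_tr h).1 (mdifferentiableAt_ts h v)),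
    (hat_ts h v).fderiv_eq, tr_ts h]
  simp

variable {nabla}

/-- Fields with constant coordinates commute, so vanishing torsion is the symmetry of the
Christoffel symbols. -/
theorem chr_symm [Bundle.RiemannianBundle (fun p : M => TangentSpace 𝓘(ℝ, E) p)]
    (hn : IsLeviCivita nabla) {p : M} {x : E} (hx : x ∈ (extChartAt 𝓘(ℝ, E) p).target) (v w : E) :
    chr nabla p x v w = chr nabla p x w v := by
  obtain ⟨r, h, rfl⟩ : ∃ r ∈ (chartAt E p).source, extChartAt 𝓘(ℝ, E) p r = x :=
    ⟨_, mem_chart_target hx, (extChartAt 𝓘(ℝ, E) p).right_inv hx⟩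
  have : CompleteSpace E := FiniteDimensional.complete ℝ E
  have h1 := nabla.torsion_eq_zero_iff.1 hn.torsion_free (mdifferentiableAt_ts h w)
    (mdifferentiableAt_ts h v)
  have h2 := congrArg (tr p r) h1
  rw [tr_mlieBracket h (mdifferentiableAt_ts h w) (mdifferentiableAt_ts h v), map_sub,
    nabla_ts nabla h, nabla_ts nabla h, tr_ts h, tr_ts h, (hat_ts h v).fderiv_eq,
    (hat_ts h w).fderiv_eq] at h2
  simpa [sub_eq_zero] using h2

section Metric

variable [Bundle.RiemannianBundle (fun p : M => TangentSpace 𝓘(ℝ, E) p)]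

/-- The coordinate expression of the metric in the chart at `p`, as a bilinear map. -/
def metLin (p : M) (x : E) : E →ₗ[ℝ] E →ₗ[ℝ] ℝ :=
  LinearMap.mk₂ ℝ (fun v w => inner ℝ (ts p ((extChartAt 𝓘(ℝ, E) p).symm x) v)
      (ts p ((extChartAt 𝓘(ℝ, E) p).symm x) w))
    (fun v v' w => by rw [map_add, inner_add_left])
    (fun c v w => by rw [map_smul, real_inner_smul_left]; rfl)
    (fun v w w' => by rw [map_add, inner_add_right])
    (fun c v w => by rw [map_smul, real_inner_smul_right]; rfl)

/-- The coordinate expression of the metric in the chart at `p`. -/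
def met (p : M) (x : E) : E →L[ℝ] E →L[ℝ] ℝ :=
  LinearMap.toContinuousLinearMap
    ((LinearMap.toContinuousLinearMap (𝕜 := ℝ) (E := E) (F' := ℝ)).toLinearMap ∘ₗ metLin p x)

theorem met_apply (p : M) (x v w : E) :
    met p x v w = inner ℝ (ts p ((extChartAt 𝓘(ℝ, E) p).symm x) v)
      (ts p ((extChartAt 𝓘(ℝ, E) p).symm x) w) := rfl

theorem met_tr {p r : M} (h : r ∈ (chartAt E p).source) (v w : TangentSpace 𝓘(ℝ, E) r) :
    met p (extChartAt 𝓘(ℝ, E) p r) (tr p r v) (tr p r w) = inner ℝ v w := by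
  rw [met_apply, extChartAt_symm_apply h, ts_tr h, ts_tr h]

theorem met_symm (p : M) (x v w : E) : met p x v w = met p x w v := by
  rw [met_apply, met_apply, real_inner_comm]

theorem met_injective {p : M} {x : E} (hx : x ∈ (extChartAt 𝓘(ℝ, E) p).target) :
    Function.Injective (met p x) := by
  rw [injective_iff_map_eq_zero]
  intro v hv
  have h1 : met p x v v = 0 := by rw [hv]; rfl
  rw [met_apply, inner_self_eq_zero] at h1
  rw [← tr_ts (mem_chart_target hx) v, h1, map_zero]

/-- Positivity makes the map from vectors to covectors injective, and the dimensions agree. -/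
theorem met_isInvertible {p : M} {x : E} (hx : x ∈ (extChartAt 𝓘(ℝ, E) p).target) :
    (met p x).IsInvertible := by
  have hfin : Module.finrank ℝ E = Module.finrank ℝ (E →L[ℝ] ℝ) := by
    rw [← (LinearMap.toContinuousLinearMap (𝕜 := ℝ) (E := E) (F' := ℝ)).finrank_eq]
    exact (Subspace.dual_finrank_eq (K := ℝ) (V := E)).symm
  refine ⟨(LinearEquiv.ofInjectiveOfFinrankEq (met p x : E →ₗ[ℝ] E →L[ℝ] ℝ)
    (met_injective hx) hfin).toContinuousLinearEquiv, ?_⟩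
  ext v w
  rfl

variable [IsContMDiffRiemannianBundle 𝓘(ℝ, E) ∞ E (fun p : M => TangentSpace 𝓘(ℝ, E) p)]

theorem contDiffAt_met {p : M} {x : E} (hx : x ∈ (extChartAt 𝓘(ℝ, E) p).target) :
    ContDiffAt ℝ ∞ (met p) x := by
  obtain ⟨r, h, rfl⟩ : ∃ r ∈ (chartAt E p).source, extChartAt 𝓘(ℝ, E) p r = x :=
    ⟨_, mem_chart_target hx, (extChartAt 𝓘(ℝ, E) p).right_inv hx⟩
  rw [contDiffAt_clm_apply_iff]
  intro v
  rw [contDiffAt_clm_apply_iff]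
  intro w
  have hs : ∀ v : E, ContMDiffAt 𝓘(ℝ, E) 𝓘(ℝ, E).tangent ∞
      (fun x => (⟨(extChartAt 𝓘(ℝ, E) p).symm x, ts p ((extChartAt 𝓘(ℝ, E) p).symm x) v⟩ :
        TangentBundle 𝓘(ℝ, E) M)) (extChartAt 𝓘(ℝ, E) p r) := by
    intro v
    have h1 := (contMDiffAt_section_iff_tr (n := ⊤) h).2
      (contDiffAt_const.congr_of_eventuallyEq (hat_ts h v))
    rw [← extChartAt_symm_apply h] at h1
    exact h1.comp (extChartAt 𝓘(ℝ, E) p r) (contMDiffAt_extChartAt_symm h)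
  have h2 := ContMDiffAt.inner_bundle (IB := 𝓘(ℝ, E)) (F := E) (n := ∞)
    (E := fun p : M => TangentSpace 𝓘(ℝ, E) p) (b := (extChartAt 𝓘(ℝ, E) p).symm)
    (v := fun x => ts p ((extChartAt 𝓘(ℝ, E) p).symm x) v)
    (w := fun x => ts p ((extChartAt 𝓘(ℝ, E) p).symm x) w) (hs v) (hs w)
  exact h2.contDiffAt

theorem fderiv_met_apply {p : M} {x : E} (hx : x ∈ (extChartAt 𝓘(ℝ, E) p).target) (u v w : E) :
    fderiv ℝ (fun x => met p x u v) x w = fderiv ℝ (met p) x w u v := by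
  have hd : DifferentiableAt ℝ (met p) x := (contDiffAt_met hx).differentiableAt (by simp)
  rw [((hd.hasFDerivAt.clm_apply (hasFDerivAt_const u _)).clm_apply
      (hasFDerivAt_const v _)).fderiv]
  simp

/-- This is compatibility with the metric, applied to two fields with constant coordinates. -/
theorem fderiv_met (hn : IsLeviCivita nabla) {p : M} {x : E}
    (hx : x ∈ (extChartAt 𝓘(ℝ, E) p).target) (u v w : E) :
    fderiv ℝ (met p) x w u v =
      met p x (chr nabla p x u w) v + met p x u (chr nabla p x v w) := by
  obtain ⟨r, h, rfl⟩ : ∃ r ∈ (chartAt E p).source, extChartAt 𝓘(ℝ, E) p r = x :=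
    ⟨_, mem_chart_target hx, (extChartAt 𝓘(ℝ, E) p).right_inv hx⟩
  have hd : DifferentiableAt ℝ (met p) (extChartAt 𝓘(ℝ, E) p r) :=
    (contDiffAt_met hx).differentiableAt (by simp)
  have h1 := hn.metric r (ts p r w) _ _ (mdifferentiableAt_ts h u) (mdifferentiableAt_ts h v)
  have hd' : DifferentiableAt ℝ (fun x => met p x u v) (extChartAt 𝓘(ℝ, E) p r) :=
    (hd.clm_apply (differentiableAt_const u)).clm_apply (differentiableAt_const v)
  have h2 := mvfderiv_comp_extChartAt h hd' (ts p r w)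
  have h3 : (fun r => met p (extChartAt 𝓘(ℝ, E) p r) u v) =ᶠ[𝓝 r]
      fun r => inner ℝ (ts p r u) (ts p r v) := by
    filter_upwards [(chartAt E p).open_source.mem_nhds h] with r' h'
    rw [met_apply, extChartAt_symm_apply h']
  rw [h3.mfderiv_eq] at h2
  have h4 := fderiv_met_apply hx u v w
  rw [tr_ts h, h4] at h2
  have h6 : ∀ a b : E, nabla (fun r => ts p r a) r (ts p r b) =
      ts p r (chr nabla p (extChartAt 𝓘(ℝ, E) p r) a b) := fun a b => by
    rw [← ts_tr h (nabla _ r _), nabla_ts nabla h, tr_ts h]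
  rw [h6, h6] at h1
  have h7 : ∀ a b : E, met p (extChartAt 𝓘(ℝ, E) p r) a b = inner ℝ (ts p r a) (ts p r b) :=
    fun a b => by rw [met_apply, extChartAt_symm_apply h]
  rw [← h2, h7 (chr nabla p _ u w) v, h7 u (chr nabla p _ v w)]
  exact h1

theorem koszul (hn : IsLeviCivita nabla) {p : M} {x : E}
    (hx : x ∈ (extChartAt 𝓘(ℝ, E) p).target) (u v w : E) :
    met p x (chr nabla p x u w) v = (1 / 2 : ℝ) * (fderiv ℝ (met p) x w u v
      + fderiv ℝ (met p) x u w v - fderiv ℝ (met p) x v u w) := by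
  rw [fderiv_met hn hx, fderiv_met hn hx, fderiv_met hn hx, chr_symm hn hx w u,
    chr_symm hn hx v w, chr_symm hn hx v u, met_symm p x w]
  ring

/-- By Koszul's formula the Christoffel symbols are the inverse metric applied to first derivatives
of the metric, so they inherit smoothness from the metric. The curvature and the Jacobi equation
need them to be differentiable. -/
theorem contDiffAt_chr (hn : IsLeviCivita nabla) {p : M} {x : E}
    (hx : x ∈ (extChartAt 𝓘(ℝ, E) p).target) : ContDiffAt ℝ ∞ (chr nabla p) x := by
  rw [contDiffAt_clm_apply_iff]
  intro u
  rw [contDiffAt_clm_apply_iff]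
  intro w
  let D := fderiv ℝ (met (E := E) p)
  -- The right side of Koszul's formula as a covector; the two flips leave free the slot for the
  -- direction of differentiation.
  let K (x : E) : E →L[ℝ] ℝ := (1 / 2 : ℝ) • (D x w u + D x u w - ((D x).flip u).flip w)
  have hm := contDiffAt_met hx
  have hK : ContDiffAt ℝ ∞ K x := by
    rw [contDiffAt_clm_apply_iff]
    intro v
    have h (a b c : E) : ContDiffAt ℝ ∞ (fun x => D x a b c) x := by
      have h1 : ContDiffAt ℝ ∞ (fun x => met p x b c) x :=
        (hm.clm_apply contDiffAt_const).clm_apply contDiffAt_const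
      have h2 : ContDiffAt ℝ ∞ (fderiv ℝ (fun x => met p x b c)) x :=
        h1.fderiv_right (m := ∞) (by simp)
      refine (h2.clm_apply (contDiffAt_const (c := a))).congr_of_eventuallyEq ?_
      filter_upwards [(isOpen_extChartAt_target p).mem_nhds hx] with y hy
      exact (fderiv_met_apply hy b c a).symm
    exact contDiffAt_const.mul (((h w u v).add (h u w v)).sub (h v u w))
  have hi : ContDiffAt ℝ ∞ (fun x => (met p x).inverse (K x)) x :=
    ((met_isInvertible hx).contDiffAt_map_inverse.comp x hm).clm_apply hK
  refine hi.congr_of_eventuallyEq ?_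
  filter_upwards [(isOpen_extChartAt_target p).mem_nhds hx] with y hy
  have : met p y (chr nabla p y u w) = K y := by
    ext v
    exact koszul hn hy u v w
  rw [← this, ← ContinuousLinearMap.comp_apply, (met_isInvertible hy).inverse_comp_self]
  rfl

end Metric

end Christoffel

/-! ### Variations by geodesics, curvature and covariant derivatives in coordinates. -/

section Variation

set_option linter.unusedSectionVars false
set_option synthInstance.maxHeartbeats 400000
set_option maxHeartbeats 1000000

variable {E : Type*} [NormedAddCommGroup E] [NormedSpace ℝ E]

theorem hasDerivAt_bilin {F : Type*} [NormedAddCommGroup F] [NormedSpace ℝ F]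
    {Γ : E → E →L[ℝ] E →L[ℝ] F} {X A B : ℝ → E} {x a b : E} {t : ℝ}
    (hΓ : DifferentiableAt ℝ Γ (X t)) (hX : HasDerivAt X x t) (hA : HasDerivAt A a t)
    (hB : HasDerivAt B b t) :
    HasDerivAt (fun s => Γ (X s) (A s) (B s))
      (fderiv ℝ Γ (X t) x (A t) (B t) + Γ (X t) a (B t) + Γ (X t) (A t) b) t := by
  have h1 : HasDerivAt (fun s => Γ (X s)) (fderiv ℝ Γ (X t) x) t :=
    HasFDerivAt.comp_hasDerivAt (F := E) (E := E →L[ℝ] E →L[ℝ] F) t hΓ.hasFDerivAt hX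
  exact (h1.clm_apply hA).clm_apply hB

theorem fderiv_fderiv_comm {V : Type*} [NormedAddCommGroup V] [NormedSpace ℝ V] {G : V → E} {z : V}
    (hG : ContDiffAt ℝ 2 G z) (a b : V) :
    fderiv ℝ (fun z => fderiv ℝ G z a) z b = fderiv ℝ (fun z => fderiv ℝ G z b) z a := by
  have h1 : ContDiffAt ℝ 1 (fderiv ℝ G) z := hG.fderiv_right (m := 1) (by norm_num)
  have h2 := h1.differentiableAt (by simp)
  have h3 (a b : V) : fderiv ℝ (fun z => fderiv ℝ G z a) z b = fderiv ℝ (fderiv ℝ G) z b a := by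
    rw [(h2.hasFDerivAt.clm_apply (hasFDerivAt_const a z)).fderiv]
    simp
  rw [h3, h3]
  exact (hG.isSymmSndFDerivAt (by simp)).eq b a

theorem hasDerivAt_fst {G : ℝ × ℝ → E} {s t : ℝ} (hG : DifferentiableAt ℝ G (s, t)) :
    HasDerivAt (fun s => G (s, t)) (fderiv ℝ G (s, t) (1, 0)) s :=
  hG.hasFDerivAt.comp_hasDerivAt s ((hasDerivAt_id s).prodMk (hasDerivAt_const s t))

theorem hasDerivAt_snd {G : ℝ × ℝ → E} {s t : ℝ} (hG : DifferentiableAt ℝ G (s, t)) :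
    HasDerivAt (fun t => G (s, t)) (fderiv ℝ G (s, t) (0, 1)) t :=
  hG.hasFDerivAt.comp_hasDerivAt t ((hasDerivAt_const t s).prodMk (hasDerivAt_id t))

/-- The Jacobi equation for a variation by geodesics, in coordinates. -/
theorem variation_coord {Γ : E → E →L[ℝ] E →L[ℝ] E} {F : ℝ × ℝ → E} {Fs Ft : ℝ × ℝ → E}
    (hF : ContDiffAt ℝ ∞ F (0, 0)) (hFs : Fs = fun z => fderiv ℝ F z (1, 0))
    (hFt : Ft = fun z => fderiv ℝ F z (0, 1))
    (hΓ : DifferentiableAt ℝ Γ (F (0, 0)))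
    (hsymm : ∀ᶠ x in 𝓝 (F (0, 0)), ∀ v w, Γ x v w = Γ x w v)
    (hgeo : ∀ᶠ z in 𝓝 (0, 0), fderiv ℝ Ft z (0, 1) + Γ (F z) (Ft z) (Ft z) = 0) :
    ∃ k, HasDerivAt (fun t => fderiv ℝ Fs (0, t) (0, 1) + Γ (F (0, t)) (Fs (0, t)) (Ft (0, t))) k 0 ∧
      k + Γ (F (0, 0)) (fderiv ℝ Fs (0, 0) (0, 1) + Γ (F (0, 0)) (Fs (0, 0)) (Ft (0, 0))) (Ft (0, 0))
      + (fderiv ℝ Γ (F (0, 0)) (Fs (0, 0)) (Ft (0, 0)) (Ft (0, 0))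
        - fderiv ℝ Γ (F (0, 0)) (Ft (0, 0)) (Ft (0, 0)) (Fs (0, 0))
        + Γ (F (0, 0)) (Γ (F (0, 0)) (Ft (0, 0)) (Ft (0, 0))) (Fs (0, 0))
        - Γ (F (0, 0)) (Γ (F (0, 0)) (Ft (0, 0)) (Fs (0, 0))) (Ft (0, 0))) = 0 := by
  have hsmooth {G : ℝ × ℝ → E} (hG : ContDiffAt ℝ ∞ G (0, 0)) (a : ℝ × ℝ) :
      ContDiffAt ℝ ∞ (fun z => fderiv ℝ G z a) (0, 0) :=
    (hG.fderiv_right (m := ∞) (by simp)).clm_apply contDiffAt_const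
  have hFs' : ContDiffAt ℝ ∞ Fs (0, 0) := hFs ▸ hsmooth hF _
  have hFt' : ContDiffAt ℝ ∞ Ft (0, 0) := hFt ▸ hsmooth hF _
  have d {G : ℝ × ℝ → E} (hG : ContDiffAt ℝ ∞ G (0, 0)) : DifferentiableAt ℝ G (0, 0) :=
    hG.differentiableAt (by simp)
  have hst : ∀ᶠ z in 𝓝 (0, 0), fderiv ℝ Ft z (1, 0) = fderiv ℝ Fs z (0, 1) := by
    filter_upwards [(hF.of_le (m := 2) (by norm_cast)).eventually (by simp)] with z hz
    rw [hFs, hFt]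
    exact fderiv_fderiv_comm hz _ _
  have hst0 := hst.self_of_nhds
  -- differentiate the geodesic equation in the direction of the parameter
  have e1 := (hasDerivAt_fst (d (hsmooth hFt' (0, 1)))).add
    (hasDerivAt_bilin (X := fun s => F (s, 0)) hΓ (hasDerivAt_fst (d hF)) (hasDerivAt_fst (d hFt'))
      (hasDerivAt_fst (d hFt')))
  have e2 : (fun s : ℝ => fderiv ℝ Ft (s, 0) (0, 1) + Γ (F (s, 0)) (Ft (s, 0)) (Ft (s, 0)))
      =ᶠ[𝓝 0] fun _ => 0 := by
    have hc : Filter.Tendsto (fun s : ℝ => (s, (0 : ℝ))) (𝓝 0) (𝓝 (0, 0)) :=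
      (Continuous.prodMk_left (0 : ℝ)).tendsto 0
    exact hc.eventually hgeo
  have e3 := (e1.congr_of_eventuallyEq e2.symm).unique (hasDerivAt_const (0 : ℝ) (0 : E))
  -- Two exchanges of partial derivatives turn `∂s ∂t ∂t F` into `∂t ∂t ∂s F`.
  have e4 : fderiv ℝ (fun z => fderiv ℝ Ft z (0, 1)) (0, 0) (1, 0) =
      fderiv ℝ (fun z => fderiv ℝ Fs z (0, 1)) (0, 0) (0, 1) := by
    rw [fderiv_fderiv_comm (hFt'.of_le (by norm_cast)), Filter.EventuallyEq.fderiv_eq hst]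
  have k1 := (hasDerivAt_snd (d (hsmooth hFs' (0, 1)))).add
    (hasDerivAt_bilin (X := fun t => F (0, t)) hΓ (hasDerivAt_snd (d hF)) (hasDerivAt_snd (d hFs'))
      (hasDerivAt_snd (d hFt')))
  refine ⟨_, k1, ?_⟩
  have hg0 := hgeo.self_of_nhds
  have hs0 := hsymm.self_of_nhds
  -- The symmetry of `Γ` holds on a neighbourhood, so it may be differentiated.
  have hds : fderiv ℝ Γ (F (0, 0)) (Ft (0, 0)) (Fs (0, 0)) (Ft (0, 0)) =
      fderiv ℝ Γ (F (0, 0)) (Ft (0, 0)) (Ft (0, 0)) (Fs (0, 0)) := by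
    have h (a b c : E) : fderiv ℝ (fun x => Γ x a b) (F (0, 0)) c =
        fderiv ℝ Γ (F (0, 0)) c a b := by
      rw [((hΓ.hasFDerivAt.clm_apply (hasFDerivAt_const a _)).clm_apply
        (hasFDerivAt_const b _)).fderiv]
      simp
    rw [← h, ← h, Filter.EventuallyEq.fderiv_eq (hsymm.mono fun x hx => hx _ _)]
  have hfs : fderiv ℝ F (0, 0) (1, 0) = Fs (0, 0) := by rw [hFs]
  have hft : fderiv ℝ F (0, 0) (0, 1) = Ft (0, 0) := by rw [hFt]
  rw [e4, hst0, hfs] at e3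
  rw [hft, hds]
  have hg1 : fderiv ℝ Ft (0, 0) (0, 1) = -Γ (F (0, 0)) (Ft (0, 0)) (Ft (0, 0)) :=
    eq_neg_of_add_eq_zero_left hg0
  rw [hg1]
  have e5 : fderiv ℝ (fun z => fderiv ℝ Fs z (0, 1)) (0, 0) (0, 1) =
      -(fderiv ℝ Γ (F (0, 0)) (Fs (0, 0)) (Ft (0, 0)) (Ft (0, 0)) +
        Γ (F (0, 0)) (fderiv ℝ Fs (0, 0) (0, 1)) (Ft (0, 0)) +
        Γ (F (0, 0)) (Ft (0, 0)) (fderiv ℝ Fs (0, 0) (0, 1))) := eq_neg_of_add_eq_zero_left e3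
  rw [e5, hs0 (Ft (0, 0)) (fderiv ℝ Fs (0, 0) (0, 1)), hs0 (Ft (0, 0)) (Fs (0, 0)),
    hs0 (Γ (F (0, 0)) (Ft (0, 0)) (Ft (0, 0))) (Fs (0, 0)), map_add, map_neg]
  simp only [add_apply]
  abel

variable [FiniteDimensional ℝ E]
  {M : Type*} [TopologicalSpace M] [ChartedSpace E M] [IsManifold 𝓘(ℝ, E) ∞ M]
  (nabla : CovariantDerivative 𝓘(ℝ, E) E (TangentSpace 𝓘(ℝ, E) : M → Type _))

theorem hat_extend {p r : M} (h : r ∈ (chartAt E p).source) (z : TangentSpace 𝓘(ℝ, E) p) :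
    hat p (FiberBundle.extend E z) =ᶠ[𝓝 (extChartAt 𝓘(ℝ, E) p r)] fun _ => tr p p z := by
  filter_upwards [target_mem_nhds h] with x hx
  rw [hat, extend_apply (mem_chart_target hx), tr_ts (mem_chart_target hx)]

theorem nabla_extend {p r : M} (h : r ∈ (chartAt E p).source) (z : TangentSpace 𝓘(ℝ, E) p)
    (w : TangentSpace 𝓘(ℝ, E) r) :
    tr p r (nabla (FiberBundle.extend E z) r w) =
      chr nabla p (extChartAt 𝓘(ℝ, E) p r) (tr p p z) (tr p r w) := by
  have h1 := (differentiableAt_const (𝕜 := ℝ) (tr p p z)).congr_of_eventuallyEq (hat_extend h z)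
  rw [nabla_eq nabla h h1, (hat_extend h z).fderiv_eq, extend_apply h, tr_ts h]
  simp

/-- The three extensions have constant coordinates, so their brackets vanish and only the derivative
of the Christoffel symbols and their quadratic terms remain. -/
theorem curvature_eq {p : M} (x y z : TangentSpace 𝓘(ℝ, E) p)
    (hΓ : DifferentiableAt ℝ (chr nabla p) (extChartAt 𝓘(ℝ, E) p p)) :
    tr p p (curvature nabla p x y z) =
      fderiv ℝ (chr nabla p) (extChartAt 𝓘(ℝ, E) p p) (tr p p x) (tr p p z) (tr p p y)
      - fderiv ℝ (chr nabla p) (extChartAt 𝓘(ℝ, E) p p) (tr p p y) (tr p p z) (tr p p x)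
      + chr nabla p (extChartAt 𝓘(ℝ, E) p p)
        (chr nabla p (extChartAt 𝓘(ℝ, E) p p) (tr p p z) (tr p p y)) (tr p p x)
      - chr nabla p (extChartAt 𝓘(ℝ, E) p p)
        (chr nabla p (extChartAt 𝓘(ℝ, E) p p) (tr p p z) (tr p p x)) (tr p p y) := by
  have hp := mem_chart_source E p
  have key (x y : TangentSpace 𝓘(ℝ, E) p) :
      tr p p (nabla (fun r => nabla (FiberBundle.extend E z) r (FiberBundle.extend E y r)) p x) =
        fderiv ℝ (chr nabla p) (extChartAt 𝓘(ℝ, E) p p) (tr p p x) (tr p p z) (tr p p y)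
        + chr nabla p (extChartAt 𝓘(ℝ, E) p p)
          (chr nabla p (extChartAt 𝓘(ℝ, E) p p) (tr p p z) (tr p p y)) (tr p p x) := by
    have h1 : hat p (fun r => nabla (FiberBundle.extend E z) r (FiberBundle.extend E y r))
        =ᶠ[𝓝 (extChartAt 𝓘(ℝ, E) p p)] fun x => chr nabla p x (tr p p z) (tr p p y) := by
      filter_upwards [target_mem_nhds hp] with x hx
      rw [hat, nabla_extend nabla (mem_chart_target hx), extend_apply (mem_chart_target hx),
        tr_ts (mem_chart_target hx), (extChartAt 𝓘(ℝ, E) p).right_inv hx]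
    have h2 := (hΓ.hasFDerivAt.clm_apply (hasFDerivAt_const (tr p p z) _)).clm_apply
      (hasFDerivAt_const (tr p p y) _)
    rw [nabla_eq nabla hp (h2.differentiableAt.congr_of_eventuallyEq h1), h1.fderiv_eq, h2.fderiv,
      nabla_extend nabla hp, FiberBundle.extend_apply_self]
    simp
  have hmd (x : TangentSpace 𝓘(ℝ, E) p) := (mdifferentiableAt_section_iff_tr hp).2
    ((differentiableAt_const (𝕜 := ℝ) (tr p p x)).congr_of_eventuallyEq (hat_extend hp x))
  have : CompleteSpace E := FiniteDimensional.complete ℝ E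
  have hbr : VectorField.mlieBracket 𝓘(ℝ, E) (FiberBundle.extend E x) (FiberBundle.extend E y) p
      = 0 := by
    rw [← ts_tr hp (VectorField.mlieBracket 𝓘(ℝ, E) _ _ p), tr_mlieBracket hp (hmd x) (hmd y),
      (hat_extend hp y).fderiv_eq, (hat_extend hp x).fderiv_eq]
    simp
  rw [curvature]
  simp only [hbr, map_zero, sub_zero, FiberBundle.extend_apply_self, map_sub]
  rw [key x y, key y x]
  abel

/-- Product rule for the transition operator `T` between the two charts. The derivative of `T`
appears as that of a field with constant coordinates in the chart at `q`. -/
theorem hasDerivAt_coord {c : ℝ → M} {t : ℝ} (hc : MDifferentiableAt 𝓘(ℝ, ℝ) 𝓘(ℝ, E) c t) {p q : M}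
    (hp : c t ∈ (chartAt E p).source) (hq : c t ∈ (chartAt E q).source)
    {J : ∀ t, TangentSpace 𝓘(ℝ, E) (c t)} {j : E}
    (hJ : HasDerivAt (fun s => tr q (c s) (J s)) j t) :
    HasDerivAt (fun s => tr p (c s) (J s)) (tr p (c t) (ts q (c t) j) +
      fderiv ℝ (hat p fun r => ts q r (tr q (c t) (J t))) (extChartAt 𝓘(ℝ, E) p (c t))
        (tr p (c t) (velocity c t))) t := by
  let T (x : E) : E →L[ℝ] E :=
    (tr p ((extChartAt 𝓘(ℝ, E) p).symm x)).comp (ts q ((extChartAt 𝓘(ℝ, E) p).symm x))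
  have hT : ContDiffAt ℝ ∞ T (extChartAt 𝓘(ℝ, E) p (c t)) := by
    rw [contDiffAt_clm_apply_iff]
    intro v
    exact (contMDiffAt_section_iff_tr (n := ⊤) hp).1
      ((contMDiffAt_section_iff_tr (n := ⊤) hq).2
        (contDiffAt_const.congr_of_eventuallyEq (hat_ts hq v)))
  have hTd := hT.differentiableAt (by simp)
  have h1 := (hTd.hasFDerivAt.comp_hasDerivAt t (tr_velocity hc hp)).clm_apply hJ
  have h2 : (fun s => tr p (c s) (J s)) =ᶠ[𝓝 t]
      fun s => T (extChartAt 𝓘(ℝ, E) p (c s)) (tr q (c s) (J s)) := by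
    filter_upwards [hc.continuousAt.preimage_mem_nhds ((chartAt E p).open_source.mem_nhds hp),
      hc.continuousAt.preimage_mem_nhds ((chartAt E q).open_source.mem_nhds hq)] with s hs hs'
    change _ = tr p _ (ts q _ _)
    rw [extChartAt_symm_apply hs, ts_tr hs']
  refine (h1.congr_of_eventuallyEq h2).congr_deriv ?_
  rw [add_comm]
  congr 1
  · change tr p _ (ts q _ j) = _
    rw [extChartAt_symm_apply hp]
  · have h3 := (hTd.hasFDerivAt.clm_apply (hasFDerivAt_const (tr q (c t) (J t)) _)).fderiv
    have h4 : (hat p fun r => ts q r (tr q (c t) (J t))) = fun x => T x (tr q (c t) (J t)) := rfl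
    rw [h4, h3]
    simp

/-- The covariant derivative along a curve, in an arbitrary chart. -/
theorem tr_covDerivAlong {c : ℝ → M} {t : ℝ} (hc : MDifferentiableAt 𝓘(ℝ, ℝ) 𝓘(ℝ, E) c t) {p : M}
    (hp : c t ∈ (chartAt E p).source)
    {J : ∀ t, TangentSpace 𝓘(ℝ, E) (c t)} {j : E}
    (hJ : HasDerivAt (fun s => tr p (c s) (J s)) j t) :
    tr p (c t) (covDerivAlong nabla c J t) = j +
      chr nabla p (extChartAt 𝓘(ℝ, E) p (c t)) (tr p (c t) (J t)) (tr p (c t) (velocity c t)) := by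
  -- The definition of `covDerivAlong` uses the chart centred at `c t`. The coordinates are moved
  -- there and back, and the terms from the change of chart are absorbed by uniqueness of the
  -- derivative. A chart independent of `t` is what allows a second differentiation.
  have hq := mem_chart_source E (c t)
  have h0 := hasDerivAt_coord hc hq hp hJ
  obtain ⟨k, hk⟩ : ∃ k, HasDerivAt (fun s => tr (c t) (c s) (J s)) k t := ⟨_, h0⟩
  have h1 : (fun s => (trivializationAt E (TangentSpace 𝓘(ℝ, E) : M → Type _) (c t)
      (⟨c s, J s⟩ : TangentBundle 𝓘(ℝ, E) M)).2) =ᶠ[𝓝 t] fun s => tr (c t) (c s) (J s) := by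
    filter_upwards [hc.continuousAt.preimage_mem_nhds
      ((chartAt E (c t)).open_source.mem_nhds hq)] with s hs
    exact trivializationAt_snd hs _
  have h2 : covDerivAlong nabla c J t =
      ts (c t) (c t) k + nabla (FiberBundle.extend E (J t)) (c t) (velocity c t) := by
    rw [covDerivAlong, h1.deriv_eq, hk.deriv]
    congr 1
    exact (Bundle.Trivialization.symmL_apply _ hq _).symm
  -- At `c t` the extension may be replaced by the field with the same constant coordinates, whose
  -- expression in the chart at `p` is known to be differentiable.
  have h3 : nabla (FiberBundle.extend E (J t)) (c t) (velocity c t) =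
      nabla (fun r => ts (c t) r (tr (c t) (c t) (J t))) (c t) (velocity c t) := by
    rw [← ts_tr hq (nabla (FiberBundle.extend E (J t)) (c t) (velocity c t)), nabla_extend nabla hq,
      ← nabla_ts nabla hq, ts_tr hq]
  have h4 : DifferentiableAt ℝ (hat p fun r => ts (c t) r (tr (c t) (c t) (J t)))
      (extChartAt 𝓘(ℝ, E) p (c t)) :=
    (mdifferentiableAt_section_iff_tr hp).1 (mdifferentiableAt_ts hq _)
  rw [h2, h3, map_add, nabla_eq nabla hp h4, ts_tr hq, ← add_assoc,
    (hasDerivAt_coord hc hp hq hk).unique hJ]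

end Variation

/-! ### The Jacobi equation for a variation by geodesics on a manifold. -/

section VariationManifold

variable {E : Type*} [NormedAddCommGroup E] [NormedSpace ℝ E] [FiniteDimensional ℝ E]
  {M : Type*} [TopologicalSpace M] [ChartedSpace E M] [IsManifold 𝓘(ℝ, E) ∞ M]
  [Bundle.RiemannianBundle (fun p : M => TangentSpace 𝓘(ℝ, E) p)]
  [IsContMDiffRiemannianBundle 𝓘(ℝ, E) ∞ E (fun p : M => TangentSpace 𝓘(ℝ, E) p)]
  {nabla : CovariantDerivative 𝓘(ℝ, E) E (TangentSpace 𝓘(ℝ, E) : M → Type _)}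

/-- One chart, centred at `f (0, 0)`, contains everything near the origin, so `variation_coord`
applies. The equation at the single parameter `(0, 0)` is all that the computation of the curvature
uses. -/
theorem jacobi_of_geodesic_variation (hn : IsLeviCivita nabla) {f : ℝ × ℝ → M}
    (hf : ContMDiff 𝓘(ℝ, ℝ × ℝ) 𝓘(ℝ, E) ∞ f)
    (hgeo : ∀ s t, covDerivAlong nabla (fun t => f (s, t)) (velocity fun t => f (s, t)) t = 0) :
    covDerivAlong nabla (fun t => f (0, t))
      (covDerivAlong nabla (fun t => f (0, t)) fun t => velocity (fun s => f (s, t)) 0) 0 +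
      curvature nabla (f (0, 0)) (velocity (fun s => f (s, 0)) 0) (velocity (fun t => f (0, t)) 0)
        (velocity (fun t => f (0, t)) 0) = 0 := by
  let p := f (0, 0)
  have hp : f (0, 0) ∈ (chartAt E p).source := mem_chart_source E _
  let F : ℝ × ℝ → E := fun z => extChartAt 𝓘(ℝ, E) p (f z)
  have hF {z : ℝ × ℝ} (hz : f z ∈ (chartAt E p).source) : ContDiffAt ℝ ∞ F z :=
    contMDiffAt_iff_contDiffAt.1 ((contMDiffAt_extChartAt_of_mem hz).comp z hf.contMDiffAt)
  let Fs : ℝ × ℝ → E := fun z => fderiv ℝ F z (1, 0)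
  let Ft : ℝ × ℝ → E := fun z => fderiv ℝ F z (0, 1)
  have hd {z : ℝ × ℝ} (hz : f z ∈ (chartAt E p).source) (a : ℝ × ℝ) :
      DifferentiableAt ℝ (fun z => fderiv ℝ F z a) z :=
    (((hF hz).fderiv_right (m := ∞) (by simp)).clm_apply contDiffAt_const).differentiableAt (by simp)
  have hU (z : ℝ × ℝ) (hz : f z ∈ (chartAt E p).source) :
      ∀ᶠ y in 𝓝 z, f y ∈ (chartAt E p).source :=
    hf.continuous.continuousAt.preimage_mem_nhds ((chartAt E p).open_source.mem_nhds hz)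
  have hfst (s t : ℝ) : ContMDiff 𝓘(ℝ, ℝ) 𝓘(ℝ, E) ∞ (fun s => f (s, t)) :=
    hf.comp (contMDiff_iff_contDiff.2 (contDiff_id.prodMk contDiff_const))
  have hsnd (s t : ℝ) : ContMDiff 𝓘(ℝ, ℝ) 𝓘(ℝ, E) ∞ (fun t => f (s, t)) :=
    hf.comp (contMDiff_iff_contDiff.2 (contDiff_const.prodMk contDiff_id))
  have hvs {s t : ℝ} (hz : f (s, t) ∈ (chartAt E p).source) :
      tr p (f (s, t)) (velocity (fun s => f (s, t)) s) = Fs (s, t) :=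
    (tr_velocity ((hfst s t).mdifferentiable (by simp) s) hz).unique
      (hasDerivAt_fst ((hF hz).differentiableAt (by simp)))
  have hvt {s t : ℝ} (hz : f (s, t) ∈ (chartAt E p).source) :
      tr p (f (s, t)) (velocity (fun t => f (s, t)) t) = Ft (s, t) :=
    (tr_velocity ((hsnd s t).mdifferentiable (by simp) t) hz).unique
      (hasDerivAt_snd ((hF hz).differentiableAt (by simp)))
  have hct (s t : ℝ) : ContinuousAt (fun t => (s, t)) t := (Continuous.prodMk_right s).continuousAt
  have hcoord : ∀ᶠ z in 𝓝 ((0 : ℝ), (0 : ℝ)),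
      fderiv ℝ Ft z (0, 1) + chr nabla p (F z) (Ft z) (Ft z) = 0 := by
    filter_upwards [hU _ hp] with z hz
    obtain ⟨s, t⟩ := z
    have h1 : HasDerivAt (fun t => tr p (f (s, t)) (velocity (fun t => f (s, t)) t))
        (fderiv ℝ Ft (s, t) (0, 1)) t := by
      refine (hasDerivAt_snd (hd hz (0, 1))).congr_of_eventuallyEq ?_
      filter_upwards [(hct s t).eventually (hU _ hz)] with t' ht'
      exact hvt ht'
    have h2 := tr_covDerivAlong nabla ((hsnd s t).mdifferentiable (by simp) t) hz h1
    rw [hgeo, map_zero, hvt hz] at h2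
    exact h2.symm
  have htarget : F (0, 0) ∈ (extChartAt 𝓘(ℝ, E) p).target := mem_extChartAt_target p
  have hΓ : DifferentiableAt ℝ (chr nabla p) (F (0, 0)) :=
    (contDiffAt_chr hn htarget).differentiableAt (by simp)
  have hsymm : ∀ᶠ x in 𝓝 (F (0, 0)), ∀ v w, chr nabla p x v w = chr nabla p x w v := by
    filter_upwards [target_mem_nhds hp] with x hx v w using chr_symm hn hx v w
  obtain ⟨k, hk, hk'⟩ := variation_coord (hF hp) (Fs := Fs) (Ft := Ft) rfl rfl hΓ hsymm hcoord
  have hDJ {t : ℝ} (hz : f (0, t) ∈ (chartAt E p).source) :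
      tr p (f (0, t)) (covDerivAlong nabla (fun t => f (0, t))
        (fun t => velocity (fun s => f (s, t)) 0) t) =
        fderiv ℝ Fs (0, t) (0, 1) + chr nabla p (F (0, t)) (Fs (0, t)) (Ft (0, t)) := by
    have h1 : HasDerivAt (fun t => tr p (f (0, t)) (velocity (fun s => f (s, t)) 0))
        (fderiv ℝ Fs (0, t) (0, 1)) t := by
      refine (hasDerivAt_snd (hd hz (1, 0))).congr_of_eventuallyEq ?_
      filter_upwards [(hct 0 t).eventually (hU _ hz)] with t' ht'
      exact hvs ht'
    have h2 := tr_covDerivAlong nabla ((hsnd 0 t).mdifferentiable (by simp) t) hz h1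
    rw [hvt hz, hvs hz] at h2
    exact h2
  have h3 : HasDerivAt (fun t => tr p (f (0, t)) (covDerivAlong nabla (fun t => f (0, t))
        (fun t => velocity (fun s => f (s, t)) 0) t)) k 0 := by
    refine hk.congr_of_eventuallyEq ?_
    filter_upwards [(hct 0 0).eventually (hU _ hp)] with t' ht'
    exact hDJ ht'
  have h4 := tr_covDerivAlong nabla ((hsnd 0 0).mdifferentiable (by simp) 0) hp h3
  rw [hvt hp, hDJ hp] at h4
  rw [← ts_tr hp (_ + _), map_add, h4, curvature_eq nabla _ _ _ hΓ, hvs hp, hvt hp, hk', map_zero]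

end VariationManifold

/-! ### Left-invariant fields and their integral curves. -/

section LieGroupBasics

set_option linter.unusedSectionVars false

variable {E : Type*} [NormedAddCommGroup E] [NormedSpace ℝ E]
  {G : Type*} [TopologicalSpace G] [ChartedSpace E G] [Group G] [LieGroup 𝓘(ℝ, E) ∞ G]

/-- The field is the tangent map of multiplication applied to the smooth pair `(0_g, X)`. -/
theorem contMDiff_leftTranslate (X : LieAlg E G) : ContMDiff 𝓘(ℝ, E) 𝓘(ℝ, E).tangent ∞
    (fun g : G => (⟨g, leftTranslate g X⟩ : TangentBundle 𝓘(ℝ, E) G)) := by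
  let fg : G → TangentBundle 𝓘(ℝ, E) G := fun g => ⟨g, 0⟩
  have sfg : ContMDiff 𝓘(ℝ, E) 𝓘(ℝ, E).tangent ∞ fg := Bundle.contMDiff_zeroSection _ _
  let fv : G → TangentBundle 𝓘(ℝ, E) G := fun _ => ⟨1, X⟩
  have sfv : ContMDiff 𝓘(ℝ, E) 𝓘(ℝ, E).tangent ∞ fv := contMDiff_const
  have S₃ : ContMDiff (𝓘(ℝ, E).prod 𝓘(ℝ, E)).tangent 𝓘(ℝ, E).tangent ∞
      (tangentMap (𝓘(ℝ, E).prod 𝓘(ℝ, E)) 𝓘(ℝ, E) (fun p : G × G => p.1 * p.2)) :=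
    (contMDiff_mul 𝓘(ℝ, E) ∞).contMDiff_tangentMap (by simp)
  have S := (S₃.comp contMDiff_equivTangentBundleProd_symm).comp (sfg.prodMk sfv)
  convert S with g
  · simp [fg, fv]
  · simp only [Function.comp_apply, tangentMap, fg, fv]
    rw [mfderiv_prod_eq_add_apply ((contMDiff_mul 𝓘(ℝ, E) ∞).mdifferentiable (by simp) _)]
    refine heq_of_eq (Eq.symm ?_)
    let L : E →L[ℝ] E := mfderiv 𝓘(ℝ, E) 𝓘(ℝ, E) (fun z : G => z * 1) g
    let v : E := mfderiv 𝓘(ℝ, E) 𝓘(ℝ, E) (fun z : G => g * z) 1 X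
    exact (congrArg (· + v) (map_zero L)).trans (zero_add v)

theorem mfderiv_mul_leftTranslate (h g : G) (X : LieAlg E G) :
    mfderiv 𝓘(ℝ, E) 𝓘(ℝ, E) (fun x => h * x) g (leftTranslate g X) = leftTranslate (h * g) X := by
  have h1 : MDifferentiableAt 𝓘(ℝ, E) 𝓘(ℝ, E) (fun x => h * x) (g * 1) :=
    (contMDiff_mul_left (n := ∞)).mdifferentiable (by simp) _
  have h2 : MDifferentiableAt 𝓘(ℝ, E) 𝓘(ℝ, E) (fun x => g * x) 1 :=
    (contMDiff_mul_left (n := ∞)).mdifferentiable (by simp) _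
  have h3 := mfderiv_comp (1 : G) h1 h2
  have h4 : (fun x => h * x) ∘ (fun x => g * x) = fun x => (h * g) * x := by
    ext x; simp [mul_assoc]
  rw [h4] at h3
  have h5 := congrArg (fun L => L X) h3
  have h6 : g * 1 = g := mul_one g
  simp only [leftTranslate, mulInvariantVectorField]
  refine Eq.trans ?_ h5.symm
  change _ = mfderiv 𝓘(ℝ, E) 𝓘(ℝ, E) (fun x => h * x) (g * 1) _
  rw [h6]
  rfl

theorem leftTranslate_injective (g : G) : Function.Injective (leftTranslate (E := E) g) := by
  intro X Y hXY
  have h : ∀ X : LieAlg E G, mfderiv 𝓘(ℝ, E) 𝓘(ℝ, E) (fun x => g⁻¹ * x) g (leftTranslate g X) = X := by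
    intro X
    rw [mfderiv_mul_leftTranslate, leftTranslate, mulInvariantVectorField]
    have : (fun x => g⁻¹ * g * x) = id := by ext; simp
    rw [this, mfderiv_id]
    rfl
  rw [← h X, hXY, h]

variable (E G) in
/-- The model vector space as a copy of the Lie algebra. -/
def lieE : LieAlg E G ≃L[ℝ] E := ContinuousLinearEquiv.refl ℝ E

/-- Left translation of Lie algebra vectors to `g`, as a continuous linear map. -/
def leftTranslateL (g : G) : LieAlg E G →L[ℝ] TangentSpace 𝓘(ℝ, E) g :=
  mfderiv 𝓘(ℝ, E) 𝓘(ℝ, E) (fun y => g * y) 1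

/-- Left translation of Lie algebra vectors, in the chart at `p`. -/
def leftHat (p : G) (x : E) : E →L[ℝ] E :=
  ((tr p ((extChartAt 𝓘(ℝ, E) p).symm x)).comp
    (leftTranslateL ((extChartAt 𝓘(ℝ, E) p).symm x))).comp
      ((lieE E G).symm : E →L[ℝ] LieAlg E G)

theorem leftHat_apply {p g : G} (h : g ∈ (chartAt E p).source) (v : E) :
    leftHat p (extChartAt 𝓘(ℝ, E) p g) v = tr p g (leftTranslate g ((lieE E G).symm v)) :=
  hat_apply h (fun g => leftTranslate g ((lieE E G).symm v))

theorem velocity_eq_leftTranslate {γ : ℝ → G} {A : LieAlg E G} {U : G}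
    (h : IsExpCurve U A γ) (t : ℝ) : velocity γ t = leftTranslate (γ t) A := by
  have h1 := (h.integral t).mfderiv
  rw [velocity, h1]
  exact one_smul ℝ (leftTranslate (γ t) A)

/-- Bootstrapping: if `u` is `n` times continuously differentiable, so is `V ∘ u = u'`, hence `u`
gains one order. -/
theorem contDiffOn_of_autonomous {V : E → E} {u : ℝ → E} {s : Set ℝ} (hs : IsOpen s)
    (hV : ∀ t ∈ s, ContDiffAt ℝ ∞ V (u t)) (hu : ∀ t ∈ s, HasDerivAt u (V (u t)) t) :
    ContDiffOn ℝ ∞ u s := by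
  rw [contDiffOn_infty]
  intro n
  induction n with
  | zero =>
    exact contDiffOn_zero.2 fun t ht => (hu t ht).continuousAt.continuousWithinAt
  | succ n ih =>
    push_cast
    rw [contDiffOn_succ_iff_deriv_of_isOpen hs]
    refine ⟨fun t ht => (hu t ht).differentiableAt.differentiableWithinAt, by simp, ?_⟩
    refine ContDiffOn.congr (f := fun t => V (u t)) (fun t ht => ?_) fun t ht => (hu t ht).deriv
    exact ((hV t ht).of_le (by exact_mod_cast le_top)).comp_contDiffWithinAt t (ih t ht)

variable [FiniteDimensional ℝ E]

theorem contDiffAt_leftHat {p g : G} (h : g ∈ (chartAt E p).source) :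
    ContDiffAt ℝ ∞ (leftHat p) (extChartAt 𝓘(ℝ, E) p g) := by
  rw [contDiffAt_clm_apply_iff]
  intro v
  exact (contMDiffAt_section_iff_tr (n := ⊤) h).1
    (contMDiff_leftTranslate ((lieE E G).symm v)).contMDiffAt

theorem leftHat_isInvertible {p g : G} (h : g ∈ (chartAt E p).source) :
    (leftHat p (extChartAt 𝓘(ℝ, E) p g)).IsInvertible := by
  have hinj : Function.Injective (leftHat p (extChartAt 𝓘(ℝ, E) p g)) := by
    intro X Y hXY
    rw [leftHat_apply h, leftHat_apply h] at hXY
    apply (lieE E G).symm.injective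
    apply leftTranslate_injective g
    rw [← ts_tr h (leftTranslate g _), hXY, ts_tr h]
  refine ⟨(LinearEquiv.ofInjectiveEndo (leftHat p (extChartAt 𝓘(ℝ, E) p g) : E →ₗ[ℝ] E)
    hinj).toContinuousLinearEquiv, ?_⟩
  ext v
  rfl

/-- In a chart, left translation is an injective endomorphism of a finite-dimensional space. -/
theorem leftTranslate_surjective (g : G) : Function.Surjective (leftTranslate (E := E) g) := by
  intro v
  have h := mem_chart_source E g
  obtain ⟨e, he⟩ := leftHat_isInvertible h
  refine ⟨(lieE E G).symm (e.symm (tr g g v)), ?_⟩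
  rw [← ts_tr h (leftTranslate g _), ← leftHat_apply h, ← he]
  exact (congrArg (ts g g) (e.apply_symm_apply _)).trans (ts_tr h v)

theorem IsExpCurve.contMDiff {γ : ℝ → G} {A : LieAlg E G} {U : G} (h : IsExpCurve U A γ) :
    ContMDiff 𝓘(ℝ, ℝ) 𝓘(ℝ, E) ∞ γ := by
  intro t
  have hmd (t : ℝ) : MDifferentiableAt 𝓘(ℝ, ℝ) 𝓘(ℝ, E) γ t := (h.integral t).mdifferentiableAt
  have hcont : Continuous γ := continuous_iff_continuousAt.2 fun t => (hmd t).continuousAt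
  rw [contMDiffAt_iff_target]
  refine ⟨hcont.continuousAt, contMDiffAt_iff_contDiffAt.2 ?_⟩
  have hs : IsOpen (γ ⁻¹' (chartAt E (γ t)).source) :=
    (chartAt E (γ t)).open_source.preimage hcont
  refine (contDiffOn_of_autonomous (V := fun x => leftHat (γ t) x (lieE E G A)) hs (fun s hs => ?_)
    fun s hs => ?_).contDiffAt (hs.mem_nhds (mem_chart_source E _))
  · exact (contDiffAt_leftHat hs).clm_apply contDiffAt_const
  · have := tr_velocity (hmd s) hs
    rw [velocity_eq_leftTranslate h, ← (lieE E G).symm_apply_apply A, ← leftHat_apply hs] at this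
    exact this

theorem IsSmoothFieldAlong.contDiffAt_tr {M : Type*} [TopologicalSpace M] [ChartedSpace E M]
    [IsManifold 𝓘(ℝ, E) ∞ M] {c : ℝ → M} {J : ∀ t, TangentSpace 𝓘(ℝ, E) (c t)}
    (hJ : IsSmoothFieldAlong c J) (t : ℝ) :
    ContDiffAt ℝ ∞ (fun s => tr (c t) (c s) (J s)) t := by
  have h1 := (Bundle.contMDiffAt_totalSpace.1 (hJ t)).2
  have hc : Continuous c :=
    (FiberBundle.continuous_proj E (TangentSpace 𝓘(ℝ, E) : M → Type _)).comp hJ.continuous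
  refine (contMDiffAt_iff_contDiffAt.1 h1).congr_of_eventuallyEq ?_
  filter_upwards [hc.continuousAt.preimage_mem_nhds
    ((chartAt E (c t)).open_source.mem_nhds (mem_chart_source E _))] with s hs
  exact (trivializationAt_snd hs _).symm

/-- The left-invariant frame is smooth and invertible in a chart, and inversion of operators is
smooth, so the coordinates in this frame are recovered smoothly. -/
theorem contDiffAt_of_leftTranslate {γ : ℝ → G} {t : ℝ} (hγ : ContMDiffAt 𝓘(ℝ, ℝ) 𝓘(ℝ, E) ∞ γ t)
    {x : ℝ → E} {p : G} (hp : γ t ∈ (chartAt E p).source)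
    (hx : ContDiffAt ℝ ∞ (fun s => tr p (γ s) (leftTranslate (γ s) ((lieE E G).symm (x s)))) t) :
    ContDiffAt ℝ ∞ x t := by
  have : CompleteSpace E := FiniteDimensional.complete ℝ E
  have h0 : ContDiffAt ℝ ∞ (fun s => extChartAt 𝓘(ℝ, E) p (γ s)) t :=
    contMDiffAt_iff_contDiffAt.1 ((contMDiffAt_extChartAt_of_mem hp).comp t hγ)
  have h1 : ContDiffAt ℝ ∞ (fun s => leftHat p (extChartAt 𝓘(ℝ, E) p (γ s))) t :=
    ContDiffAt.comp (F := E) (G := E →L[ℝ] E) (g := leftHat p) t (contDiffAt_leftHat hp) h0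
  have h2 : ContDiffAt ℝ ∞ (fun s => (leftHat p (extChartAt 𝓘(ℝ, E) p (γ s))).inverse) t :=
    ContDiffAt.comp (g := ContinuousLinearMap.inverse) t
      (leftHat_isInvertible hp).contDiffAt_map_inverse h1
  refine (h2.clm_apply hx).congr_of_eventuallyEq ?_
  filter_upwards [hγ.continuousAt.preimage_mem_nhds
    ((chartAt E p).open_source.mem_nhds hp)] with s hs
  rw [← leftHat_apply hs]
  exact (congrArg (fun L : E →L[ℝ] E => L (x s)) (leftHat_isInvertible hs).inverse_comp_self).symm

end LieGroupBasics

/-! ### Variations by left translates of a one-parameter group. -/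

section LieGroupVariation

set_option linter.unusedSectionVars false

variable {E : Type*} [NormedAddCommGroup E] [NormedSpace ℝ E] [FiniteDimensional ℝ E]
  {G : Type*} [TopologicalSpace G] [ChartedSpace E G] [Group G] [LieGroup 𝓘(ℝ, E) ∞ G]

theorem IsExpCurve.mul_left {U : G} {A : LieAlg E G} {γ : ℝ → G} (h : IsExpCurve U A γ) (g : G) :
    IsExpCurve (g * U) A (fun t => g * γ t) where
  integral t := by
    have h1 : MDifferentiableAt 𝓘(ℝ, E) 𝓘(ℝ, E) (fun x => g * x) (γ t) :=
      (contMDiff_mul_left (n := ∞)).mdifferentiable (by simp) _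
    have h2 := h1.hasMFDerivAt.comp t (h.integral t)
    refine h2.congr_mfderiv ?_
    ext
    exact (map_smul (mfderiv 𝓘(ℝ, E) 𝓘(ℝ, E) (fun x => g * x) (γ t)) (1 : ℝ)
        (leftTranslate (γ t) A)).trans
      (congrArg (fun v : TangentSpace 𝓘(ℝ, E) (g * γ t) => (1 : ℝ) • v)
        (mfderiv_mul_leftTranslate g (γ t) A))
  initial := by rw [h.initial]

theorem leftHat_bracket {p g : G} (h : g ∈ (chartAt E p).source) (A X : LieAlg E G) :
    leftHat p (extChartAt 𝓘(ℝ, E) p g) (lieE E G ⁅A, X⁆) =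
      fderiv ℝ (leftHat p) (extChartAt 𝓘(ℝ, E) p g)
        (leftHat p (extChartAt 𝓘(ℝ, E) p g) (lieE E G A)) (lieE E G X) -
      fderiv ℝ (leftHat p) (extChartAt 𝓘(ℝ, E) p g)
        (leftHat p (extChartAt 𝓘(ℝ, E) p g) (lieE E G X)) (lieE E G A) := by
  have : CompleteSpace E := FiniteDimensional.complete ℝ E
  have hd (X : LieAlg E G) : fderiv ℝ (hat p fun g => leftTranslate g X) (extChartAt 𝓘(ℝ, E) p g) =
      (fderiv ℝ (leftHat p) (extChartAt 𝓘(ℝ, E) p g)).flip (lieE E G X) := by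
    have h1 := (((contDiffAt_leftHat h).differentiableAt (by simp)).hasFDerivAt.clm_apply
      (hasFDerivAt_const (lieE E G X) _)).fderiv
    have h2 : (hat p fun g => leftTranslate g X) = fun x => leftHat p x (lieE E G X) := rfl
    rw [h2, h1]
    ext
    simp
  have hmd (X : LieAlg E G) : MDifferentiableAt 𝓘(ℝ, E) 𝓘(ℝ, E).tangent
      (fun g : G => (⟨g, leftTranslate g X⟩ : TangentBundle 𝓘(ℝ, E) G)) g :=
    (contMDiff_leftTranslate X).mdifferentiable (by simp) g
  have h1 := tr_mlieBracket h (hmd A) (hmd X)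
  rw [hd, hd] at h1
  have h2 : VectorField.mlieBracket 𝓘(ℝ, E) (fun g => leftTranslate g A)
      (fun g => leftTranslate g X) g = leftTranslate g ⁅A, X⁆ :=
    (congrFun (mulInvariantVector_mlieBracket A X) g).symm
  rw [h2] at h1
  rw [leftHat_apply h, leftHat_apply h, leftHat_apply h]
  exact h1

/-- Transport of a variation field by a one-parameter group of right translations. -/
theorem exists_leftTranslate_variation {U : G} {A : LieAlg E G} {δ : ℝ → G}
    (hδ : IsExpCurve U A δ) {h : ℝ → G} (hh : ContMDiff 𝓘(ℝ, ℝ) 𝓘(ℝ, E) ∞ h) :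
    ∃ a : ℝ → LieAlg E G,
      (∀ t, velocity (fun s => h s * δ t) 0 = leftTranslate (h 0 * δ t) (a t)) ∧
      (∀ t, HasDerivAt (fun t => lieE E G (a t)) (-lieE E G ⁅A, a t⁆) t) := by
  choose a ha using fun t => leftTranslate_surjective (E := E) (h 0 * δ t)
    (velocity (fun s => h s * δ t) 0)
  refine ⟨a, fun t => (ha t).symm, fun t₀ => ?_⟩
  let f : ℝ × ℝ → G := fun z => h z.1 * δ z.2
  have hf : ContMDiff 𝓘(ℝ, ℝ × ℝ) 𝓘(ℝ, E) ∞ f :=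
    (hh.comp (contMDiff_iff_contDiff.2 contDiff_fst)).mul
      (hδ.contMDiff.comp (contMDiff_iff_contDiff.2 contDiff_snd))
  let p := f (0, t₀)
  have hp : f (0, t₀) ∈ (chartAt E p).source := mem_chart_source E _
  let F : ℝ × ℝ → E := fun z => extChartAt 𝓘(ℝ, E) p (f z)
  have hF {z : ℝ × ℝ} (hz : f z ∈ (chartAt E p).source) : ContDiffAt ℝ ∞ F z :=
    contMDiffAt_iff_contDiffAt.1 ((contMDiffAt_extChartAt_of_mem hz).comp z hf.contMDiffAt)
  have hU : ∀ᶠ y in 𝓝 (0, t₀), f y ∈ (chartAt E p).source :=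
    hf.continuous.continuousAt.preimage_mem_nhds ((chartAt E p).open_source.mem_nhds hp)
  have hct : ContinuousAt (fun t : ℝ => ((0 : ℝ), t)) t₀ :=
    (Continuous.prodMk_right (0 : ℝ)).continuousAt
  have hU0 : ∀ᶠ t in 𝓝 t₀, f (0, t) ∈ (chartAt E p).source := hct.eventually hU
  have hfst (t : ℝ) : ContMDiff 𝓘(ℝ, ℝ) 𝓘(ℝ, E) ∞ (fun s => f (s, t)) :=
    hf.comp (contMDiff_iff_contDiff.2 (contDiff_id.prodMk contDiff_const))
  have hsnd (s : ℝ) : ContMDiff 𝓘(ℝ, ℝ) 𝓘(ℝ, E) ∞ (fun t => f (s, t)) :=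
    hf.comp (contMDiff_iff_contDiff.2 (contDiff_const.prodMk contDiff_id))
  have hFs {t : ℝ} (hz : f (0, t) ∈ (chartAt E p).source) :
      fderiv ℝ F (0, t) (1, 0) = leftHat p (F (0, t)) (lieE E G (a t)) := by
    rw [leftHat_apply hz, ContinuousLinearEquiv.symm_apply_apply]
    refine (hasDerivAt_fst ((hF hz).differentiableAt (by simp))).unique ?_
    have := tr_velocity ((hfst t).mdifferentiable (by simp) 0) hz
    rw [← ha t] at this
    exact this
  have hFt {z : ℝ × ℝ} (hz : f z ∈ (chartAt E p).source) :
      fderiv ℝ F z (0, 1) = leftHat p (F z) (lieE E G A) := by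
    obtain ⟨s, t⟩ := z
    rw [leftHat_apply hz, ContinuousLinearEquiv.symm_apply_apply]
    refine (hasDerivAt_snd ((hF hz).differentiableAt (by simp))).unique ?_
    have := tr_velocity ((hsnd s).mdifferentiable (by simp) t) hz
    rw [velocity_eq_leftTranslate (hδ.mul_left (h s))] at this
    exact this
  have hd (b : ℝ × ℝ) : DifferentiableAt ℝ (fun z => fderiv ℝ F z b) (0, t₀) :=
    (((hF hp).fderiv_right (m := ∞) (by simp)).clm_apply contDiffAt_const).differentiableAt (by simp)
  have hsm : ContDiffAt ℝ ∞ (fun t => lieE E G (a t)) t₀ := by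
    refine contDiffAt_of_leftTranslate (p := p) (γ := fun t => f (0, t))
      (hsnd 0).contMDiffAt hp ?_
    have h1 : ContDiffAt ℝ ∞ (fun t => fderiv ℝ F (0, t) (1, 0)) t₀ :=
      (((hF hp).fderiv_right (m := ∞) (by simp)).clm_apply contDiffAt_const).comp t₀
        (contDiff_const.prodMk contDiff_id).contDiffAt
    refine h1.congr_of_eventuallyEq ?_
    filter_upwards [hU0] with t ht
    rw [hFs ht, leftHat_apply ht]
  obtain ⟨a', ha'⟩ : ∃ a', HasDerivAt (fun t => lieE E G (a t)) a' t₀ :=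
    ⟨_, (hsm.differentiableAt (by simp)).hasDerivAt⟩
  have hL : DifferentiableAt ℝ (leftHat p) (F (0, t₀)) :=
    (contDiffAt_leftHat hp).differentiableAt (by simp)
  have e1 : HasDerivAt (fun t => fderiv ℝ F (0, t) (1, 0))
      (fderiv ℝ (leftHat p) (F (0, t₀)) (leftHat p (F (0, t₀)) (lieE E G A)) (lieE E G (a t₀)) +
        leftHat p (F (0, t₀)) a') t₀ := by
    have h1 : HasDerivAt (fun t => F (0, t)) (leftHat p (F (0, t₀)) (lieE E G A)) t₀ :=
      hFt hp ▸ hasDerivAt_snd ((hF hp).differentiableAt (by simp))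
    have h2 := HasFDerivAt.comp_hasDerivAt (F := E) (E := E →L[ℝ] E) t₀ hL.hasFDerivAt h1
    refine (h2.clm_apply ha').congr_of_eventuallyEq ?_
    filter_upwards [hU0] with t ht using hFs ht
  have e2 : HasDerivAt (fun s => fderiv ℝ F (s, t₀) (0, 1))
      (fderiv ℝ (leftHat p) (F (0, t₀)) (leftHat p (F (0, t₀)) (lieE E G (a t₀))) (lieE E G A))
      0 := by
    have h1 : HasDerivAt (fun s => F (s, t₀)) (leftHat p (F (0, t₀)) (lieE E G (a t₀))) 0 :=
      hFs hp ▸ hasDerivAt_fst ((hF hp).differentiableAt (by simp))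
    have h2 := HasFDerivAt.comp_hasDerivAt (F := E) (E := E →L[ℝ] E) 0 hL.hasFDerivAt h1
    have h3 := h2.clm_apply (hasDerivAt_const (0 : ℝ) (lieE E G A))
    rw [map_zero, add_zero] at h3
    refine h3.congr_of_eventuallyEq ?_
    have hct' : ContinuousAt (fun s : ℝ => (s, t₀)) 0 := (Continuous.prodMk_left t₀).continuousAt
    filter_upwards [hct'.eventually hU] with s hs using hFt hs
  -- With `L` the left frame in the chart, `∂s F = L a` and `∂t F = L A`. Equality of the mixed
  -- derivatives reads `DL(L A) a + L a' = DL(L a) A`, and by `leftHat_bracket` this is `a' = -[A,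
  -- a]`.
  have e3 := (hasDerivAt_snd (hd (1, 0))).unique e1
  have e4 := (hasDerivAt_fst (hd (0, 1))).unique e2
  rw [fderiv_fderiv_comm ((hF hp).of_le (by norm_cast)), e3] at e4
  refine ha'.congr_deriv ?_
  obtain ⟨e, he⟩ := leftHat_isInvertible hp
  apply e.injective
  have e5 : leftHat p (F (0, t₀)) a' = leftHat p (F (0, t₀)) (-lieE E G ⁅A, a t₀⁆) := by
    rw [map_neg, leftHat_bracket hp, neg_sub, ← e4, add_sub_cancel_left]
  rw [← he] at e5
  exact e5

/-- A straight line in the chart may leave its target, while the curve must be defined for all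
times. Replacing `s` by `ε sin(s / ε)` keeps the derivative `1` at `0` and bounds the excursion. -/
theorem exists_curve_hasDerivAt {M : Type*} [TopologicalSpace M] [ChartedSpace E M]
    [IsManifold 𝓘(ℝ, E) ∞ M] (p : M) (v : E) :
    ∃ h : ℝ → M, ContMDiff 𝓘(ℝ, ℝ) 𝓘(ℝ, E) ∞ h ∧ h 0 = p ∧
      HasDerivAt (fun s => extChartAt 𝓘(ℝ, E) p (h s)) v 0 := by
  obtain ⟨r, hr, hball⟩ := Metric.mem_nhds_iff.1 (extChartAt_target_mem_nhds (I := 𝓘(ℝ, E)) p)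
  -- This choice gives `ε ‖v‖ < r`; the added `1` covers `v = 0`.
  let ε := r / (‖v‖ + 1)
  have hε : 0 < ε := by positivity
  let u : ℝ → E := fun s => extChartAt 𝓘(ℝ, E) p p + (ε * Real.sin (s / ε)) • v
  have hu : ContDiff ℝ ∞ u := contDiff_const.add
    ((contDiff_const.mul (Real.contDiff_sin.comp (contDiff_id.div_const ε))).smul contDiff_const)
  have hmem (s : ℝ) : u s ∈ (extChartAt 𝓘(ℝ, E) p).target := by
    apply hball
    rw [mem_ball_iff_norm, add_sub_cancel_left, norm_smul, norm_mul, Real.norm_eq_abs,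
      Real.norm_eq_abs, abs_of_pos hε]
    calc ε * |Real.sin (s / ε)| * ‖v‖ ≤ ε * 1 * ‖v‖ := by
          gcongr
          exact Real.abs_sin_le_one _
      _ < ε * (‖v‖ + 1) := by nlinarith
      _ = r := div_mul_cancel₀ _ (by positivity)
  refine ⟨fun s => (extChartAt 𝓘(ℝ, E) p).symm (u s),
    (contMDiffOn_extChartAt_symm p).comp_contMDiff (contMDiff_iff_contDiff.2 hu) hmem, ?_, ?_⟩
  · simp [u]
  · have h1 : (fun s => extChartAt 𝓘(ℝ, E) p ((extChartAt 𝓘(ℝ, E) p).symm (u s))) = u :=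
      funext fun s => (extChartAt 𝓘(ℝ, E) p).right_inv (hmem s)
    rw [h1]
    have h2 : HasDerivAt (fun s : ℝ => ε * Real.sin (s / ε)) 1 0 := by
      have := ((hasDerivAt_id (0 : ℝ)).div_const ε).sin.const_mul ε
      refine this.congr_deriv ?_
      simp [hε.ne']
    have h3 := (h2.smul_const v).const_add (extChartAt 𝓘(ℝ, E) p p)
    rw [one_smul] at h3
    exact h3

theorem exists_variation {A : LieAlg E G} {δ : ℝ → G} (hδ : IsExpCurve 1 A δ) (g : G)
    (C : LieAlg E G) :
    ∃ h : ℝ → G, ContMDiff 𝓘(ℝ, ℝ) 𝓘(ℝ, E) ∞ h ∧ h 0 = g ∧ ∃ a : ℝ → LieAlg E G, a 0 = C ∧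
      (∀ t, velocity (fun s => h s * δ t) 0 = leftTranslate (h 0 * δ t) (a t)) ∧
      (∀ t, HasDerivAt (fun t => lieE E G (a t)) (-lieE E G ⁅A, a t⁆) t) := by
  obtain ⟨h, hh, h0, hd⟩ := exists_curve_hasDerivAt g (tr g g (leftTranslate g C))
  obtain ⟨a, ha, ha'⟩ := exists_leftTranslate_variation hδ hh
  refine ⟨h, hh, h0, a, ?_, ha, ha'⟩
  have hg := mem_chart_source E g
  have h1 : h 0 * δ 0 = g := by rw [h0, hδ.initial, mul_one]
  have h2 : ContMDiff 𝓘(ℝ, ℝ) 𝓘(ℝ, E) ∞ (fun s => h s * δ 0) := hh.mul contMDiff_const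
  have h3 := tr_velocity (h2.mdifferentiable (by simp) 0) (p := g) (h1 ▸ hg)
  rw [ha 0] at h3
  have h4 : (fun s => extChartAt 𝓘(ℝ, E) g (h s * δ 0)) = fun s => extChartAt 𝓘(ℝ, E) g (h s) := by
    funext s
    rw [hδ.initial, mul_one]
  rw [h4] at h3
  have h5 : ∀ x, x = g → tr g x (leftTranslate x (a 0)) = tr g g (leftTranslate g (a 0)) := by
    rintro _ rfl
    rfl
  apply leftTranslate_injective g
  rw [← ts_tr hg (leftTranslate g (a 0)), ← h5 _ h1, h3.unique hd, ts_tr hg]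

end LieGroupVariation

/-! ### Left-invariant fields projected by a map `q`, and their covariant derivatives. -/

section Submersion

set_option linter.unusedSectionVars false

variable {E : Type*} [NormedAddCommGroup E] [NormedSpace ℝ E]
  {G : Type*} [TopologicalSpace G] [ChartedSpace E G] [Group G] [LieGroup 𝓘(ℝ, E) ∞ G]
  {N : Type*} [TopologicalSpace N]
  {E' : Type*} [NormedAddCommGroup E'] [NormedSpace ℝ E']
  [ChartedSpace E' N] [IsManifold 𝓘(ℝ, E') ∞ N]

/-- The differential of `q : G → N` on left-invariant fields, in charts at `g₀` and `p`. -/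
def leftDiffHat (q : G → N) (p : N) (g₀ : G) (x : E) : E →L[ℝ] E' :=
  (fderiv ℝ (fun x => extChartAt 𝓘(ℝ, E') p (q ((extChartAt 𝓘(ℝ, E) g₀).symm x))) x).comp
    (leftHat g₀ x)

variable {q : G → N} (hq : ContMDiff 𝓘(ℝ, E) 𝓘(ℝ, E') ∞ q)
include hq

theorem contDiffAt_written {p : N} {g₀ g : G} (hg : g ∈ (chartAt E g₀).source)
    (hp : q g ∈ (chartAt E' p).source) :
    ContDiffAt ℝ ∞ (fun x => extChartAt 𝓘(ℝ, E') p (q ((extChartAt 𝓘(ℝ, E) g₀).symm x)))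
      (extChartAt 𝓘(ℝ, E) g₀ g) := by
  have h1 : ContMDiffAt 𝓘(ℝ, E) 𝓘(ℝ, E') ∞ (fun x => q ((extChartAt 𝓘(ℝ, E) g₀).symm x))
      (extChartAt 𝓘(ℝ, E) g₀ g) := hq.contMDiffAt.comp _ (contMDiffAt_extChartAt_symm hg)
  refine contMDiffAt_iff_contDiffAt.1 (ContMDiffAt.comp _ ?_ h1)
  rw [extChartAt_symm_apply hg]
  exact contMDiffAt_extChartAt_of_mem hp

theorem leftDiffHat_apply {p : N} {g₀ g : G} (hg : g ∈ (chartAt E g₀).source)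
    (hp : q g ∈ (chartAt E' p).source) (X : LieAlg E G) :
    leftDiffHat q p g₀ (extChartAt 𝓘(ℝ, E) g₀ g) (lieE E G X) =
      tr p (q g) (mfderiv 𝓘(ℝ, E) 𝓘(ℝ, E') q g (leftTranslate g X)) := by
  have h1 := (contMDiffAt_iff_contDiffAt.2 (contDiffAt_written hq hg hp)).mdifferentiableAt
    (by simp)
  have h2 := mfderiv_comp g h1 ((contMDiffAt_extChartAt_of_mem hg).mdifferentiableAt (by simp))
  have h3 := mfderiv_comp g ((contMDiffAt_extChartAt_of_mem hp).mdifferentiableAt (by simp))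
    (hq.mdifferentiable (by simp) g)
  have h4 : (fun x => extChartAt 𝓘(ℝ, E') p (q ((extChartAt 𝓘(ℝ, E) g₀).symm x))) ∘
      extChartAt 𝓘(ℝ, E) g₀ =ᶠ[𝓝 g] extChartAt 𝓘(ℝ, E') p ∘ q := by
    filter_upwards [(chartAt E g₀).open_source.mem_nhds hg] with y hy
    simp only [Function.comp_apply]
    rw [extChartAt_symm_apply hy]
  rw [h4.mfderiv_eq, h3, ← tr_eq_mfderiv hg, ← tr_eq_mfderiv hp, mfderiv_eq_fderiv] at h2
  have h5 := congrArg (fun L => L (leftTranslate g X)) h2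
  rw [leftDiffHat]
  refine Eq.trans ?_ h5.symm
  change fderiv ℝ _ _ (leftHat g₀ _ _) = fderiv ℝ _ _ _
  rw [leftHat_apply hg, ContinuousLinearEquiv.symm_apply_apply]
  rfl

theorem tr_mfderiv_eq_fderiv {p : N} {g₀ g : G} (hg : g ∈ (chartAt E g₀).source)
    (hp : q g ∈ (chartAt E' p).source) (X : LieAlg E G) :
    fderiv ℝ (fun x => extChartAt 𝓘(ℝ, E') p (q ((extChartAt 𝓘(ℝ, E) g₀).symm x)))
      (extChartAt 𝓘(ℝ, E) g₀ g) (leftHat g₀ (extChartAt 𝓘(ℝ, E) g₀ g) (lieE E G X)) =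
      tr p (q g) (mfderiv 𝓘(ℝ, E) 𝓘(ℝ, E') q g (leftTranslate g X)) :=
  leftDiffHat_apply hq hg hp X

-- A submersion has a local section through every point, and the chain rule makes the derivative of
-- that section a right inverse.
omit hq in
theorem mfderiv_surjective_of_isSubmersion (hq : Manifold.IsSubmersion 𝓘(ℝ, E) 𝓘(ℝ, E') ∞ q)
    (g : G) : Function.Surjective (mfderiv 𝓘(ℝ, E) 𝓘(ℝ, E') q g) := by
  have h := hq.isSubmersionAt g
  let a := h.domChart
  let b := h.codChart
  have hw : ∀ x ∈ a.target, b (q (a.symm x)) = (h.equiv x).1 := fun x hx =>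
    h.writtenInCharts (by simpa [OpenPartialHomeomorph.extend_target] using hx)
  have hga : g ∈ a.source := h.mem_domChart_source
  have hgb : q g ∈ b.source := h.mem_codChart_source
  -- In the adapted charts `q` is the projection to the first factor; freezing the second coordinate
  -- at its value at `g` makes the section pass through `g`.
  let τ : N → E := fun y => h.equiv.symm (b y, (h.equiv (a g)).2)
  have hτg : τ (q g) = a g := by
    have := hw (a g) (a.map_source hga)
    rw [a.left_inv hga] at this
    simp only [τ, this]
    exact h.equiv.symm_apply_apply _
  have hb : ContMDiffAt 𝓘(ℝ, E') 𝓘(ℝ, E') ∞ b (q g) :=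
    contMDiffAt_of_mem_maximalAtlas h.codChart_mem_maximalAtlas hgb
  have hτ : ContMDiffAt 𝓘(ℝ, E') 𝓘(ℝ, E) ∞ τ (q g) :=
    (contMDiffAt_iff_contDiffAt.2 (h.equiv.symm.contDiff.contDiffAt)).comp (q g)
      (ContMDiffAt.prodMk_space hb contMDiffAt_const)
  have hτa : τ (q g) ∈ a.target := hτg ▸ a.map_source hga
  have ha : ContMDiffAt 𝓘(ℝ, E) 𝓘(ℝ, E) ∞ a.symm (τ (q g)) :=
    contMDiffAt_symm_of_mem_maximalAtlas h.domChart_mem_maximalAtlas hτa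
  have hσ := (ha.comp (q g) hτ).mdifferentiableAt (by simp)
  have hσg : (a.symm ∘ τ) (q g) = g := by
    rw [Function.comp_apply, hτg, a.left_inv hga]
  have hinv : q ∘ (a.symm ∘ τ) =ᶠ[𝓝 (q g)] id := by
    filter_upwards [b.open_source.mem_nhds hgb,
      hτ.continuousAt.preimage_mem_nhds (a.open_target.mem_nhds hτa)] with y hy hy'
    refine b.injOn (h.source_subset_preimage_source (a.map_target hy')) hy ?_
    refine (hw _ hy').trans ?_
    simp [τ]
  have hqd : MDifferentiableAt 𝓘(ℝ, E) 𝓘(ℝ, E') q ((a.symm ∘ τ) (q g)) :=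
    hq.contMDiff.mdifferentiable (by simp) _
  have hc := mfderiv_comp (q g) hqd hσ
  rw [hinv.mfderiv_eq, mfderiv_id] at hc
  have hsurj : Function.Surjective (mfderiv 𝓘(ℝ, E) 𝓘(ℝ, E') q ((a.symm ∘ τ) (q g))) := fun w =>
    ⟨mfderiv 𝓘(ℝ, E') 𝓘(ℝ, E) (a.symm ∘ τ) (q g) w, (congrArg (fun L => L w) hc).symm⟩
  rw [hσg] at hsurj
  exact hsurj

variable [FiniteDimensional ℝ E]

theorem contDiffAt_leftDiffHat {p : N} {g₀ g : G} (hg : g ∈ (chartAt E g₀).source)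
    (hp : q g ∈ (chartAt E' p).source) :
    ContDiffAt ℝ ∞ (leftDiffHat (E := E) (E' := E') q p g₀) (extChartAt 𝓘(ℝ, E) g₀ g) :=
  ((contDiffAt_written hq hg hp).fderiv_right (m := ∞) (by simp)).clm_comp (contDiffAt_leftHat hg)

/-- The second derivative of `q` in charts is symmetric and cancels in the difference, leaving the
derivative of the left frame, which is the bracket. -/
theorem fderiv_leftDiffHat_sub {p : N} {g₀ g : G} (hg : g ∈ (chartAt E g₀).source)
    (hp : q g ∈ (chartAt E' p).source) (A X : LieAlg E G) :
    fderiv ℝ (leftDiffHat (E := E) (E' := E') q p g₀) (extChartAt 𝓘(ℝ, E) g₀ g)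
        (leftHat g₀ (extChartAt 𝓘(ℝ, E) g₀ g) (lieE E G A)) (lieE E G X) -
      fderiv ℝ (leftDiffHat (E := E) (E' := E') q p g₀) (extChartAt 𝓘(ℝ, E) g₀ g)
        (leftHat g₀ (extChartAt 𝓘(ℝ, E) g₀ g) (lieE E G X)) (lieE E G A) =
      leftDiffHat q p g₀ (extChartAt 𝓘(ℝ, E) g₀ g) (lieE E G ⁅A, X⁆) := by
  have h1 := contDiffAt_written hq hg hp
  have h2 := ((h1.fderiv_right (m := ∞) (by simp)).differentiableAt (by simp)).hasFDerivAt.clm_comp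
    ((contDiffAt_leftHat hg).differentiableAt (by simp)).hasFDerivAt
  have h3 := ((h1.of_le (m := 2) (by norm_cast)).isSymmSndFDerivAt (by simp)).eq
    (leftHat g₀ (extChartAt 𝓘(ℝ, E) g₀ g) (lieE E G A))
    (leftHat g₀ (extChartAt 𝓘(ℝ, E) g₀ g) (lieE E G X))
  have h4 : leftDiffHat (E := E) (E' := E') q p g₀ = fun x =>
    (fderiv ℝ (fun x => extChartAt 𝓘(ℝ, E') p (q ((extChartAt 𝓘(ℝ, E) g₀).symm x))) x).comp
    (leftHat g₀ x) := rfl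
  rw [h4, h2.fderiv]
  simp only [add_apply, ContinuousLinearMap.comp_apply, ContinuousLinearMap.compL_apply,
    ContinuousLinearMap.flip_apply]
  rw [leftHat_bracket hg, map_sub, h3]
  abel

/-- The covariant derivative of left-invariant fields projected by `q`, in the charts at `g` and
`q g`. -/
def leftChr [FiniteDimensional ℝ E']
    (nabla : CovariantDerivative 𝓘(ℝ, E') E' (TangentSpace 𝓘(ℝ, E') : N → Type _))
    (q : G → N) (g : G) (A X : LieAlg E G) : E' :=
  fderiv ℝ (leftDiffHat (E := E) (E' := E') q (q g) g) (extChartAt 𝓘(ℝ, E) g g)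
      (leftHat g (extChartAt 𝓘(ℝ, E) g g) (lieE E G A)) (lieE E G X) +
    chr nabla (q g) (extChartAt 𝓘(ℝ, E') (q g) (q g))
      (tr (q g) (q g) (mfderiv 𝓘(ℝ, E) 𝓘(ℝ, E') q g (leftTranslate g X)))
      (tr (q g) (q g) (mfderiv 𝓘(ℝ, E) 𝓘(ℝ, E') q g (leftTranslate g A)))

variable [FiniteDimensional ℝ E']
  {nabla : CovariantDerivative 𝓘(ℝ, E') E' (TangentSpace 𝓘(ℝ, E') : N → Type _)}

/-- By the product rule, the moving coefficients contribute `x'`, and the frame, transported along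
`γ`, contributes `leftChr`. -/
theorem tr_covDerivAlong_leftTranslate {U : G} {A : LieAlg E G} {γ : ℝ → G}
    (hγ : IsExpCurve U A γ) {x : ℝ → LieAlg E G} {x' : LieAlg E G} {t : ℝ}
    (hx : HasDerivAt (fun s => lieE E G (x s)) (lieE E G x') t) :
    tr (q (γ t)) (q (γ t)) (covDerivAlong nabla (fun s => q (γ s))
      (fun s => mfderiv 𝓘(ℝ, E) 𝓘(ℝ, E') q (γ s) (leftTranslate (γ s) (x s))) t) =
      tr (q (γ t)) (q (γ t)) (mfderiv 𝓘(ℝ, E) 𝓘(ℝ, E') q (γ t) (leftTranslate (γ t) x')) +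
        leftChr nabla q (γ t) A (x t) := by
  have hg := mem_chart_source E (γ t)
  have hp := mem_chart_source E' (q (γ t))
  have hγd := hγ.contMDiff.mdifferentiable (by simp) t
  have hqγ : ContMDiff 𝓘(ℝ, ℝ) 𝓘(ℝ, E') ∞ (fun s => q (γ s)) := hq.comp hγ.contMDiff
  have h1 : HasDerivAt (fun s => extChartAt 𝓘(ℝ, E) (γ t) (γ s))
      (leftHat (γ t) (extChartAt 𝓘(ℝ, E) (γ t) (γ t)) (lieE E G A)) t := by
    have := tr_velocity hγd hg
    rw [velocity_eq_leftTranslate hγ] at this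
    rw [leftHat_apply hg, ContinuousLinearEquiv.symm_apply_apply]
    exact this
  have h2 := HasFDerivAt.comp_hasDerivAt (F := E) (E := E →L[ℝ] E') t
    ((contDiffAt_leftDiffHat hq hg hp).differentiableAt (by simp)).hasFDerivAt h1
  have h3 : (fun s => tr (q (γ t)) (q (γ s))
      (mfderiv 𝓘(ℝ, E) 𝓘(ℝ, E') q (γ s) (leftTranslate (γ s) (x s)))) =ᶠ[𝓝 t] fun s =>
      leftDiffHat q (q (γ t)) (γ t) (extChartAt 𝓘(ℝ, E) (γ t) (γ s)) (lieE E G (x s)) := by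
    filter_upwards [hγ.contMDiff.continuous.continuousAt.preimage_mem_nhds
      ((chartAt E (γ t)).open_source.mem_nhds hg), hqγ.continuous.continuousAt.preimage_mem_nhds
      ((chartAt E' (q (γ t))).open_source.mem_nhds hp)] with s hs hs'
    rw [leftDiffHat_apply hq hs hs']
  have h4 := tr_covDerivAlong nabla (hqγ.mdifferentiable (by simp) t) hp
    ((h2.clm_apply hx).congr_of_eventuallyEq h3)
  have h5 : velocity (fun s => q (γ s)) t =
      mfderiv 𝓘(ℝ, E) 𝓘(ℝ, E') q (γ t) (leftTranslate (γ t) A) := by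
    rw [velocity_comp (hq.mdifferentiable (by simp) _) hγd, velocity_eq_leftTranslate hγ]
  rw [h5] at h4
  refine h4.trans ?_
  rw [← leftDiffHat_apply hq hg hp x', leftChr]
  simp only [Function.comp_apply]
  abel

variable [Bundle.RiemannianBundle (fun p : N => TangentSpace 𝓘(ℝ, E') p)]

/-- The torsion identity for projected left-invariant fields. These are fields along `q` and need
not descend to `N`, so the identity is derived in coordinates. -/
theorem leftChr_sub (hn : IsLeviCivita nabla) (g : G) (A X : LieAlg E G) :
    leftChr nabla q g A X - leftChr nabla q g X A =
      tr (q g) (q g) (mfderiv 𝓘(ℝ, E) 𝓘(ℝ, E') q g (leftTranslate g ⁅A, X⁆)) := by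
  have hg := mem_chart_source E g
  have hp := mem_chart_source E' (q g)
  rw [← leftDiffHat_apply hq hg hp, ← fderiv_leftDiffHat_sub hq hg hp, leftChr, leftChr,
    chr_symm hn (mem_extChartAt_target (q g))]
  abel

variable [IsContMDiffRiemannianBundle 𝓘(ℝ, E') ∞ E' (fun p : N => TangentSpace 𝓘(ℝ, E') p)]

/-- Differentiate the constant function `⟨dq X, dq Y⟩` in the direction of `A`; metric compatibility
turns the derivative of the metric into the Christoffel terms of `leftChr`. -/
theorem leftChr_skew (hn : IsLeviCivita nabla) (g : G) (A X Y : LieAlg E G) {c : ℝ}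
    (hc : ∀ g : G, inner ℝ (mfderiv 𝓘(ℝ, E) 𝓘(ℝ, E') q g (leftTranslate g X))
      (mfderiv 𝓘(ℝ, E) 𝓘(ℝ, E') q g (leftTranslate g Y)) = c) :
    met (q g) (extChartAt 𝓘(ℝ, E') (q g) (q g)) (leftChr nabla q g A X)
      (tr (q g) (q g) (mfderiv 𝓘(ℝ, E) 𝓘(ℝ, E') q g (leftTranslate g Y))) +
    met (q g) (extChartAt 𝓘(ℝ, E') (q g) (q g))
      (tr (q g) (q g) (mfderiv 𝓘(ℝ, E) 𝓘(ℝ, E') q g (leftTranslate g X)))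
      (leftChr nabla q g A Y) = 0 := by
  have hg := mem_chart_source E g
  have hp := mem_chart_source E' (q g)
  let p := q g
  let x₀ := extChartAt 𝓘(ℝ, E) g g
  let w : E → E' := fun x => extChartAt 𝓘(ℝ, E') p (q ((extChartAt 𝓘(ℝ, E) g).symm x))
  have hw0 : w x₀ = extChartAt 𝓘(ℝ, E') p p := by
    simp only [w, x₀]
    rw [extChartAt_symm_apply hg]
  have hw : HasFDerivAt w (fderiv ℝ w x₀) x₀ :=
    ((contDiffAt_written hq hg hp).differentiableAt (by simp)).hasFDerivAt
  have hQ : HasFDerivAt (leftDiffHat (E := E) (E' := E') q p g)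
      (fderiv ℝ (leftDiffHat (E := E) (E' := E') q p g) x₀) x₀ :=
    ((contDiffAt_leftDiffHat hq hg hp).differentiableAt (by simp)).hasFDerivAt
  let v : E := leftHat g x₀ (lieE E G A)
  -- Only the velocity at `0` matters, so a segment in the chart replaces the integral curve of `A`.
  let u : ℝ → E := fun s => x₀ + s • v
  have hu0 : u 0 = x₀ := by simp [u]
  have hu : HasDerivAt u v 0 := by
    have := ((hasDerivAt_id (0 : ℝ)).smul_const v).const_add x₀
    rw [one_smul] at this
    exact this
  rw [← hu0] at hw hQ
  have hwu := HasFDerivAt.comp_hasDerivAt (F := E) (E := E') 0 hw hu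
  have hQu := HasFDerivAt.comp_hasDerivAt (F := E) (E := E →L[ℝ] E') 0 hQ hu
  have hX := hQu.clm_apply (hasDerivAt_const (0 : ℝ) (lieE E G X))
  have hY := hQu.clm_apply (hasDerivAt_const (0 : ℝ) (lieE E G Y))
  rw [map_zero, add_zero] at hX hY
  have hm : DifferentiableAt ℝ (met (E := E') p) ((w ∘ u) 0) := by
    rw [Function.comp_apply, hu0, hw0]
    exact (contDiffAt_met (mem_extChartAt_target p)).differentiableAt (by simp)
  have h1 := hasDerivAt_bilin hm hwu hX hY
  have h2 : (fun s => met p ((w ∘ u) s) ((leftDiffHat (E := E) (E' := E') q p g ∘ u) s (lieE E G X))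
      ((leftDiffHat (E := E) (E' := E') q p g ∘ u) s (lieE E G Y))) =ᶠ[𝓝 0] fun _ => c := by
    have hc0 : ContinuousAt (fun s => (extChartAt 𝓘(ℝ, E) g).symm (u s)) 0 := by
      refine ContinuousAt.comp (g := (extChartAt 𝓘(ℝ, E) g).symm) ?_ hu.continuousAt
      rw [hu0]
      exact continuousAt_extChartAt_symm g
    have hg0 : (extChartAt 𝓘(ℝ, E) g).symm (u 0) = g := by
      rw [hu0]
      exact extChartAt_symm_apply hg
    filter_upwards [hu.continuousAt.preimage_mem_nhds (by
      rw [hu0]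
      exact target_mem_nhds hg), hc0.preimage_mem_nhds (by
      rw [hg0]
      exact hq.continuous.continuousAt.preimage_mem_nhds
        ((chartAt E' p).open_source.mem_nhds hp))] with s hs hs'
    have e1 := leftDiffHat_apply hq (mem_chart_target hs) hs' X
    have e2 := leftDiffHat_apply hq (mem_chart_target hs) hs' Y
    rw [(extChartAt 𝓘(ℝ, E) g).right_inv hs] at e1 e2
    simp only [Function.comp_apply]
    rw [e1, e2]
    exact (met_tr hs' _ _).trans (hc _)
  have h3 := (h1.congr_of_eventuallyEq h2.symm).unique (hasDerivAt_const (0 : ℝ) c)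
  simp only [Function.comp_apply, hu0, hw0] at h3
  have h4 : fderiv ℝ w x₀ v = tr p p (mfderiv 𝓘(ℝ, E) 𝓘(ℝ, E') q g (leftTranslate g A)) :=
    tr_mfderiv_eq_fderiv hq hg hp A
  rw [fderiv_met hn (mem_extChartAt_target p), h4] at h3
  have eX := leftDiffHat_apply hq hg hp X
  have eY := leftDiffHat_apply hq hg hp Y
  simp only [x₀, p] at h3
  rw [eX, eY] at h3
  simp only [leftChr, map_add, add_apply]
  linarith

end Submersion

/-! ### Calculus of curves in the Lie algebra. -/

section LieAlgebraCurves

variable {E : Type*} [NormedAddCommGroup E] [NormedSpace ℝ E]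
  {G : Type*} [TopologicalSpace G] [ChartedSpace E G] [Group G]

/-- The curve `x` in the Lie algebra has derivative `x'` at `t`. -/
def HasLieDerivAt (x : ℝ → LieAlg E G) (x' : LieAlg E G) (t : ℝ) : Prop :=
  HasDerivAt (fun s => lieE E G (x s)) (lieE E G x') t

theorem HasLieDerivAt.congr_deriv {x : ℝ → LieAlg E G} {x' y' : LieAlg E G} {t : ℝ}
    (hx : HasLieDerivAt x x' t) (h : x' = y') : HasLieDerivAt x y' t := h ▸ hx

theorem HasLieDerivAt.add {x y : ℝ → LieAlg E G} {x' y' : LieAlg E G} {t : ℝ}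
    (hx : HasLieDerivAt x x' t) (hy : HasLieDerivAt y y' t) :
    HasLieDerivAt (fun s => x s + y s) (x' + y') t := by
  have := HasDerivAt.add hx hy
  rw [← map_add] at this
  exact this

theorem HasLieDerivAt.const_smul {x : ℝ → LieAlg E G} {x' : LieAlg E G} {t : ℝ} (r : ℝ)
    (hx : HasLieDerivAt x x' t) : HasLieDerivAt (fun s => r • x s) (r • x') t := by
  have := HasDerivAt.const_smul r hx
  rw [← map_smul] at this
  exact this

theorem hasLieDerivAt_smul_const {r : ℝ → ℝ} {r' t : ℝ} (h : HasDerivAt r r' t) (X : LieAlg E G) :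
    HasLieDerivAt (fun s => r s • X) (r' • X) t := by
  have := h.smul_const (lieE E G X)
  rw [← map_smul] at this
  exact this

theorem hasLieDerivAt_const (X : LieAlg E G) (t : ℝ) : HasLieDerivAt (fun _ => X) 0 t := by
  have := hasDerivAt_const t (lieE E G X)
  rw [← map_zero (lieE E G)] at this
  exact this

theorem HasLieDerivAt.unique {x : ℝ → LieAlg E G} {x' y' : LieAlg E G} {t : ℝ}
    (hx : HasLieDerivAt x x' t) (hy : HasLieDerivAt x y' t) : x' = y' :=
  (lieE E G).injective (HasDerivAt.unique hx hy)

variable [FiniteDimensional ℝ E]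

variable (E G) in
/-- An endomorphism of the Lie algebra, as a continuous linear map of the model space. -/
def endE (L : Module.End ℝ (LieAlg E G)) : E →L[ℝ] E :=
  LinearMap.toContinuousLinearMap
    (((lieE E G : LieAlg E G →ₗ[ℝ] E) ∘ₗ L) ∘ₗ ((lieE E G).symm : E →ₗ[ℝ] LieAlg E G))

theorem endE_apply (L : Module.End ℝ (LieAlg E G)) (X : LieAlg E G) :
    endE E G L (lieE E G X) = lieE E G (L X) := rfl

theorem HasLieDerivAt.map {x : ℝ → LieAlg E G} {x' : LieAlg E G} {t : ℝ}
    (hx : HasLieDerivAt x x' t) (L : Module.End ℝ (LieAlg E G)) :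
    HasLieDerivAt (fun s => L (x s)) (L x') t :=
  (endE E G L).hasFDerivAt.comp_hasDerivAt t hx

/-- Uniqueness for second order linear equations in the Lie algebra. -/
theorem eq_of_hasLieDerivAt_second_order {x x' y y' : ℝ → LieAlg E G}
    (P Q : Module.End ℝ (LieAlg E G))
    (hx : ∀ t, HasLieDerivAt x (x' t) t) (hx' : ∀ t, HasLieDerivAt x' (P (x t) + Q (x' t)) t)
    (hy : ∀ t, HasLieDerivAt y (y' t) t) (hy' : ∀ t, HasLieDerivAt y' (P (y t) + Q (y' t)) t)
    (h0 : x 0 = y 0) (h0' : x' 0 = y' 0) : x = y := by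
  -- The equation as a first-order system `(x, x')' = (x', P x + Q x')`, which is linear and hence
  -- Lipschitz.
  let L : E × E →L[ℝ] E × E := (ContinuousLinearMap.snd ℝ E E).prod
    ((endE E G P).comp (ContinuousLinearMap.fst ℝ E E) +
      (endE E G Q).comp (ContinuousLinearMap.snd ℝ E E))
  have key := ODE_solution_unique_univ (v := fun _ => L) (s := fun _ => Set.univ) (t₀ := 0)
    (f := fun t => (lieE E G (x t), lieE E G (x' t)))
    (g := fun t => (lieE E G (y t), lieE E G (y' t)))
    (fun _ => L.lipschitz.lipschitzOnWith)
    (fun t => ⟨(hx t).prodMk (hx' t), trivial⟩) (fun t => ⟨(hy t).prodMk (hy' t), trivial⟩)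
    (by rw [h0, h0'])
  funext t
  exact (lieE E G).injective (congrArg Prod.fst (congrFun key t))

end LieAlgebraCurves

/-! ### The Levi-Civita connection of the naturally reductive space. -/

section Homogeneous

set_option linter.unusedSectionVars false

variable {E : Type*} [NormedAddCommGroup E] [NormedSpace ℝ E] [FiniteDimensional ℝ E]
  {E' : Type*} [NormedAddCommGroup E'] [NormedSpace ℝ E']
  {G : Type*} [TopologicalSpace G] [ChartedSpace E G] [Group G] [LieGroup 𝓘(ℝ, E) ∞ G]
  {K : Subgroup G} [ChartedSpace E' (G ⧸ K)]

namespace NaturallyReductive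

variable (E' K) in
/-- The map `X ↦ d𝔮 (dL_g X)` on the Lie algebra. -/
def dprojLeft (g : G) :
    LieAlg E G →L[ℝ] TangentSpace 𝓘(ℝ, E') (QuotientGroup.mk g : G ⧸ K) :=
  (dproj E K E' g).comp (leftTranslateL g)

variable (S : NaturallyReductive E K)

/-- The projection of the Lie algebra onto `𝔟`, as an endomorphism. -/
def endB : Module.End ℝ (LieAlg E G) := S.𝔟.subtype ∘ₗ S.projB

theorem endB_apply (X : LieAlg E G) : S.endB X = S.projB X := rfl

theorem projB_coe (X : S.𝔟) : S.projB X = X :=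
  Submodule.projectionOnto_apply_left S.isCompl X

theorem projB_of_mem {X : LieAlg E G} (hX : X ∈ S.𝔟) : (S.projB X : LieAlg E G) = X :=
  congrArg Subtype.val (S.projB_coe ⟨X, hX⟩)

theorem projB_add_projK (X : LieAlg E G) : (S.projB X : LieAlg E G) + S.projK X = X :=
  Submodule.projection_add_projection_eq_self S.isCompl X

theorem projB_of_mem_𝔨 {X : LieAlg E G} (hX : X ∈ S.𝔨) : S.projB X = 0 :=
  (Submodule.projectionOnto_apply_eq_zero_iff S.isCompl).2 hX

theorem lie_mem_of_mem_𝔨 (A : S.𝔟) {D : LieAlg E G} (hD : D ∈ S.𝔨) :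
    ⁅(A : LieAlg E G), D⁆ ∈ S.𝔟 := by
  rw [← lie_skew]
  exact S.𝔟.neg_mem (S.bracket_mem D hD A A.2)

theorem form_adB (A X Y : S.𝔟) : S.form (S.projB ⁅(A : LieAlg E G), (X : LieAlg E G)⁆) Y +
    S.form X (S.projB ⁅(A : LieAlg E G), (Y : LieAlg E G)⁆) = 0 := by
  rw [add_comm]
  exact S.natural X Y A

theorem form_self_eq_zero {X : S.𝔟} (h : S.form X X = 0) : X = 0 := by
  by_contra hX
  exact (S.form_pos X hX).ne' h

/-- The curve `g exp(tX)` stays in the coset `g K`, so its projection is constant. -/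
theorem dprojLeft_mem_𝔨 (hq : ContMDiff 𝓘(ℝ, E) 𝓘(ℝ, E') ∞ (QuotientGroup.mk : G → G ⧸ K))
    (g : G) {X : LieAlg E G} (hX : X ∈ S.𝔨) : dprojLeft E' K g X = 0 := by
  obtain ⟨γ, hγ, hK⟩ := (S.mem_𝔨 X).1 hX
  have h1 := hγ.mul_left g
  have h2 := velocity_comp (hq.mdifferentiable (by simp) _)
    (h1.contMDiff.mdifferentiable (by simp) 0)
  rw [velocity_eq_leftTranslate h1] at h2
  have h3 : (fun s => (QuotientGroup.mk (g * γ s) : G ⧸ K)) = fun _ => QuotientGroup.mk g := by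
    funext s
    exact QuotientGroup.mk_mul_of_mem g (hK s)
  have h4 : (velocity (fun s => (QuotientGroup.mk (g * γ s) : G ⧸ K)) 0 : E') = 0 := by
    rw [h3, velocity, mfderiv_const]
    rfl
  have h5 : ∀ y, y = g → dprojLeft E' K y X = 0 →
      dprojLeft E' K g X = 0 := by
    rintro _ rfl h
    exact h
  exact h5 (g * γ 0) (by rw [hγ.initial, mul_one]) (h2.symm.trans h4)

theorem dprojLeft_projB (hq : ContMDiff 𝓘(ℝ, E) 𝓘(ℝ, E') ∞ (QuotientGroup.mk : G → G ⧸ K))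
    (g : G) (X : LieAlg E G) : dprojLeft E' K g (S.projB X : LieAlg E G) =
      dprojLeft E' K g X := by
  have h1 := map_add (dprojLeft E' K g) (S.projB X : LieAlg E G) (S.projK X)
  rw [S.projB_add_projK] at h1
  refine Eq.trans ?_ h1.symm
  exact (add_zero _).symm.trans
    (congrArg (dprojLeft E' K g (S.projB X : LieAlg E G) + ·)
      (S.dprojLeft_mem_𝔨 hq g (S.projK X).2).symm)

variable [Bundle.RiemannianBundle (fun p : G ⧸ K => TangentSpace 𝓘(ℝ, E') p)]

theorem inner_dprojLeft {S : NaturallyReductive E K} (hm : S.IsInducedMetric (E' := E')) (g : G)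
    (X Y : S.𝔟) : inner ℝ (dprojLeft E' K g (X : LieAlg E G)) (dprojLeft E' K g (Y : LieAlg E G)) =
      S.form X Y := hm g X Y

theorem dprojLeft_injective {S : NaturallyReductive E K} (hm : S.IsInducedMetric (E' := E')) (g : G)
    {X Y : S.𝔟} (h : dprojLeft E' K g (X : LieAlg E G) = dprojLeft E' K g (Y : LieAlg E G)) :
    X = Y := by
  rw [← sub_eq_zero]
  apply S.form_self_eq_zero
  have h1 : dprojLeft E' K g ((X - Y : S.𝔟) : LieAlg E G) = 0 := by
    rw [Submodule.coe_sub, map_sub, h, sub_self]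
  rw [← inner_dprojLeft hm g, h1, inner_zero_left]

variable [IsManifold 𝓘(ℝ, E') ∞ (G ⧸ K)]

/-- The differential of the submersion is onto, and the `𝔨`-component of a preimage projects to
zero. -/
theorem exists_dprojLeft_eq
    (hq : Manifold.IsSubmersion 𝓘(ℝ, E) 𝓘(ℝ, E') ∞ (QuotientGroup.mk : G → G ⧸ K)) (g : G)
    (w : TangentSpace 𝓘(ℝ, E') (QuotientGroup.mk g : G ⧸ K)) :
    ∃ X : S.𝔟, dprojLeft E' K g (X : LieAlg E G) = w := by
  obtain ⟨v, hv⟩ := mfderiv_surjective_of_isSubmersion hq g w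
  obtain ⟨X, rfl⟩ := leftTranslate_surjective g v
  exact ⟨S.projB X, (S.dprojLeft_projB hq.contMDiff g X).trans hv⟩

variable [FiniteDimensional ℝ E']
  [IsContMDiffRiemannianBundle 𝓘(ℝ, E') ∞ E' (fun p : G ⧸ K => TangentSpace 𝓘(ℝ, E') p)]
  {nabla : CovariantDerivative 𝓘(ℝ, E') E' (TangentSpace 𝓘(ℝ, E') : (G ⧸ K) → Type _)}

/-- Let `T(A, X)` be the difference of the two sides. Vanishing torsion makes `T` symmetric. Metric
compatibility, together with the skewness of `[A, ·]_𝔟`, makes `⟨T(A, X), Y⟩` skew in `X` and `Y`.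
Hence `T = 0`. -/
theorem leftChr_eq {S : NaturallyReductive E K}
    (hq : Manifold.IsSubmersion 𝓘(ℝ, E) 𝓘(ℝ, E') ∞ (QuotientGroup.mk : G → G ⧸ K))
    (hm : S.IsInducedMetric (E' := E')) (hn : IsLeviCivita nabla) (g : G) (A X : S.𝔟) :
    leftChr nabla QuotientGroup.mk g (A : LieAlg E G) (X : LieAlg E G) =
      tr (QuotientGroup.mk g : G ⧸ K) (QuotientGroup.mk g : G ⧸ K) (dprojLeft E' K g
        ((1 / 2 : ℝ) • (S.projB ⁅(A : LieAlg E G), (X : LieAlg E G)⁆ : LieAlg E G))) := by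
  let p : G ⧸ K := QuotientGroup.mk g
  let B : E' →L[ℝ] E' →L[ℝ] ℝ := met p (extChartAt 𝓘(ℝ, E') p p)
  let Q : LieAlg E G →L[ℝ] E' := (tr p p).comp (dprojLeft E' K g)
  let T : S.𝔟 → S.𝔟 → E' := fun A X =>
    leftChr nabla QuotientGroup.mk g (A : LieAlg E G) (X : LieAlg E G) -
      (1 / 2 : ℝ) • Q (S.projB ⁅(A : LieAlg E G), (X : LieAlg E G)⁆ : LieAlg E G)
  have hQ (X Y : S.𝔟) : B (Q X) (Q Y) = S.form X Y :=
    (met_tr (mem_chart_source E' p) _ _).trans (inner_dprojLeft hm g X Y)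
  have hTs (A X : S.𝔟) : T A X = T X A := by
    have h1 : leftChr nabla QuotientGroup.mk g (A : LieAlg E G) (X : LieAlg E G) -
        leftChr nabla QuotientGroup.mk g (X : LieAlg E G) (A : LieAlg E G) =
          Q ⁅(A : LieAlg E G), (X : LieAlg E G)⁆ := leftChr_sub hq.contMDiff hn g A X
    have h2 : Q (S.projB ⁅(A : LieAlg E G), (X : LieAlg E G)⁆ : LieAlg E G) =
        Q ⁅(A : LieAlg E G), (X : LieAlg E G)⁆ :=
      congrArg (tr p p) (S.dprojLeft_projB hq.contMDiff g _)
    have h3 : Q (S.projB ⁅(X : LieAlg E G), (A : LieAlg E G)⁆ : LieAlg E G) =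
        -Q (S.projB ⁅(A : LieAlg E G), (X : LieAlg E G)⁆ : LieAlg E G) := by
      rw [← lie_skew, map_neg, Submodule.coe_neg, map_neg]
    rw [sub_eq_iff_eq_add] at h1
    simp only [T]
    rw [h1, h3, h2]
    module
  have hTk (A X Y : S.𝔟) : B (T A X) (Q Y) = -B (T A Y) (Q X) := by
    have h1 : B (leftChr nabla QuotientGroup.mk g (A : LieAlg E G) (X : LieAlg E G)) (Q Y) +
        B (Q X) (leftChr nabla QuotientGroup.mk g (A : LieAlg E G) (Y : LieAlg E G)) = 0 :=
      leftChr_skew hq.contMDiff hn g A X Y (fun g => inner_dprojLeft hm g X Y)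
    have h2 := S.form_adB A X Y
    have h3 : B (Q X) (leftChr nabla QuotientGroup.mk g (A : LieAlg E G) (Y : LieAlg E G)) =
        B (leftChr nabla QuotientGroup.mk g (A : LieAlg E G) (Y : LieAlg E G)) (Q X) :=
      met_symm _ _ _ _
    rw [h3] at h1
    rw [S.form_symm X] at h2
    simp only [T, map_sub, sub_apply, map_smul, smul_apply, hQ, smul_eq_mul]
    linarith
  -- Three skew exchanges alternating with three symmetric ones return to the same expression with
  -- the opposite sign.
  have h0 (A X Y : S.𝔟) : B (T A X) (Q Y) = 0 := by
    have := hTk A X Y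
    rw [hTs A Y, hTk Y A X, hTs Y X, hTk X Y A, hTs X A] at this
    linarith
  have hT : T A X = 0 := by
    apply met_injective (mem_extChartAt_target p)
    ext w
    -- Every tangent vector of the quotient is the projection of some `Y` in `𝔟`, so testing against
    -- such vectors suffices.
    obtain ⟨Y, hY⟩ := S.exists_dprojLeft_eq hq g (ts p p w)
    have h1 : Q (Y : LieAlg E G) = w := by
      change tr p p (dprojLeft E' K g (Y : LieAlg E G)) = w
      rw [hY, tr_ts (mem_chart_source E' p)]
    rw [map_zero, ← h1]
    exact h0 A X Y
  refine (sub_eq_zero.1 hT).trans ?_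
  rw [← map_smul]
  rfl

theorem covDerivAlong_dprojLeft {S : NaturallyReductive E K}
    (hq : Manifold.IsSubmersion 𝓘(ℝ, E) 𝓘(ℝ, E') ∞ (QuotientGroup.mk : G → G ⧸ K))
    (hm : S.IsInducedMetric (E' := E')) (hn : IsLeviCivita nabla) {U : G} {A : S.𝔟} {γ : ℝ → G}
    (hγ : IsExpCurve U (A : LieAlg E G) γ) {x : ℝ → S.𝔟} {x' : LieAlg E G} {t : ℝ}
    (hx : HasLieDerivAt (fun s => (x s : LieAlg E G)) x' t) :
    covDerivAlong nabla (fun s => (QuotientGroup.mk (γ s) : G ⧸ K))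
      (fun s => dprojLeft E' K (γ s) (x s : LieAlg E G)) t =
      dprojLeft E' K (γ t)
        (x' + (1 / 2 : ℝ) • (S.projB ⁅(A : LieAlg E G), (x t : LieAlg E G)⁆ : LieAlg E G)) := by
  have hp := mem_chart_source E' (QuotientGroup.mk (γ t) : G ⧸ K)
  have h1 := tr_covDerivAlong_leftTranslate (nabla := nabla) hq.contMDiff hγ hx
  rw [leftChr_eq hq hm hn] at h1
  have h2 := (map_add (tr (QuotientGroup.mk (γ t) : G ⧸ K) (QuotientGroup.mk (γ t) : G ⧸ K))
    (dprojLeft E' K (γ t) x') (dprojLeft E' K (γ t)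
      ((1 / 2 : ℝ) • (S.projB ⁅(A : LieAlg E G), (x t : LieAlg E G)⁆ : LieAlg E G))))
  rw [← map_add] at h2
  have h3 := congrArg (ts (QuotientGroup.mk (γ t) : G ⧸ K) (QuotientGroup.mk (γ t) : G ⧸ K))
    (h1.trans h2.symm)
  exact (ts_tr hp _).symm.trans (h3.trans (ts_tr hp _))

theorem velocity_mk
    (hq : Manifold.IsSubmersion 𝓘(ℝ, E) 𝓘(ℝ, E') ∞ (QuotientGroup.mk : G → G ⧸ K))
    {U : G} {A : LieAlg E G} {γ : ℝ → G} (hγ : IsExpCurve U A γ) (t : ℝ) :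
    velocity (fun s => (QuotientGroup.mk (γ s) : G ⧸ K)) t = dprojLeft E' K (γ t) A := by
  rw [velocity_comp (hq.contMDiff.mdifferentiable (by simp) _)
    (hγ.contMDiff.mdifferentiable (by simp) t), velocity_eq_leftTranslate hγ]
  rfl

/-- The velocity has constant coordinate `A`, and `[A, A] = 0`. -/
theorem isGeodesic_mk {S : NaturallyReductive E K}
    (hq : Manifold.IsSubmersion 𝓘(ℝ, E) 𝓘(ℝ, E') ∞ (QuotientGroup.mk : G → G ⧸ K))
    (hm : S.IsInducedMetric (E' := E')) (hn : IsLeviCivita nabla) {U : G} {A : S.𝔟} {γ : ℝ → G}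
    (hγ : IsExpCurve U (A : LieAlg E G) γ) :
    IsGeodesic nabla (fun s => (QuotientGroup.mk (γ s) : G ⧸ K)) where
  smooth := hq.contMDiff.comp hγ.contMDiff
  parallel t := by
    have h1 : velocity (fun s => (QuotientGroup.mk (γ s) : G ⧸ K)) =
        fun t => dprojLeft E' K (γ t) (A : LieAlg E G) := funext (velocity_mk hq hγ)
    rw [h1, covDerivAlong_dprojLeft hq hm hn hγ (x := fun _ => A) (hasLieDerivAt_const _ t),
      lie_self]
    simp

end NaturallyReductive

end Homogeneous

/-! ### The curvature in the direction of a geodesic. -/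

section HomogeneousJacobi

set_option linter.unusedSectionVars false

variable {E : Type*} [NormedAddCommGroup E] [NormedSpace ℝ E] [FiniteDimensional ℝ E]
  {E' : Type*} [NormedAddCommGroup E'] [NormedSpace ℝ E'] [FiniteDimensional ℝ E']
  {G : Type*} [TopologicalSpace G] [ChartedSpace E G] [Group G] [LieGroup 𝓘(ℝ, E) ∞ G]
  {K : Subgroup G} [ChartedSpace E' (G ⧸ K)] [IsManifold 𝓘(ℝ, E') ∞ (G ⧸ K)]
  [Bundle.RiemannianBundle (fun p : G ⧸ K => TangentSpace 𝓘(ℝ, E') p)]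
  [IsContMDiffRiemannianBundle 𝓘(ℝ, E') ∞ E' (fun p : G ⧸ K => TangentSpace 𝓘(ℝ, E') p)]
  {nabla : CovariantDerivative 𝓘(ℝ, E') E' (TangentSpace 𝓘(ℝ, E') : (G ⧸ K) → Type _)}

namespace NaturallyReductive

variable {S : NaturallyReductive E K}

theorem adOp_apply (A X : LieAlg E G) : adOp A X = ⁅A, X⁆ := rfl

/-- No curvature tensor is expanded: a variation of geodesics with initial field `C` has an
explicitly known variation field, and its Jacobi equation at `t = 0` is solved for the curvature
term. -/
theorem curvature_dprojLeft
    (hq : Manifold.IsSubmersion 𝓘(ℝ, E) 𝓘(ℝ, E') ∞ (QuotientGroup.mk : G → G ⧸ K))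
    (hm : S.IsInducedMetric (E' := E')) (hn : IsLeviCivita nabla) {A : S.𝔟} {δ : ℝ → G}
    (hδ : IsExpCurve 1 (A : LieAlg E G) δ) (g : G) (C : S.𝔟) :
    curvature nabla (QuotientGroup.mk g : G ⧸ K) (dprojLeft E' K g (C : LieAlg E G))
      (dprojLeft E' K g (A : LieAlg E G)) (dprojLeft E' K g (A : LieAlg E G)) =
      -dprojLeft E' K g ((1 / 4 : ℝ) • S.endB ⁅(A : LieAlg E G), S.endB ⁅(A : LieAlg E G),
        (C : LieAlg E G)⁆⁆ + ⁅(A : LieAlg E G), (S.projK ⁅(A : LieAlg E G), (C : LieAlg E G)⁆ :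
          LieAlg E G)⁆) := by
  obtain ⟨h, hh, h0, a, ha0, ha, ha'⟩ := exists_variation hδ g (C : LieAlg E G)
  have hγ := hδ.mul_left (h 0)
  have hf : ContMDiff 𝓘(ℝ, ℝ × ℝ) 𝓘(ℝ, E') ∞
      (fun z : ℝ × ℝ => (QuotientGroup.mk (h z.1 * δ z.2) : G ⧸ K)) :=
    hq.contMDiff.comp ((hh.comp (contMDiff_iff_contDiff.2 contDiff_fst)).mul
      (hδ.contMDiff.comp (contMDiff_iff_contDiff.2 contDiff_snd)))
  have jac := jacobi_of_geodesic_variation hn hf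
    fun s t => (isGeodesic_mk hq hm hn (hδ.mul_left (h s))).parallel t
  let x : ℝ → S.𝔟 := fun t => S.projB (a t)
  have hx (t : ℝ) : HasLieDerivAt (fun s => (x s : LieAlg E G))
      (-S.endB ⁅(A : LieAlg E G), a t⁆) t := by
    have h1 : HasLieDerivAt a (-⁅(A : LieAlg E G), a t⁆) t := by
      have := ha' t
      rw [← map_neg] at this
      exact this
    exact (h1.map S.endB).congr_deriv (map_neg _ _)
  -- The coordinate `x' + ½[A, x]_𝔟` of the covariant derivative, where `x = a_𝔟` and `x' = -[A,
  -- a]_𝔟`.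
  let y : ℝ → S.𝔟 := fun t => -S.projB ⁅(A : LieAlg E G), a t⁆ +
    (1 / 2 : ℝ) • S.projB ⁅(A : LieAlg E G), (x t : LieAlg E G)⁆
  have hy : HasLieDerivAt (fun s => (y s : LieAlg E G))
      (S.endB ⁅(A : LieAlg E G), ⁅(A : LieAlg E G), (C : LieAlg E G)⁆⁆ -
        (1 / 2 : ℝ) • S.endB ⁅(A : LieAlg E G), S.endB ⁅(A : LieAlg E G), (C : LieAlg E G)⁆⁆) 0 := by
    have h1 : HasLieDerivAt a (-⁅(A : LieAlg E G), a 0⁆) 0 := by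
      have := ha' 0
      rw [← map_neg] at this
      exact this
    have h2 := (h1.map (-(S.endB ∘ₗ adOp (A : LieAlg E G)))).add
      (((hx 0).map (S.endB ∘ₗ adOp (A : LieAlg E G))).const_smul (1 / 2))
    refine h2.congr_deriv ?_
    simp only [LinearMap.neg_apply, LinearMap.comp_apply, adOp_apply, ha0, map_neg]
    module
  have hJ : (fun t => velocity (fun s => (QuotientGroup.mk (h s * δ t) : G ⧸ K)) 0) =
      fun t => dprojLeft E' K (h 0 * δ t) (x t : LieAlg E G) := by
    funext t
    have h1 : ContMDiff 𝓘(ℝ, ℝ) 𝓘(ℝ, E) ∞ (fun s => h s * δ t) := hh.mul contMDiff_const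
    rw [velocity_comp (hq.contMDiff.mdifferentiable (by simp) _) (h1.mdifferentiable (by simp) 0),
      ha t]
    exact (S.dprojLeft_projB hq.contMDiff _ _).symm
  have hD : covDerivAlong nabla (fun t => (QuotientGroup.mk (h 0 * δ t) : G ⧸ K))
      (fun t => dprojLeft E' K (h 0 * δ t) (x t : LieAlg E G)) =
      fun t => dprojLeft E' K (h 0 * δ t) (y t : LieAlg E G) := by
    funext t
    rw [covDerivAlong_dprojLeft hq hm hn hγ (hx t)]
    rfl
  have jac' : covDerivAlong nabla (fun t => (QuotientGroup.mk (h 0 * δ t) : G ⧸ K))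
      (covDerivAlong nabla (fun t => (QuotientGroup.mk (h 0 * δ t) : G ⧸ K))
        fun t => velocity (fun s => (QuotientGroup.mk (h s * δ t) : G ⧸ K)) 0) 0 +
      curvature nabla (QuotientGroup.mk (h 0 * δ 0) : G ⧸ K)
        ((fun t => velocity (fun s => (QuotientGroup.mk (h s * δ t) : G ⧸ K)) 0) 0)
        (velocity (fun s => (QuotientGroup.mk (h 0 * δ s) : G ⧸ K)) 0)
        (velocity (fun s => (QuotientGroup.mk (h 0 * δ s) : G ⧸ K)) 0) = 0 := jac
  have hx0 : x 0 = C := by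
    simp only [x, ha0]
    exact S.projB_coe C
  rw [hJ, hD, covDerivAlong_dprojLeft hq hm hn hγ hy, velocity_mk hq hγ] at jac'
  simp only [hx0] at jac'
  -- Since `y(0) = -½[A, C]_𝔟`, the coefficient of `[A, [A, C]_𝔟]_𝔟` is `1 - ½ - ¼ = ¼`.
  have hval : (S.endB ⁅(A : LieAlg E G), ⁅(A : LieAlg E G), (C : LieAlg E G)⁆⁆ -
        (1 / 2 : ℝ) • S.endB ⁅(A : LieAlg E G), S.endB ⁅(A : LieAlg E G), (C : LieAlg E G)⁆⁆) +
        (1 / 2 : ℝ) • (S.projB ⁅(A : LieAlg E G), (y 0 : LieAlg E G)⁆ : LieAlg E G) =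
      (1 / 4 : ℝ) • S.endB ⁅(A : LieAlg E G), S.endB ⁅(A : LieAlg E G),
        (C : LieAlg E G)⁆⁆ + ⁅(A : LieAlg E G), (S.projK ⁅(A : LieAlg E G), (C : LieAlg E G)⁆ :
          LieAlg E G)⁆ := by
    have e1 : S.endB ⁅(A : LieAlg E G), ⁅(A : LieAlg E G), (C : LieAlg E G)⁆⁆ =
        S.endB ⁅(A : LieAlg E G), S.endB ⁅(A : LieAlg E G), (C : LieAlg E G)⁆⁆ +
        ⁅(A : LieAlg E G), (S.projK ⁅(A : LieAlg E G), (C : LieAlg E G)⁆ : LieAlg E G)⁆ := by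
      conv_lhs => rw [← S.projB_add_projK ⁅(A : LieAlg E G), (C : LieAlg E G)⁆]
      rw [lie_add, map_add]
      congr 1
      exact S.projB_of_mem (S.lie_mem_of_mem_𝔨 A (S.projK _).2)
    have e2 : (y 0 : LieAlg E G) =
        -((1 / 2 : ℝ) • S.endB ⁅(A : LieAlg E G), (C : LieAlg E G)⁆) := by
      simp only [y, hx0, ha0, Submodule.coe_add, Submodule.coe_neg, Submodule.coe_smul, endB_apply]
      module
    have e3 : (S.projB ⁅(A : LieAlg E G), (y 0 : LieAlg E G)⁆ : LieAlg E G) =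
        -((1 / 2 : ℝ) • S.endB ⁅(A : LieAlg E G), S.endB ⁅(A : LieAlg E G),
          (C : LieAlg E G)⁆⁆) := by
      rw [← endB_apply, e2, lie_neg, lie_smul, map_neg, map_smul]
    rw [e3, e1]
    module
  rw [hval] at jac'
  have key : ∀ z, z = g → dprojLeft E' K z ((1 / 4 : ℝ) • S.endB ⁅(A : LieAlg E G), S.endB
      ⁅(A : LieAlg E G), (C : LieAlg E G)⁆⁆ + ⁅(A : LieAlg E G), (S.projK ⁅(A : LieAlg E G),
      (C : LieAlg E G)⁆ : LieAlg E G)⁆) + curvature nabla (QuotientGroup.mk z : G ⧸ K)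
      (dprojLeft E' K z (C : LieAlg E G)) (dprojLeft E' K z (A : LieAlg E G))
      (dprojLeft E' K z (A : LieAlg E G)) = 0 →
    curvature nabla (QuotientGroup.mk g : G ⧸ K) (dprojLeft E' K g (C : LieAlg E G))
      (dprojLeft E' K g (A : LieAlg E G)) (dprojLeft E' K g (A : LieAlg E G)) =
      -dprojLeft E' K g ((1 / 4 : ℝ) • S.endB ⁅(A : LieAlg E G), S.endB ⁅(A : LieAlg E G),
        (C : LieAlg E G)⁆⁆ + ⁅(A : LieAlg E G), (S.projK ⁅(A : LieAlg E G), (C : LieAlg E G)⁆ :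
          LieAlg E G)⁆) := by
    rintro _ rfl h
    exact eq_neg_of_add_eq_zero_right h
  exact key (h 0 * δ 0) (by rw [h0, hδ.initial, mul_one]) jac'

end NaturallyReductive

end HomogeneousJacobi

/-! ### The Jacobi equation in the Lie algebra and its isotropic solutions. -/

section JacobiCoordinates

set_option linter.unusedSectionVars false

variable {E : Type*} [NormedAddCommGroup E] [NormedSpace ℝ E] [FiniteDimensional ℝ E]
  {G : Type*} [TopologicalSpace G] [ChartedSpace E G] [Group G] [LieGroup 𝓘(ℝ, E) ∞ G]

theorem endE_pow_apply (L : Module.End ℝ (LieAlg E G)) (n : ℕ) (X : LieAlg E G) :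
    (endE E G L ^ n) (lieE E G X) = lieE E G ((L ^ n) X) := by
  induction n with
  | zero => rfl
  | succ n ih =>
    rw [pow_succ', pow_succ', mul_apply_eq_comp, ih, endE_apply, Module.End.mul_apply]

/-- Identifies the series with the operator exponential of the model space, whose derivative is
available. -/
theorem lieE_expEnd (L : Module.End ℝ (LieAlg E G)) (X : LieAlg E G) :
    lieE E G (expEnd L X) = NormedSpace.exp (endE E G L) (lieE E G X) := by
  have : CompleteSpace E := FiniteDimensional.complete ℝ E
  have : T2Space (LieAlg E G) := inferInstanceAs (T2Space E)
  have h1 := (NormedSpace.exp_series_hasSum_exp' (𝕂 := ℝ) (endE E G L)).mapL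
    (ContinuousLinearMap.apply ℝ E (lieE E G X))
  rw [expEnd, powerSeriesAt, (lieE E G).map_tsum]
  refine Eq.trans ?_ h1.tsum_eq
  congr 1
  funext n
  rw [map_smul, ContinuousLinearMap.apply_apply, smul_apply, endE_pow_apply, one_div]

theorem hasLieDerivAt_expEnd (L : Module.End ℝ (LieAlg E G)) (X : LieAlg E G) (t : ℝ) :
    HasLieDerivAt (fun s : ℝ => expEnd (-(s • L)) X) (-L (expEnd (-(t • L)) X)) t := by
  have : CompleteSpace E := FiniteDimensional.complete ℝ E
  have hL (s : ℝ) : endE E G (-(s • L)) = s • endE E G (-L) := by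
    ext v
    obtain ⟨X, rfl⟩ := (lieE E G).surjective v
    rw [endE_apply, smul_apply, endE_apply, ← map_smul (lieE E G)]
    simp
  have h1 := (hasDerivAt_exp_smul_const' (endE E G (-L)) t).clm_apply
    (hasDerivAt_const t (lieE E G X))
  rw [map_zero, add_zero] at h1
  have h2 : (fun s : ℝ => lieE E G (expEnd (-(s • L)) X)) =
      fun s : ℝ => NormedSpace.exp (s • endE E G (-L)) (lieE E G X) := by
    funext s
    rw [lieE_expEnd, hL]
  rw [HasLieDerivAt, h2]
  refine h1.congr_deriv ?_
  rw [mul_apply_eq_comp, ← hL, ← lieE_expEnd, endE_apply, LinearMap.neg_apply]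

theorem expEnd_zero (X : LieAlg E G) : expEnd 0 X = X := by
  apply (lieE E G).injective
  have h1 : endE E G 0 = 0 := by
    ext v
    exact map_zero (lieE E G)
  rw [lieE_expEnd, h1, NormedSpace.exp_zero]
  rfl

variable {K : Subgroup G}

namespace NaturallyReductive

variable {S : NaturallyReductive E K}

variable (S) in
/-- The projection of the Lie algebra onto `𝔨`, as an endomorphism. -/
def endK : Module.End ℝ (LieAlg E G) := S.𝔨.subtype ∘ₗ S.projK

theorem endK_apply (X : LieAlg E G) : S.endK X = S.projK X := rfl

theorem endK_of_mem_𝔟 {X : LieAlg E G} (hX : X ∈ S.𝔟) : S.endK X = 0 := by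
  have h1 := S.projB_add_projK X
  rw [S.projB_of_mem hX] at h1
  exact add_eq_left.1 h1

theorem endB_add_endK (X : LieAlg E G) : S.endB X + S.endK X = X := S.projB_add_projK X

theorem endB_lie_endK (A : S.𝔟) (X : LieAlg E G) :
    S.endB ⁅(A : LieAlg E G), S.endK X⁆ = ⁅(A : LieAlg E G), S.endK X⁆ :=
  S.projB_of_mem (S.lie_mem_of_mem_𝔨 A (S.projK X).2)

theorem endB_lie (A : S.𝔟) (X : LieAlg E G) :
    S.endB ⁅(A : LieAlg E G), X⁆ =
      S.endB ⁅(A : LieAlg E G), S.endB X⁆ + ⁅(A : LieAlg E G), S.endK X⁆ := by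
  conv_lhs => rw [← S.endB_add_endK X]
  rw [lie_add, map_add, endB_lie_endK]

/-- As `[A, 𝔨] ⊂ 𝔟`, the `𝔨`-part of a bracket with `A` sees only the `𝔟`-part of `X`. This is why
the equation for `(exp(-t ad_A) X)_𝔟` closes up. -/
theorem endK_lie (A : S.𝔟) (X : LieAlg E G) :
    S.endK ⁅(A : LieAlg E G), X⁆ = S.endK ⁅(A : LieAlg E G), S.endB X⁆ := by
  conv_lhs => rw [← S.endB_add_endK X]
  have h1 : ⁅(A : LieAlg E G), S.endK X⁆ ∈ S.𝔟 := S.lie_mem_of_mem_𝔨 A (S.projK X).2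
  rw [lie_add, map_add, endK_of_mem_𝔟 h1, add_zero]

/-- `x` is a solution in `𝔟` of the equation `x'' = [A, [A, x]_𝔨] - [A, x']_𝔟`, which is the Jacobi
equation for left-translated fields, with initial values `x 0 = C` and `x' 0 = C'`. -/
def IsJacobiCurve (A : S.𝔟) (C C' : LieAlg E G) (x : ℝ → LieAlg E G) : Prop :=
  x 0 = C ∧ ∃ x' : ℝ → LieAlg E G, x' 0 = C' ∧ (∀ t, HasLieDerivAt x (x' t) t) ∧
    ∀ t, HasLieDerivAt x' (⁅(A : LieAlg E G), S.endK ⁅(A : LieAlg E G), x t⁆⁆ -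
      S.endB ⁅(A : LieAlg E G), x' t⁆) t

theorem IsJacobiCurve.unique {A : S.𝔟} {C C' : LieAlg E G} {x y : ℝ → LieAlg E G}
    (hx : IsJacobiCurve A C C' x) (hy : IsJacobiCurve A C C' y) : x = y := by
  obtain ⟨x0, x', x0', hx, hx'⟩ := hx
  obtain ⟨y0, y', y0', hy, hy'⟩ := hy
  refine eq_of_hasLieDerivAt_second_order
    (adOp (A : LieAlg E G) ∘ₗ S.endK ∘ₗ adOp (A : LieAlg E G)) (-(S.endB ∘ₗ adOp (A : LieAlg E G)))
    hx (fun t => (hx' t).congr_deriv ?_) hy (fun t => (hy' t).congr_deriv ?_)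
    (x0.trans y0.symm) (x0'.trans y0'.symm)
  all_goals
    rw [sub_eq_add_neg]
    rfl

/-- With `w = exp(-t ad_A) X` one has `w' = -[A, w]`, so the second derivative of `w_𝔟` is `[A, [A,
w]]_𝔟`. Splitting the inner bracket into its two components gives the two terms of the equation. -/
theorem isJacobiCurve_expEnd (A : S.𝔟) (X : LieAlg E G) :
    IsJacobiCurve A (S.endB X) (-S.endB ⁅(A : LieAlg E G), X⁆)
      (fun t => S.endB (expEnd (-(t • adOp (A : LieAlg E G))) X)) := by
  have h0 : expEnd (-((0 : ℝ) • adOp (A : LieAlg E G))) X = X := by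
    rw [zero_smul, neg_zero, expEnd_zero]
  have hd (t : ℝ) := hasLieDerivAt_expEnd (adOp (A : LieAlg E G)) X t
  refine ⟨by simp only [h0], fun t => -S.endB ⁅(A : LieAlg E G),
    expEnd (-(t • adOp (A : LieAlg E G))) X⁆, by simp only [h0], fun t => ?_, fun t => ?_⟩
  · exact ((hd t).map S.endB).congr_deriv (map_neg _ _)
  · refine ((hd t).map (-(S.endB ∘ₗ adOp (A : LieAlg E G)))).congr_deriv ?_
    simp only [LinearMap.neg_apply, LinearMap.comp_apply, map_neg, neg_neg, adOp_apply, lie_neg,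
      sub_neg_eq_add]
    rw [endB_lie, endK_lie, add_comm]

/-- Both curves solve the same second-order linear equation, so they agree exactly when their values
and first derivatives at `0` do. -/
theorem isJacobiCurve_eq_expEnd_iff {A : S.𝔟} {C E₀ : S.𝔟} {x : ℝ → LieAlg E G}
    (hx : IsJacobiCurve A (C : LieAlg E G)
      ((E₀ : LieAlg E G) - (1 / 2 : ℝ) • S.endB ⁅(A : LieAlg E G), (C : LieAlg E G)⁆) x)
    (X : LieAlg E G) :
    (∀ t, x t = S.endB (expEnd (-(t • adOp (A : LieAlg E G))) X)) ↔ C = S.projB X ∧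
      (E₀ : LieAlg E G) = -((1 / 2 : ℝ) • (S.projB ⁅(A : LieAlg E G), (C : LieAlg E G)⁆
        : LieAlg E G)) - ⁅(A : LieAlg E G), (S.projK X : LieAlg E G)⁆ := by
  have hy := isJacobiCurve_expEnd A X
  constructor
  · intro h
    have hxy : x = fun t => S.endB (expEnd (-(t • adOp (A : LieAlg E G))) X) := funext h
    have hC : (C : LieAlg E G) = S.endB X := by rw [← hx.1, hxy, ← hy.1]
    refine ⟨Subtype.ext hC, ?_⟩
    obtain ⟨-, x', x0', hd, -⟩ := hx
    obtain ⟨-, y', y0', hd', -⟩ := hy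
    have h1 : x' 0 = y' 0 := (hd 0).unique (hxy ▸ hd' 0)
    rw [x0', y0', endB_lie A X, ← hC, sub_eq_iff_eq_add] at h1
    rw [h1, endK_apply, ← endB_apply]
    module
  · rintro ⟨hC, hE⟩ t
    have hC' : (C : LieAlg E G) = S.endB X := congrArg Subtype.val hC
    have h1 : (E₀ : LieAlg E G) - (1 / 2 : ℝ) • S.endB ⁅(A : LieAlg E G), (C : LieAlg E G)⁆ =
        -S.endB ⁅(A : LieAlg E G), X⁆ := by
      rw [hE, endB_lie A X, ← hC', endK_apply, ← endB_apply]
      module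
    rw [h1, hC'] at hx
    rw [hx.unique hy]

end NaturallyReductive

end JacobiCoordinates

/-! ### From lifted Jacobi fields to curves in the Lie algebra. -/

section LiftedJacobi

set_option linter.unusedSectionVars false

variable {E : Type*} [NormedAddCommGroup E] [NormedSpace ℝ E] [FiniteDimensional ℝ E]
  {E' : Type*} [NormedAddCommGroup E'] [NormedSpace ℝ E'] [FiniteDimensional ℝ E']
  {G : Type*} [TopologicalSpace G] [ChartedSpace E G] [Group G] [LieGroup 𝓘(ℝ, E) ∞ G]
  {K : Subgroup G} [ChartedSpace E' (G ⧸ K)] [IsManifold 𝓘(ℝ, E') ∞ (G ⧸ K)]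
  [Bundle.RiemannianBundle (fun p : G ⧸ K => TangentSpace 𝓘(ℝ, E') p)]
  [IsContMDiffRiemannianBundle 𝓘(ℝ, E') ∞ E' (fun p : G ⧸ K => TangentSpace 𝓘(ℝ, E') p)]
  {nabla : CovariantDerivative 𝓘(ℝ, E') E' (TangentSpace 𝓘(ℝ, E') : (G ⧸ K) → Type _)}

namespace NaturallyReductive

variable {S : NaturallyReductive E K}

theorem endB_eq_of_dprojLeft_eq
    (hq : Manifold.IsSubmersion 𝓘(ℝ, E) 𝓘(ℝ, E') ∞ (QuotientGroup.mk : G → G ⧸ K))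
    (hm : S.IsInducedMetric (E' := E')) {g : G} {X Y : LieAlg E G}
    (h : dprojLeft E' K g X = dprojLeft E' K g Y) : S.endB X = S.endB Y := by
  refine congrArg Subtype.val (dprojLeft_injective hm g (X := S.projB X) (Y := S.projB Y) ?_)
  rw [S.dprojLeft_projB hq.contMDiff, S.dprojLeft_projB hq.contMDiff, h]

/-- Applying `x ↦ x' + ½[A, x]_𝔟` twice and inserting the curvature, the two terms `¼[A, [A,
x]_𝔟]_𝔟` cancel and the constant-coefficient equation remains. -/
theorem IsLiftedJacobiField.exists_isJacobiCurve
    (hq : Manifold.IsSubmersion 𝓘(ℝ, E) 𝓘(ℝ, E') ∞ (QuotientGroup.mk : G → G ⧸ K))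
    (hm : S.IsInducedMetric (E' := E')) (hn : IsLeviCivita nabla) {U : G} {A : S.𝔟} {γ : ℝ → G}
    (hγ : IsExpCurve U (A : LieAlg E G) γ) {C E₀ : S.𝔟} {J : ∀ t, TangentSpace 𝓘(ℝ, E) (γ t)}
    (hJ : S.IsLiftedJacobiField nabla γ C E₀ J) :
    ∃ x : ℝ → LieAlg E G, (∀ t, J t = leftTranslate (γ t) (x t)) ∧
      IsJacobiCurve A (C : LieAlg E G)
        ((E₀ : LieAlg E G) - (1 / 2 : ℝ) • S.endB ⁅(A : LieAlg E G), (C : LieAlg E G)⁆) x := by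
  choose x hx using hJ.horizontal
  -- The curvature formula uses the one-parameter group of `A`, recovered by translating `γ` back to
  -- the identity.
  have hδ : IsExpCurve 1 (A : LieAlg E G) (fun t => U⁻¹ * γ t) := by
    have := hγ.mul_left U⁻¹
    rwa [inv_mul_cancel] at this
  have hxb (t : ℝ) : S.endB (x t) = x t := S.projB_of_mem (x t).2
  have hsm : ContDiff ℝ ∞ (fun t => lieE E G (x t : LieAlg E G)) := by
    rw [contDiff_iff_contDiffAt]
    intro t
    refine contDiffAt_of_leftTranslate hγ.contMDiff.contMDiffAt (mem_chart_source E (γ t)) ?_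
    refine (hJ.smooth.contDiffAt_tr t).congr_of_eventuallyEq (Filter.Eventually.of_forall fun s => ?_)
    exact congrArg (tr (γ t) (γ s)) (hx s).symm
  let x' : ℝ → LieAlg E G := fun t =>
    (lieE E G).symm (deriv (fun t => lieE E G (x t : LieAlg E G)) t)
  have hd (t : ℝ) : HasLieDerivAt (fun t => (x t : LieAlg E G)) (x' t) t :=
    (hsm.differentiable (by simp) t).hasDerivAt
  have hsm' : ContDiff ℝ ∞ (fun t => lieE E G (x' t)) := (contDiff_infty_iff_deriv.1 hsm).2
  let x'' : ℝ → LieAlg E G := fun t => (lieE E G).symm (deriv (fun t => lieE E G (x' t)) t)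
  have hd' (t : ℝ) : HasLieDerivAt x' (x'' t) t := (hsm'.differentiable (by simp) t).hasDerivAt
  -- The projection to `𝔟` is linear and fixes `x`, so it fixes the derivatives of `x` too.
  have hb' (t : ℝ) : S.endB (x' t) = x' t := by
    have h1 := (hd t).map S.endB
    simp only [hxb] at h1
    exact h1.unique (hd t)
  have hb'' (t : ℝ) : S.endB (x'' t) = x'' t := by
    have h1 := (hd' t).map S.endB
    simp only [hb'] at h1
    exact h1.unique (hd' t)
  let y : ℝ → S.𝔟 := fun t => S.projB (x' t) +
    (1 / 2 : ℝ) • S.projB ⁅(A : LieAlg E G), (x t : LieAlg E G)⁆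
  have hy (t : ℝ) : (y t : LieAlg E G) =
      x' t + (1 / 2 : ℝ) • S.endB ⁅(A : LieAlg E G), (x t : LieAlg E G)⁆ := by
    conv_rhs => rw [← hb']
    rfl
  have hyd (t : ℝ) : HasLieDerivAt (fun t => (y t : LieAlg E G))
      (x'' t + (1 / 2 : ℝ) • S.endB ⁅(A : LieAlg E G), x' t⁆) t := by
    have h1 := (hd' t).add
      (((hd t).map (S.endB ∘ₗ adOp (A : LieAlg E G))).const_smul (1 / 2))
    have h2 : (fun t => (y t : LieAlg E G)) = fun t => x' t +
      (1 / 2 : ℝ) • S.endB ⁅(A : LieAlg E G), (x t : LieAlg E G)⁆ := funext hy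
    rw [h2]
    exact h1
  have hJx : (fun t => dproj E K E' (γ t) (J t)) =
      fun t => dprojLeft E' K (γ t) (x t : LieAlg E G) := by
    funext t
    rw [hx t]
    rfl
  have hD : covDerivAlong nabla (fun t => (QuotientGroup.mk (γ t) : G ⧸ K))
      (fun t => dprojLeft E' K (γ t) (x t : LieAlg E G)) =
      fun t => dprojLeft E' K (γ t) (y t : LieAlg E G) := by
    funext t
    rw [covDerivAlong_dprojLeft hq hm hn hγ (hd t), hy]
    rfl
  have hx0 : x 0 = C := by
    have h1 := (hx 0).symm.trans hJ.value_zero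
    exact Subtype.ext (leftTranslate_injective _ h1)
  refine ⟨fun t => x t, hx, congrArg Subtype.val hx0, x', ?_, hd, fun t => ?_⟩
  · have h1 := hJ.deriv_zero
    rw [hJx, hD] at h1
    have h2 : y 0 = E₀ := dprojLeft_injective hm _ h1
    have h3 := hy 0
    rw [h2, hx0] at h3
    exact eq_sub_of_add_eq h3.symm
  · have h1 := hJ.jacobi.equation t
    have h2 : dproj E K E' (γ t) (J t) = dprojLeft E' K (γ t) (x t : LieAlg E G) := congrFun hJx t
    rw [hJx, hD, covDerivAlong_dprojLeft hq hm hn hγ (hyd t), velocity_mk hq hγ,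
      h2, curvature_dprojLeft hq hm hn hδ, add_neg_eq_zero] at h1
    have h3 := endB_eq_of_dprojLeft_eq hq hm h1
    rw [← endB_apply, hy, ← endK_apply] at h3
    simp only [lie_add, lie_smul, map_add, map_smul, hb'', endB_lie_endK] at h3
    have hbb (X : LieAlg E G) : S.endB (S.endB X) = S.endB X := S.projB_of_mem (S.projB X).2
    simp only [hbb] at h3
    refine (hd' t).congr_deriv ?_
    rw [eq_sub_iff_add_eq]
    have h4 : x'' t + S.endB ⁅(A : LieAlg E G), x' t⁆ = (x'' t + (1 / 2 : ℝ) • S.endB ⁅(A : LieAlg E G), x' t⁆ +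
        (1 / 2 : ℝ) • (S.endB ⁅(A : LieAlg E G), x' t⁆ + (1 / 2 : ℝ) • S.endB ⁅(A : LieAlg E G),
          S.endB ⁅(A : LieAlg E G), (x t : LieAlg E G)⁆⁆)) - (1 / 4 : ℝ) • S.endB ⁅(A : LieAlg E G),
          S.endB ⁅(A : LieAlg E G), (x t : LieAlg E G)⁆⁆ := by module
    rw [h4, h3]
    abel

theorem isIsotropic_iff {A : S.𝔟} {γ : ℝ → G} {J : ∀ t, TangentSpace 𝓘(ℝ, E) (γ t)}
    {x : ℝ → LieAlg E G} (hJx : ∀ t, J t = leftTranslate (γ t) (x t)) {C E₀ : S.𝔟}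
    (hx : IsJacobiCurve A (C : LieAlg E G)
      ((E₀ : LieAlg E G) - (1 / 2 : ℝ) • S.endB ⁅(A : LieAlg E G), (C : LieAlg E G)⁆) x) :
    S.IsIsotropic A γ J ↔ ∃ X : LieAlg E G, C = S.projB X ∧
      (E₀ : LieAlg E G) = -((1 / 2 : ℝ) • (S.projB ⁅(A : LieAlg E G), (C : LieAlg E G)⁆
        : LieAlg E G)) - ⁅(A : LieAlg E G), (S.projK X : LieAlg E G)⁆ := by
  refine exists_congr fun X => Iff.trans ?_ (isJacobiCurve_eq_expEnd_iff hx X)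
  refine forall_congr' fun t => ?_
  rw [hJx t]
  exact (leftTranslate_injective (γ t)).eq_iff

end NaturallyReductive

end LiftedJacobi

/-! ### Real and imaginary parts in the complexification. -/

section Complexification

variable {V : Type*} [AddCommGroup V] [Module ℝ V]

/-- The real part of a vector of the complexification. -/
def tensorRe (V : Type*) [AddCommGroup V] [Module ℝ V] : ℂ ⊗[ℝ] V →ₗ[ℝ] V :=
  (TensorProduct.lid ℝ V : ℝ ⊗[ℝ] V →ₗ[ℝ] V) ∘ₗ Complex.reLm.rTensor V

/-- The imaginary part of a vector of the complexification. -/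
def tensorIm (V : Type*) [AddCommGroup V] [Module ℝ V] : ℂ ⊗[ℝ] V →ₗ[ℝ] V :=
  (TensorProduct.lid ℝ V : ℝ ⊗[ℝ] V →ₗ[ℝ] V) ∘ₗ Complex.imLm.rTensor V

theorem tensorRe_tmul (z : ℂ) (v : V) : tensorRe V (z ⊗ₜ v) = z.re • v := by
  simp [tensorRe]

theorem tensorIm_tmul (z : ℂ) (v : V) : tensorIm V (z ⊗ₜ v) = z.im • v := by
  simp [tensorIm]

theorem exists_eq_tmul_add (w : ℂ ⊗[ℝ] V) :
    ∃ a b : V, w = (1 : ℂ) ⊗ₜ[ℝ] a + Complex.I ⊗ₜ[ℝ] b := by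
  induction w using TensorProduct.induction_on with
  | zero => exact ⟨0, 0, by simp⟩
  | tmul z v =>
    refine ⟨z.re • v, z.im • v, ?_⟩
    rw [← TensorProduct.smul_tmul, ← TensorProduct.smul_tmul, ← TensorProduct.add_tmul]
    congr 1
    rw [Complex.real_smul, Complex.real_smul, mul_one, Complex.re_add_im]
  | add x y hx hy =>
    obtain ⟨a, b, rfl⟩ := hx
    obtain ⟨c, d, rfl⟩ := hy
    exact ⟨a + c, b + d, by rw [TensorProduct.tmul_add, TensorProduct.tmul_add]; abel⟩

theorem eq_of_baseChange_eigen {B : Module.End ℝ V} {μ : ℂ} {a b : V}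
    (h : B.baseChange ℂ ((1 : ℂ) ⊗ₜ[ℝ] a + Complex.I ⊗ₜ[ℝ] b) =
      μ • ((1 : ℂ) ⊗ₜ[ℝ] a + Complex.I ⊗ₜ[ℝ] b)) :
    B a = μ.re • a - μ.im • b ∧ B b = μ.im • a + μ.re • b := by
  rw [map_add, LinearMap.baseChange_tmul, LinearMap.baseChange_tmul, smul_add,
    TensorProduct.smul_tmul', TensorProduct.smul_tmul'] at h
  have h1 := congrArg (tensorRe V) h
  have h2 := congrArg (tensorIm V) h
  simp only [map_add, tensorRe_tmul, tensorIm_tmul] at h1 h2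
  simp at h1 h2
  exact ⟨by rw [h1, sub_eq_add_neg], h2⟩

end Complexification

/-! ### The spectrum of `ad_A^𝔟` and the series `𝒵` on its eigenvectors. -/

section Eigen

set_option linter.unusedSectionVars false

variable {E : Type*} [NormedAddCommGroup E] [NormedSpace ℝ E] [FiniteDimensional ℝ E]
  {G : Type*} [TopologicalSpace G] [ChartedSpace E G] [Group G] [LieGroup 𝓘(ℝ, E) ∞ G]
  {K : Subgroup G}

theorem _root_.HasSum.congr_terms {ι M : Type*} [AddCommMonoid M] [TopologicalSpace M]
    {f g : ι → M} {a : M} (h : HasSum f a) (hfg : ∀ i, g i = f i) : HasSum g a :=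
  (funext hfg : g = f) ▸ h

theorem calZ_zero (V : LieAlg E G) : calZ 0 V = V := by
  have : T2Space (LieAlg E G) := inferInstanceAs (T2Space E)
  rw [calZ, powerSeriesAt, tsum_eq_single 0]
  · simp
  · intro n hn
    rw [zero_pow hn]
    simp

/-- Since `L² V = -r² (V + D)` and `L D = 0`, the even powers of `L` on `V` are multiples of `V + D`
except for the zeroth, and the odd powers are multiples of `L V`. The two halves of the series are
those of `sin r / r` and `(1 - cos r) / r²`. -/
theorem calZ_eq {L : Module.End ℝ (LieAlg E G)} {V D : LieAlg E G} {r : ℝ} (hr : r ≠ 0)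
    (hL : L (L V) = -(r ^ 2 • (V + D))) (hD : L D = 0) :
    calZ L V = (Real.sin r / r) • (V + D) - D - ((1 - Real.cos r) / r ^ 2) • L V := by
  have hT : T2Space (LieAlg E G) := inferInstanceAs (T2Space E)
  have hodd (k : ℕ) : (L ^ (2 * k + 1)) V = ((-1) ^ k * r ^ (2 * k)) • L V := by
    induction k with
    | zero => simp
    | succ k ih =>
      have : 2 * (k + 1) + 1 = (2 * k + 1) + 1 + 1 := by ring
      rw [this, pow_succ', pow_succ', Module.End.mul_apply, Module.End.mul_apply, ih, map_smul,
        map_smul, hL, map_neg, map_smul, map_add, hD, add_zero, smul_neg, smul_smul, ← neg_smul]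
      congr 1
      ring
  -- For `k = 0` the power gives `V` and not `V + D`; the indicator removes the extra `D`.
  have heven (k : ℕ) : (L ^ (2 * k)) V =
      ((-1) ^ k * r ^ (2 * k)) • (V + D) - (if k = 0 then (1 : ℝ) else 0) • D := by
    rcases k with _ | k
    · simp
    · have : 2 * (k + 1) = (2 * k + 1) + 1 := by ring
      rw [this, pow_succ', Module.End.mul_apply, hodd, map_smul, hL, if_neg (Nat.succ_ne_zero k),
        zero_smul, sub_zero, ← neg_smul, smul_smul]
      congr 1
      ring
  have hs : HasSum (fun k : ℕ => ((-1) ^ k * r ^ (2 * k)) / ((2 * k + 1).factorial : ℝ))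
      (Real.sin r / r) := by
    refine ((Real.hasSum_sin r).div_const r).congr_terms fun k => ?_
    field_simp
    try ring
  have hc : HasSum (fun k : ℕ => ((-1) ^ k * r ^ (2 * k)) / ((2 * k + 2).factorial : ℝ))
      ((1 - Real.cos r) / r ^ 2) := by
    -- The cosine series without its constant term, negated and divided by `r²`.
    have h1 := ((hasSum_nat_add_iff' 1).2 (Real.hasSum_cos r)).neg.div_const (r ^ 2)
    simp only [Finset.range_one, Finset.sum_singleton, mul_zero, pow_zero, Nat.factorial_zero,
      Nat.cast_one, div_one, mul_one, neg_sub] at h1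
    refine h1.congr_terms fun k => ?_
    rw [mul_add, mul_one]
    field_simp
    ring
  apply (lieE E G).injective
  rw [calZ, powerSeriesAt, (lieE E G).map_tsum]
  have h1 := (hs.smul_const (lieE E G (V + D))).sub
    ((hasSum_ite_eq 0 (1 : ℝ)).smul_const (lieE E G D))
  have h2 := (hc.smul_const (lieE E G (L V))).neg
  have h3 : HasSum (fun n => lieE E G (((-1) ^ n / ((n + 1).factorial : ℝ)) • (L ^ n) V))
      ((Real.sin r / r) • lieE E G (V + D) - (1 : ℝ) • lieE E G D +
        -(((1 - Real.cos r) / r ^ 2) • lieE E G (L V))) := by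
    refine HasSum.even_add_odd ?_ ?_
    · refine h1.congr_terms fun k => ?_
      rw [heven, map_smul, map_sub, map_smul, map_smul, smul_sub, smul_smul, smul_smul,
        Even.neg_one_pow (even_two_mul k)]
      rcases k with _ | k
      · simp
      · simp only [Nat.add_eq_zero_iff, one_ne_zero, and_false, if_false, mul_zero, zero_smul]
        congr 2
        ring
    · refine h2.congr_terms fun k => ?_
      rw [hodd, map_smul, map_smul, smul_smul, ← neg_smul,
        Odd.neg_one_pow (odd_two_mul_add_one k)]
      congr 1
      ring
  rw [h3.tsum_eq]
  simp only [map_sub, map_smul]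
  module

namespace NaturallyReductive

variable {S : NaturallyReductive E K}

theorem form_adB_left (A X Y : S.𝔟) : S.form (S.adB A X) Y = -S.form X (S.adB A Y) :=
  eq_neg_of_add_eq_zero_left (S.form_adB A X Y)

theorem form_adB_self (A X : S.𝔟) : S.form (S.adB A X) X = 0 := by
  have h1 := form_adB_left A X X
  rw [S.form_symm X] at h1
  linarith

theorem form_self_nonneg (X : S.𝔟) : 0 ≤ S.form X X := by
  rcases eq_or_ne X 0 with rfl | h
  · simp
  · exact (S.form_pos X h).le

/-- For an eigenvector `a + i b`, skewness gives `⟨B a, a⟩ = ⟨B b, b⟩ = 0` with `B = ad_A^𝔟`. Adding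
the two cancels the imaginary part of `μ` and leaves `Re μ (|a|² + |b|²) = 0`. -/
theorem re_eq_zero_of_hasEigenvalue (A : S.𝔟) {μ : ℂ}
    (h : Module.End.HasEigenvalue ((S.adB A).baseChange ℂ) μ) : μ.re = 0 := by
  obtain ⟨w, hw⟩ := h.exists_hasEigenvector
  obtain ⟨a, b, rfl⟩ := exists_eq_tmul_add w
  obtain ⟨h1, h2⟩ := eq_of_baseChange_eigen hw.apply_eq_smul
  have h3 := form_adB_self A a
  have h4 := form_adB_self A b
  rw [h1] at h3
  rw [h2] at h4
  simp only [map_sub, map_add, map_smul, LinearMap.sub_apply, LinearMap.add_apply,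
    LinearMap.smul_apply, smul_eq_mul] at h3 h4
  rw [S.form_symm b a] at h3
  have h5 : μ.re * (S.form a a + S.form b b) = 0 := by linarith
  rcases mul_eq_zero.1 h5 with h6 | h6
  · exact h6
  · have ha := form_self_nonneg (S := S) a
    have hb := form_self_nonneg (S := S) b
    have ha0 := S.form_self_eq_zero (X := a) (by linarith)
    have hb0 := S.form_self_eq_zero (X := b) (by linarith)
    exact absurd (by rw [ha0, hb0]; simp) hw.2

theorem adB_eq_of_hasEigenvector {A V Vs : S.𝔟} {lam : ℝ}
    (h : Module.End.HasEigenvector ((S.adB A).baseChange ℂ) (lam * Complex.I)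
      ((1 : ℂ) ⊗ₜ[ℝ] V + Complex.I ⊗ₜ[ℝ] Vs)) :
    S.endB ⁅(A : LieAlg E G), (V : LieAlg E G)⁆ = -(lam • (Vs : LieAlg E G)) ∧
      S.endB ⁅(A : LieAlg E G), (Vs : LieAlg E G)⁆ = lam • (V : LieAlg E G) := by
  obtain ⟨h1, h2⟩ := eq_of_baseChange_eigen h.apply_eq_smul
  simp at h1 h2
  exact ⟨congrArg Subtype.val h1, congrArg Subtype.val h2⟩

/-- Here `[A, [A, V]] = -λ² (V + λ⁻¹ D)` with `D = [A, V_*]_𝔨` killed by `ad_A`, so `calZ_eq`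
applies with `r = tλ`. Projecting to `𝔟` removes `D`. -/
theorem projB_calZ {A V Vs : S.𝔟} {lam t : ℝ} (hlam : lam ≠ 0) (ht : t ≠ 0)
    (h1 : S.endB ⁅(A : LieAlg E G), (V : LieAlg E G)⁆ = -(lam • (Vs : LieAlg E G)))
    (h2 : S.endB ⁅(A : LieAlg E G), (Vs : LieAlg E G)⁆ = lam • (V : LieAlg E G))
    (hDs : ⁅(A : LieAlg E G), S.endK ⁅(A : LieAlg E G), (V : LieAlg E G)⁆⁆ = 0)
    (hD : ⁅(A : LieAlg E G), S.endK ⁅(A : LieAlg E G), (Vs : LieAlg E G)⁆⁆ = 0) :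
    S.projB (calZ (t • adOp (A : LieAlg E G)) (V : LieAlg E G)) =
      (Real.sin (t * lam) / (t * lam)) • V - (t * ((1 - Real.cos (t * lam)) / (t * lam) ^ 2)) •
        S.projB ⁅(A : LieAlg E G), (V : LieAlg E G)⁆ := by
  let D := S.endK ⁅(A : LieAlg E G), (Vs : LieAlg E G)⁆
  have hDK : S.projB D = 0 := S.projB_of_mem_𝔨 (S.projK _).2
  have e1 : ⁅(A : LieAlg E G), ⁅(A : LieAlg E G), (V : LieAlg E G)⁆⁆ =
      -(lam ^ 2 • ((V : LieAlg E G) + lam⁻¹ • D)) := by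
    rw [← S.endB_add_endK ⁅(A : LieAlg E G), (V : LieAlg E G)⁆, lie_add, hDs, add_zero, h1, lie_neg,
      lie_smul, ← S.endB_add_endK ⁅(A : LieAlg E G), (Vs : LieAlg E G)⁆, h2, smul_add, smul_add,
      smul_smul, smul_smul, sq, mul_assoc, mul_inv_cancel₀ hlam, mul_one]
  have key := calZ_eq (L := t • adOp (A : LieAlg E G)) (V := (V : LieAlg E G)) (D := lam⁻¹ • D)
    (mul_ne_zero ht hlam) (by
      simp only [LinearMap.smul_apply, map_smul, adOp_apply]
      rw [e1, smul_neg, smul_neg, smul_smul, smul_smul]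
      congr 2
      ring) (by
      rw [map_smul, LinearMap.smul_apply, adOp_apply, hD, smul_zero, smul_zero])
  rw [key, map_sub, map_sub, map_smul, map_smul, map_smul, map_add, map_smul, hDK, smul_zero, add_zero,
    sub_zero, projB_coe, LinearMap.smul_apply, S.projB.map_smul t, smul_smul, adOp_apply,
    mul_comm t ((1 - Real.cos (t * lam)) / (t * lam) ^ 2)]

/-- The derivative is `cos(tλ) V + sin(tλ) V_*`, which rotates in the plane where `ad_A^𝔟` acts as a
rotation; the `𝔨`-term of the equation vanishes by hypothesis. -/
theorem isJacobiCurve_sin_cos {A V Vs : S.𝔟} {lam : ℝ} (hlam : lam ≠ 0)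
    (h1 : S.endB ⁅(A : LieAlg E G), (V : LieAlg E G)⁆ = -(lam • (Vs : LieAlg E G)))
    (h2 : S.endB ⁅(A : LieAlg E G), (Vs : LieAlg E G)⁆ = lam • (V : LieAlg E G))
    (hDs : ⁅(A : LieAlg E G), S.endK ⁅(A : LieAlg E G), (V : LieAlg E G)⁆⁆ = 0)
    (hD : ⁅(A : LieAlg E G), S.endK ⁅(A : LieAlg E G), (Vs : LieAlg E G)⁆⁆ = 0) :
    IsJacobiCurve A 0 (V : LieAlg E G) (fun t =>
      (Real.sin (t * lam) / lam) • (V : LieAlg E G) +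
        ((1 - Real.cos (t * lam)) / lam) • (Vs : LieAlg E G)) := by
  have hlin (t : ℝ) : HasDerivAt (fun t : ℝ => t * lam) lam t := hasDerivAt_mul_const lam
  have hs (t : ℝ) : HasDerivAt (fun t : ℝ => Real.sin (t * lam)) (Real.cos (t * lam) * lam) t :=
    (hlin t).sin
  have hc (t : ℝ) : HasDerivAt (fun t : ℝ => Real.cos (t * lam)) (-Real.sin (t * lam) * lam) t :=
    (hlin t).cos
  refine ⟨by simp, fun t => Real.cos (t * lam) • (V : LieAlg E G) +
    Real.sin (t * lam) • (Vs : LieAlg E G), by simp, fun t => ?_, fun t => ?_⟩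
  · refine (hasLieDerivAt_smul_const (((hs t).div_const lam).congr_deriv ?_) _).add
      (hasLieDerivAt_smul_const ((((hc t).const_sub 1).div_const lam).congr_deriv ?_) _)
    · field_simp
    · field_simp
  · refine ((hasLieDerivAt_smul_const (hc t) _).add (hasLieDerivAt_smul_const (hs t) _)).congr_deriv
      ?_
    simp only [lie_add, lie_smul, map_add, map_smul, h1, h2, hDs, hD, smul_zero, add_zero]
    module

end NaturallyReductive

end Eigen

end NatRed

end

open NatRed.NaturallyReductive

/-! ### The two claims assembled. -/

theorem mainTheorem12
    {E : Type*} [NormedAddCommGroup E] [NormedSpace ℝ E] [FiniteDimensional ℝ E]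
    {E' : Type*} [NormedAddCommGroup E'] [NormedSpace ℝ E'] [FiniteDimensional ℝ E']
    {G : Type*} [TopologicalSpace G] [T2Space G] [ChartedSpace E G] [Group G]
    [LieGroup 𝓘(ℝ, E) ∞ G]
    (K : Subgroup G) (hK : IsClosed (K : Set G))
    [ConnectedSpace (G ⧸ K)] [ChartedSpace E' (G ⧸ K)] [IsManifold 𝓘(ℝ, E') ∞ (G ⧸ K)]
    (hq : Manifold.IsSubmersion 𝓘(ℝ, E) 𝓘(ℝ, E') ∞ (QuotientGroup.mk : G → G ⧸ K))
    (S : NaturallyReductive E K)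
    [Bundle.RiemannianBundle (fun p : G ⧸ K => TangentSpace 𝓘(ℝ, E') p)]
    [IsContMDiffRiemannianBundle 𝓘(ℝ, E') ∞ E' (fun p : G ⧸ K => TangentSpace 𝓘(ℝ, E') p)]
    (hmetric : S.IsInducedMetric (E' := E'))
    (nabla : CovariantDerivative 𝓘(ℝ, E') E' (TangentSpace 𝓘(ℝ, E') : (G ⧸ K) → Type _))
    (hnabla : IsLeviCivita nabla) :
    (∀ (U : G) (A : S.𝔟) (γ : ℝ → G), IsExpCurve U (A : LieAlg E G) γ →
      IsGeodesic nabla (fun t => (QuotientGroup.mk (γ t) : G ⧸ K)) ∧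
      (∀ (C E₀ : S.𝔟) (J : ∀ t, TangentSpace 𝓘(ℝ, E) (γ t)),
        S.IsLiftedJacobiField nabla γ C E₀ J →
        (S.IsIsotropic A γ J ↔ ∃ X : LieAlg E G, C = S.projB X ∧
          (E₀ : LieAlg E G) = -((1 / 2 : ℝ) • (S.projB ⁅(A : LieAlg E G), (C : LieAlg E G)⁆
            : LieAlg E G)) - ⁅(A : LieAlg E G), (S.projK X : LieAlg E G)⁆)) ∧
      (∀ (E₀ : S.𝔟) (J : ∀ t, TangentSpace 𝓘(ℝ, E) (γ t)),
        S.IsLiftedJacobiField nabla γ 0 E₀ J →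
        (S.IsIsotropic A γ J ↔ ∃ D ∈ S.𝔨, (E₀ : LieAlg E G) = -⁅(A : LieAlg E G), D⁆)) ∧
      (∀ (C : S.𝔟) (J : ∀ t, TangentSpace 𝓘(ℝ, E) (γ t)),
        S.IsLiftedJacobiField nabla γ C
          (-((1 / 2 : ℝ) • S.projB ⁅(A : LieAlg E G), (C : LieAlg E G)⁆)) J →
        S.IsIsotropic A γ J)) ∧
    (∀ A : S.𝔟,
      (∀ X Y : S.𝔟, S.form (S.adB A X) Y = -S.form X (S.adB A Y)) ∧
      (∀ μ : ℂ, Module.End.HasEigenvalue ((S.adB A).baseChange ℂ) μ → μ.re = 0) ∧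
      (∀ (lam : ℝ) (V Vs : S.𝔟), lam ≠ 0 →
        Module.End.HasEigenvector ((S.adB A).baseChange ℂ) (lam * Complex.I)
          ((1 : ℂ) ⊗ₜ[ℝ] V + Complex.I ⊗ₜ[ℝ] Vs) →
        ∃ D ∈ S.𝔨, ∃ Ds ∈ S.𝔨,
          ⁅(A : LieAlg E G), (V : LieAlg E G)⁆ = -(lam • (Vs : LieAlg E G)) + Ds ∧
          ⁅(A : LieAlg E G), (Vs : LieAlg E G)⁆ = lam • (V : LieAlg E G) + D ∧
          (((⁅(A : LieAlg E G), Ds⁆ = 0 ∧ ⁅(A : LieAlg E G), D⁆ = 0) ∨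
              (∀ W ∈ S.𝔨, ⁅(A : LieAlg E G), W⁆ = 0)) →
            (∀ t : ℝ, t ≠ 0 →
              S.projB (calZ (t • adOp (A : LieAlg E G)) (V : LieAlg E G)) =
                (Real.sin (t * lam) / (t * lam)) • V
                  - (t * ((1 - Real.cos (t * lam)) / (t * lam) ^ 2)) •
                    S.projB ⁅(A : LieAlg E G), (V : LieAlg E G)⁆) ∧
            S.projB (calZ ((0 : ℝ) • adOp (A : LieAlg E G)) (V : LieAlg E G)) = V ∧
            (∀ (k : ℤ) (t : ℝ), t = 2 * k * Real.pi / lam →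
              t • S.projB (calZ (t • adOp (A : LieAlg E G)) (V : LieAlg E G)) = 0 ∧
              ∀ (U : G) (γ : ℝ → G), IsExpCurve U (A : LieAlg E G) γ →
                ∀ J : ∀ t, TangentSpace 𝓘(ℝ, E) (γ t),
                  S.IsLiftedJacobiField nabla γ 0 V J → J t = 0)))) := by
  refine ⟨fun U A γ hγ => ⟨isGeodesic_mk hq hmetric hnabla hγ, ?_, ?_, ?_⟩, fun A => ⟨?_, ?_, ?_⟩⟩
  · intro C E₀ J hJ
    obtain ⟨x, hJx, hx⟩ := hJ.exists_isJacobiCurve hq hmetric hnabla hγ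
    exact isIsotropic_iff hJx hx
  · intro E₀ J hJ
    obtain ⟨x, hJx, hx⟩ := hJ.exists_isJacobiCurve hq hmetric hnabla hγ
    rw [isIsotropic_iff hJx hx]
    simp only [Submodule.coe_zero, lie_zero, map_zero, smul_zero, neg_zero, zero_sub]
    constructor
    · rintro ⟨X, -, h⟩
      exact ⟨S.projK X, (S.projK X).2, h⟩
    · rintro ⟨D, hD, h⟩
      have hB : S.projB D = 0 := S.projB_of_mem_𝔨 hD
      have hK' : (S.projK D : LieAlg E G) = D := by
        have := S.projB_add_projK D
        rwa [hB, Submodule.coe_zero, zero_add] at this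
      exact ⟨D, hB.symm, by rw [hK', h]⟩
  · intro C J hJ
    obtain ⟨x, hJx, hx⟩ := hJ.exists_isJacobiCurve hq hmetric hnabla hγ
    -- The witness `X = C` has no `𝔨`-component, so the last term drops.
    refine (isIsotropic_iff hJx hx).2 ⟨C, (S.projB_coe C).symm, ?_⟩
    have h0 : (S.projK (C : LieAlg E G) : LieAlg E G) = 0 := S.endK_of_mem_𝔟 C.2
    rw [h0, lie_zero, sub_zero]
    rfl
  · exact form_adB_left A
  · exact fun μ h => re_eq_zero_of_hasEigenvalue A h
  · intro lam V Vs hlam h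
    obtain ⟨h1, h2⟩ := adB_eq_of_hasEigenvector h
    -- `D` and `D_*` are the `𝔨`-components of `[A, V_*]` and `[A, V]`.
    refine ⟨S.endK ⁅(A : LieAlg E G), (Vs : LieAlg E G)⁆, (S.projK _).2,
      S.endK ⁅(A : LieAlg E G), (V : LieAlg E G)⁆, (S.projK _).2, ?_, ?_, fun hcomm => ?_⟩
    · rw [← h1, endB_add_endK]
    · rw [← h2, endB_add_endK]
    · obtain ⟨hDs, hD⟩ : ⁅(A : LieAlg E G), S.endK ⁅(A : LieAlg E G), (V : LieAlg E G)⁆⁆ = 0 ∧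
          ⁅(A : LieAlg E G), S.endK ⁅(A : LieAlg E G), (Vs : LieAlg E G)⁆⁆ = 0 :=
        hcomm.elim id fun h0 => ⟨h0 _ (S.projK _).2, h0 _ (S.projK _).2⟩
      refine ⟨fun t ht => projB_calZ hlam ht h1 h2 hDs hD, ?_, fun k t ht => ?_⟩
      · rw [zero_smul, calZ_zero, projB_coe]
      · have htl : t * lam = k * (2 * Real.pi) := by
          rw [ht]
          field_simp
        have hcos : Real.cos (t * lam) = 1 := by rw [htl, Real.cos_int_mul_two_pi]
        have hsin : Real.sin (t * lam) = 0 := by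
          rw [htl, ← mul_assoc]
          exact_mod_cast Real.sin_int_mul_pi (k * 2)
        refine ⟨?_, fun U γ hγ J hJ => ?_⟩
        -- The closed formula needs `t ≠ 0`; at `t = 0`, which is the case `k = 0`, the factor `t`
        -- already gives zero.
        · rcases eq_or_ne t 0 with rfl | ht0
          · rw [zero_smul]
          · rw [projB_calZ hlam ht0 h1 h2 hDs hD, hsin, hcos]
            simp
        · obtain ⟨x, hJx, hx⟩ := hJ.exists_isJacobiCurve hq hmetric hnabla hγ
          have hV : (V : LieAlg E G) - (1 / 2 : ℝ) • S.endB ⁅(A : LieAlg E G),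
              ((0 : S.𝔟) : LieAlg E G)⁆ = V := by
            rw [Submodule.coe_zero, lie_zero, map_zero, smul_zero, sub_zero]
          rw [hV, Submodule.coe_zero] at hx
          -- By uniqueness `x` is the explicit sine and cosine solution, and both of its
          -- coefficients vanish at this time.
          have hxt : x t = 0 := by
            rw [hx.unique (isJacobiCurve_sin_cos hlam h1 h2 hDs hD)]
            simp only [hsin, hcos, sub_self, zero_div, zero_smul, add_zero]
          exact (hJx t).trans
            ((congrArg (leftTranslate (γ t)) hxt).trans (map_zero (leftTranslateL (γ t))))
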